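/- For $r,d\ge 0$ let $F_r$ be the free group on $X_r=\{x_1,\dots,x_r\}$, let $F_r^{(0)}=F_r$ and $F_r^{(i+1)}=[F_r^{(i)},F_r^{(i)}]$, and let $S_{r,d}=F_r/F_r^{(d)}$ be the free solvable group of rank $r$ and class $d$. A word $w$ in $x_1^{\pm1},\dots,x_r^{\pm1}$ of length $|w|$ (reduced or not) is encoded by a bit-string $\mathrm{code}(w)$, the concatenation of the codes of its letters, each of length $\lceil\log_2 r\rceil+1$ (a sign bit followed by the binary digits of the index; $\lceil\log_2 0\rceil$ is read as $0$), so that $|\mathrm{code}(w)|=|w|(\lceil\log_2 r\rceil+1)$. Time is the bit cost on a deterministic random access machine: it can add, subtract (truncated at $0$), load and store indirectly, test for zero and read its input sequentially, and each instruction is charged the total bit-length of the numbers and indirect addresses it handles. (1) The word problem in free solvable groups can be decided by a deterministic algorithm in quasi-quadratic time $\tilde O(|w|^2)$, uniformly in $r$ and $d$. Precisely, there are one program $P$ for such a machine and constants $C,k\in\mathbb N$ such that for all $r,d\ge 0$ and every word $w$ in $x_1^{\pm1},\dots,x_r^{\pm1}$, the program $P$, given $\mathrm{code}(w)$ followed by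 $r$ and $d$ in binary, halts, correctly answers whether $w=1$ in $S_{r,d}$, and takes time at most $$C\Bigl(|w|^2\,\lfloor\log_2(|w|+2)\rfloor^k+|\mathrm{code}(w)|\,\lfloor\log_2(|\mathrm{code}(w)|+2)\rfloor^k+1\Bigr).$$ In particular the time is $\tilde O(|w|^2)$ for nonempty $w$, with constants independent of $d$ when $r$ is fixed, and with constants independent of both $r$ and $d$ when $r\le|w|$. (2) If $g\in F_r$ is a nontrivial element whose image in $S_{r,d}$ is trivial, then its reduced length satisfies $|g|\ge 3^d$. -/

import Mathlib

/-! ### Random access machines with logarithmic (bit) cost -/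

namespace RAM

/-- The bit-length of a natural number, counted as at least one. -/
def bitLen (n : ℕ) : ℕ := max 1 (Nat.size n)

/-- The instructions of a random access machine with registers `X 0, X 1, X 2, …` that hold natural
numbers of arbitrary size, and with a one-way read-only input tape:
* `const i a`   : `X i ← a`;
* `add i j k`   : `X i ← X j + X k`;
* `sub i j k`   : `X i ← max (X j - X k) 0`;
* `load i j`    : `X i ← X (X j)`;
* `store i j`   : `X (X i) ← X j`;
* `jump j m`    : if `X j > 0`, continue with instruction number `m`;
* `read i`      : `X i ←` the next symbol of the input tape (`0` past its end);
* `accept`, `reject` : halt with the answer yes, respectively no. -/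
inductive Instr : Type
  | const (i a : ℕ)
  | add (i j k : ℕ)
  | sub (i j k : ℕ)
  | load (i j : ℕ)
  | store (i j : ℕ)
  | jump (j m : ℕ)
  | read (i : ℕ)
  | accept
  | reject

/-- A program is a finite list of instructions, numbered from `0`. -/
abbrev Program : Type := List Instr

/-- A configuration: the number of the current instruction, the contents of the registers, and the
part of the input tape that has not been read yet. -/
structure Config : Type where
  pc : ℕ
  reg : ℕ → ℕ
  tape : List ℕ

/-- The configuration after one instruction; `none` for the two halting instructions. -/
def Instr.next (c : Config) : Instr → Option Config
  | .const i a => some ⟨c.pc + 1, Function.update c.reg i a, c.tape⟩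
  | .add i j k => some ⟨c.pc + 1, Function.update c.reg i (c.reg j + c.reg k), c.tape⟩
  | .sub i j k => some ⟨c.pc + 1, Function.update c.reg i (c.reg j - c.reg k), c.tape⟩
  | .load i j => some ⟨c.pc + 1, Function.update c.reg i (c.reg (c.reg j)), c.tape⟩
  | .store i j => some ⟨c.pc + 1, Function.update c.reg (c.reg i) (c.reg j), c.tape⟩
  | .jump j m => some ⟨if 0 < c.reg j then m else c.pc + 1, c.reg, c.tape⟩
  | .read i => some ⟨c.pc + 1, Function.update c.reg i (c.tape.headD 0), c.tape.tail⟩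
  | .accept => none
  | .reject => none

/-- The logarithmic cost of an instruction: the total bit-length of the numbers and of the indirect
addresses it handles. In particular every instruction costs at least one. -/
def Instr.cost (c : Config) : Instr → ℕ
  | .const _ a => bitLen a
  | .add _ j k => bitLen (c.reg j) + bitLen (c.reg k)
  | .sub _ j k => bitLen (c.reg j) + bitLen (c.reg k)
  | .load _ j => bitLen (c.reg j) + bitLen (c.reg (c.reg j))
  | .store i j => bitLen (c.reg i) + bitLen (c.reg j)
  | .jump j _ => bitLen (c.reg j)
  | .read _ => bitLen (c.tape.headD 0)
  | .accept => 1
  | .reject => 1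

/-- `HaltsFrom P c t b`: started in the configuration `c`, the program `P` halts with the answer `b`,
and the total cost of the instructions it executes is `t`. -/
inductive HaltsFrom (P : Program) : Config → ℕ → Bool → Prop
  | accept {c : Config} : P[c.pc]? = some .accept → HaltsFrom P c 1 true
  | reject {c : Config} : P[c.pc]? = some .reject → HaltsFrom P c 1 false
  | step {c c' : Config} {I : Instr} {t : ℕ} {b : Bool} :
      P[c.pc]? = some I → I.next c = some c' → HaltsFrom P c' t b →
      HaltsFrom P c (I.cost c + t) b

/-- `Halts P x t b`: on the input tape `x`, with all registers initially `0`, the program `P` halts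
with the answer `b` after time (total logarithmic cost) `t`. -/
def Halts (P : Program) (x : List ℕ) (t : ℕ) (b : Bool) : Prop :=
  HaltsFrom P ⟨0, fun _ => 0, x⟩ t b

/-- The machine is deterministic: answer and running time are determined by the input. -/
theorem HaltsFrom.unique {P : Program} {c : Config} {t t' : ℕ} {b b' : Bool}
    (h : HaltsFrom P c t b) (h' : HaltsFrom P c t' b') : t = t' ∧ b = b' := by
  induction h generalizing t' b' with
  | accept h =>
    cases h' with
    | accept _ => exact ⟨rfl, rfl⟩
    | reject g => rw [h] at g; cases g
    | step g e _ => rw [h] at g; cases g; cases e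
  | reject h =>
    cases h' with
    | accept g => rw [h] at g; cases g
    | reject _ => exact ⟨rfl, rfl⟩
    | step g e _ => rw [h] at g; cases g; cases e
  | step h e _ ih =>
    cases h' with
    | accept g => rw [h] at g; cases g; cases e
    | reject g => rw [h] at g; cases g; cases e
    | step g e' k =>
      rw [h] at g
      cases g
      rw [e] at e'
      cases e'
      obtain ⟨h1, h2⟩ := ih k
      exact ⟨by rw [h1], h2⟩

end RAM

/-! ### The word problem in free solvable groups -/

namespace FreeSolvable

/-- The free solvable group `S_{r,d}` of rank `r` and class `d`: the quotient of the free group of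
rank `r` by the `d`-th term of its derived series (`F⁽⁰⁾ = F`, `F⁽ᵈ⁺¹⁾ = [F⁽ᵈ⁾, F⁽ᵈ⁾]`). -/
abbrev S (r d : ℕ) : Type := FreeGroup (Fin r) ⧸ derivedSeries (FreeGroup (Fin r)) d

/-- A (not necessarily reduced) group word in the letters `x_i`, written `(i, true)`, and `x_i⁻¹`,
written `(i, false)`, where `i < r`. -/
abbrev Word (r : ℕ) : Type := List (Fin r × Bool)

/-- The element of `S_{r,d}` that a word represents. -/
def eval (r d : ℕ) (w : Word r) : S r d := QuotientGroup.mk (FreeGroup.mk w)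

/-- The code of a letter, a bit-string of length `⌈log₂ r⌉ + 1`: the sign of the exponent, followed
by the `⌈log₂ r⌉` lowest binary digits of the index, lowest first. -/
def letterCode {r : ℕ} (a : Fin r × Bool) : List Bool :=
  a.2 :: (List.range (Nat.clog 2 r)).map (fun j => (a.1 : ℕ).testBit j)

/-- The code of a word: the concatenation of the codes of its letters. -/
def code {r : ℕ} (w : Word r) : List Bool := w.flatMap letterCode

/-- The tape symbols `0`, `1` that represent a bit-string. -/
def bitsToTape (s : List Bool) : List ℕ := s.map Bool.toNat

/-- The input tape for the instance `(w, r, d)`: the code of `w`, then `r` and `d` in base two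
(lowest digit first, no superfluous zeros), each of the three followed by the separator `2`. -/
def inputTape (r d : ℕ) (w : Word r) : List ℕ :=
  bitsToTape (code w) ++ 2 :: (bitsToTape (Nat.bits r) ++ 2 :: (bitsToTape (Nat.bits d) ++ [2]))

end FreeSolvable

/-!
A word over a generating set spells a path in the Cayley graph of `F / N`, for a normal subgroup
`N` of the free group `F`. The proof rests on the Magnus embedding in its geometric form
(`eq_mod_commutator_iff_balanced`): two prefixes of a word agree modulo `⁅N, N⁆` if and only if
the path between them traverses each edge of this graph equally often in both directions, that is,
if its flow vanishes. One direction holds since, modulo `⁅N, N⁆`, the element of a path is a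
product of factors attached to its edges; the other one since `F` acts on pairs (flow, vertex),
and the elements of `N` act by commuting translations of the flow.

Lower bound (`three_pow_le_norm`): let `m` be the girth of the Cayley graph of `F / N`. A
cyclically reduced word in `⁅N, N⁆` is a closed path without backtracking and with zero flow. It
contains a shortest cycle, of length `c ≥ m`, and it has to leave this cycle, since otherwise it
never undoes its first step. Until it next meets itself it has traversed at least `3 m / 2`
distinct edges, because the ear contains a second cycle or closes up with the shorter way along
the first one. By zero flow each edge is traversed twice, whence the length is at least `3 m`
(`three_mul_girth_le`). Induction along the derived series gives `3 ^ d`.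

Algorithm: the classes of the prefixes of a word of length `n` modulo `F⁽ⁱ⁺¹⁾` are computed from
those modulo `F⁽ⁱ⁾`. Those determine which steps traverse the same edge, so that each oriented
edge gets a number. For each `j` the path is followed backwards from the time `j`, with a table of
the net numbers of visits to the oriented edges and with their sum, and the prefixes `i` at which
the sum vanishes are those in the class of `j` (`Encodes.netCount_step`,
`Encodes.tot_eq_zero_iff`). This takes `O(n ^ 2)` steps for a level. By the lower bound, only
`O(log n)` levels have to be computed: when `n < 2 ^ i`, a word of length `n` is trivial modulo
`F⁽ⁱ⁾` only if it is trivial in `F` (`mem_derivedSeries_iff`). The generators are replaced by the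
nodes of a binary tree, so that all numbers stay polynomial in the length `L` of the input word's
code, whatever the rank. The procedure is written in a small structured language, whose compiler
to machine programs is verified, with its cost, in `Exec.halts`. The extra factor `log L` in the
time is absorbed by the two terms of the bound (`time_le`).
-/

/-! ### Flows of paths in Cayley graphs -/

namespace FreeSolvable

open Finset

section Flow

variable {α : Type*}

/-- The group element spelled by the first `k` letters of the sequence `a`. -/
def pre (a : ℕ → α × Bool) : ℕ → FreeGroup α
  | 0 => 1
  | k + 1 => pre a k * FreeGroup.mk [a k]

/-- The edge of the Cayley graph of `F / N` that the `k`-th step of the path spelled by `a`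
traverses: its initial vertex and its label (as an edge labelled by a generator), and whether the
step runs along the edge (`true`) or against it (`false`). -/
def edge (N : Subgroup (FreeGroup α)) (a : ℕ → α × Bool) (k : ℕ) :
    ((FreeGroup α ⧸ N) × α) × Bool :=
  (((if (a k).2 then pre a k else pre a (k + 1) : FreeGroup α), (a k).1), (a k).2)

open Classical in
/-- Between the times `i` and `j` the path spelled by `a` in the Cayley graph of `F / N` traverses
each edge equally often in both directions. -/
def Balanced (N : Subgroup (FreeGroup α)) (a : ℕ → α × Bool) (i j : ℕ) : Prop :=
  ∀ e, #{k ∈ Ico i j | edge N a k = (e, true)} = #{k ∈ Ico i j | edge N a k = (e, false)}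

theorem mk_singleton_false (x : α) :
    FreeGroup.mk [(x, false)] = (FreeGroup.of x)⁻¹ := by
  simp [FreeGroup.of, FreeGroup.inv_mk, FreeGroup.invRev]

theorem mk_singleton_true (x : α) : FreeGroup.mk [(x, true)] = FreeGroup.of x := rfl

open Classical in
/-- A signed product over the steps of a balanced path vanishes in every commutative group. -/
theorem Balanced.prod_eq_one {N : Subgroup (FreeGroup α)} {a : ℕ → α × Bool} {i j : ℕ}
    (h : Balanced N a i j) {A : Type*} [CommGroup A] (g : (FreeGroup α ⧸ N) × α → A) :
    ∏ k ∈ Ico i j,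
      (if (edge N a k).2 then g (edge N a k).1 else (g (edge N a k).1)⁻¹) = 1 := by
  rw [← Finset.prod_fiberwise_of_maps_to (t := (Ico i j).image fun k => (edge N a k).1)
    (g := fun k => (edge N a k).1) (fun k hk => Finset.mem_image_of_mem _ hk)]
  refine Finset.prod_eq_one fun e _ => ?_
  rw [← Finset.prod_filter_mul_prod_filter_not _ (fun k => (edge N a k).2 = true)]
  have h1 : ∏ k ∈ ((Ico i j).filter fun k => (edge N a k).1 = e).filter
      (fun k => (edge N a k).2 = true),
      (if (edge N a k).2 then g (edge N a k).1 else (g (edge N a k).1)⁻¹)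
      = g e ^ #{k ∈ Ico i j | edge N a k = (e, true)} := by
    rw [Finset.prod_congr rfl (g := fun _ => g e), Finset.prod_const]
    · congr 2
      ext k
      simp only [mem_filter, Prod.ext_iff]
      tauto
    · intro k hk
      simp only [mem_filter] at hk
      simp [hk.2, hk.1.2]
  have h2 : ∏ k ∈ ((Ico i j).filter fun k => (edge N a k).1 = e).filter
      (fun k => ¬ (edge N a k).2 = true),
      (if (edge N a k).2 then g (edge N a k).1 else (g (edge N a k).1)⁻¹)
      = (g e)⁻¹ ^ #{k ∈ Ico i j | edge N a k = (e, false)} := by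
    rw [Finset.prod_congr rfl (g := fun _ => (g e)⁻¹), Finset.prod_const]
    · congr 2
      ext k
      simp only [mem_filter, Prod.ext_iff, Bool.not_eq_true]
      tauto
    · intro k hk
      simp only [mem_filter] at hk
      simp [hk.2, hk.1.2]
  rw [h1, h2, h e]
  simp

/-- A quantity with values in a commutative group that changes along each edge by an amount
depending only on the edge is the same at both ends of a balanced path. -/
theorem Balanced.eq_of_step {N : Subgroup (FreeGroup α)} {a : ℕ → α × Bool} {i j : ℕ}
    (hij : i ≤ j) (h : Balanced N a i j) {A : Type*} [CommGroup A]
    (g : (FreeGroup α ⧸ N) × α → A) (D : ℕ → A)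
    (hD : ∀ k, D (k + 1) =
      D k * (if (edge N a k).2 then g (edge N a k).1 else (g (edge N a k).1)⁻¹)) :
    D i = D j := by
  have key : ∀ j, i ≤ j → D j = D i * ∏ k ∈ Ico i j,
      (if (edge N a k).2 then g (edge N a k).1 else (g (edge N a k).1)⁻¹) := by
    intro j hj
    induction j, hj using Nat.le_induction with
    | base => simp
    | succ j hj ih => rw [Finset.prod_Ico_succ_top hj, hD, ih, mul_assoc]
  rw [key j hij, h.prod_eq_one, mul_one]

/-- A balanced path is closed. -/
theorem Balanced.closed {N : Subgroup (FreeGroup α)} [N.Normal] {a : ℕ → α × Bool} {i j : ℕ}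
    (hij : i ≤ j) (h : Balanced N a i j) :
    (pre a i : FreeGroup α ⧸ N) = pre a j := by
  have := h.eq_of_step hij (A := Multiplicative (FreeAbelianGroup (FreeGroup α ⧸ N)))
    (fun e => Multiplicative.ofAdd (FreeAbelianGroup.of (e.1 * (FreeGroup.of e.2 : FreeGroup α))
      - FreeAbelianGroup.of e.1))
    (fun k => Multiplicative.ofAdd (FreeAbelianGroup.of (pre a k : FreeGroup α ⧸ N))) ?_
  · exact FreeAbelianGroup.of_injective (Multiplicative.ofAdd.injective this)
  · intro k
    rcases hx : a k with ⟨x, b⟩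
    cases b
    · simp [edge, hx, pre, mk_singleton_false]
    · simp [edge, hx, pre, mk_singleton_true]

/-- The two ends of a balanced path agree modulo `⁅N, N⁆`. With a section `s` of `F → F / N`, the
group element of a path is a product of the elements `s q * x * (s (q x))⁻¹` of `N`, one for each
edge, so that modulo `⁅N, N⁆` it depends only on the net number of traversals of each edge. -/
theorem Balanced.eq_mod_commutator {N : Subgroup (FreeGroup α)} [N.Normal] {a : ℕ → α × Bool}
    {i j : ℕ} (hij : i ≤ j) (h : Balanced N a i j) :
    (pre a i : FreeGroup α ⧸ ⁅N, N⁆) = pre a j := by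
  classical
  let s : FreeGroup α ⧸ N → FreeGroup α := Quotient.out
  have hs : ∀ q, ((s q : FreeGroup α) : FreeGroup α ⧸ N) = q := fun q => QuotientGroup.out_eq' q
  have hmem : ∀ g : FreeGroup α, ∀ q : FreeGroup α ⧸ N, (g : FreeGroup α ⧸ N) = q →
      g * (s q)⁻¹ ∈ N := by
    intro g q hq
    rw [← QuotientGroup.eq_one_iff]
    simp [hs, hq]
  let γ : (FreeGroup α ⧸ N) × α → N := fun e =>
    ⟨s e.1 * FreeGroup.of e.2 * (s (e.1 * (FreeGroup.of e.2 : FreeGroup α)))⁻¹,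
      hmem _ _ (by simp [hs])⟩
  let δ : ℕ → N := fun k => ⟨pre a k * (s (pre a k))⁻¹, hmem _ _ rfl⟩
  have hδ := h.eq_of_step hij (A := Abelianization N) (fun e => Abelianization.of (γ e))
    (fun k => Abelianization.of (δ k)) (by
      intro k
      rcases hx : a k with ⟨x, b⟩
      cases b
      · have e1 : (edge N a k).2 = false := by simp [edge, hx]
        rw [e1, ← map_inv]
        simp only [Bool.false_eq_true, if_false, ← map_mul]
        congr 1
        ext
        simp [δ, γ, edge, hx, pre, mk_singleton_false, mul_assoc]
      · have e1 : (edge N a k).2 = true := by simp [edge, hx]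
        rw [e1]
        simp only [if_true, ← map_mul]
        congr 1
        ext
        simp [δ, γ, edge, hx, pre, mk_singleton_true, mul_assoc])
  have h1 : (δ i)⁻¹ * δ j ∈ commutator N := by
    rw [← QuotientGroup.eq]
    exact hδ
  have h2 : N.subtype ((δ i)⁻¹ * δ j) ∈ ⁅N, N⁆ := by
    rw [← Subgroup.map_subtype_commutator]
    exact Subgroup.mem_map_of_mem _ h1
  have hc := h.closed hij
  rw [← QuotientGroup.eq_one_iff] at h2
  simp only [δ, hc, map_mul, map_inv, Subgroup.subtype_apply, QuotientGroup.mk_mul,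
    QuotientGroup.mk_inv, mul_inv_rev, inv_inv] at h2
  rw [← inv_mul_eq_one]
  generalize ((s (pre a j : FreeGroup α ⧸ N) : FreeGroup α) : FreeGroup α ⧸ ⁅N, N⁆) = t at h2
  generalize ((pre a i : FreeGroup α) : FreeGroup α ⧸ ⁅N, N⁆) = u at h2 ⊢
  generalize ((pre a j : FreeGroup α) : FreeGroup α ⧸ ⁅N, N⁆) = v at h2 ⊢
  have : u⁻¹ * v = t⁻¹ * (t * u⁻¹ * (v * t⁻¹)) * t := by group
  rw [this, h2]
  group

open Classical in
/-- The permutation "walk along an edge labelled `x`" of the pairs (flow, vertex). -/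
noncomputable def walkPerm (N : Subgroup (FreeGroup α)) [N.Normal] (x : α) :
    Equiv.Perm (((FreeGroup α ⧸ N) × α → ℤ) × (FreeGroup α ⧸ N)) where
  toFun p := (p.1 + Pi.single (p.2, x) 1, p.2 * (FreeGroup.of x : FreeGroup α))
  invFun p := (p.1 - Pi.single (p.2 * (FreeGroup.of x : FreeGroup α)⁻¹, x) 1,
    p.2 * (FreeGroup.of x : FreeGroup α)⁻¹)
  left_inv p := by simp
  right_inv p := by simp

/-- The right action of the free group on pairs (flow, vertex) of the Cayley graph of `F / N`. -/
noncomputable def walk (N : Subgroup (FreeGroup α)) [N.Normal] :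
    FreeGroup α →* (Equiv.Perm (((FreeGroup α ⧸ N) × α → ℤ) × (FreeGroup α ⧸ N)))ᵐᵒᵖ :=
  FreeGroup.lift fun x => MulOpposite.op (walkPerm N x)

/-- A group element shifts the flow by an amount that depends only on the initial vertex. -/
theorem walk_apply (N : Subgroup (FreeGroup α)) [N.Normal] (g : FreeGroup α) :
    ∃ h : (FreeGroup α ⧸ N) → ((FreeGroup α ⧸ N) × α → ℤ), ∀ f q,
      (walk N g).unop (f, q) = (f + h q, q * (g : FreeGroup α ⧸ N)) := by
  classical
  induction g using FreeGroup.induction_on with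
  | C1 => exact ⟨0, by simp⟩
  | of x => exact ⟨fun q => Pi.single (q, x) 1, by simp [walk, walkPerm]⟩
  | inv_of x _ =>
    refine ⟨fun q => - Pi.single (q * (FreeGroup.of x : FreeGroup α)⁻¹, x) 1, fun f q => ?_⟩
    simp [walk, walkPerm, Equiv.Perm.inv_def, Equiv.symm, sub_eq_add_neg]
  | mul g g' ih ih' =>
    obtain ⟨h, hh⟩ := ih
    obtain ⟨h', hh'⟩ := ih'
    refine ⟨fun q => h q + h' (q * (g : FreeGroup α ⧸ N)), fun f q => ?_⟩
    simp [hh, hh', add_assoc, mul_assoc]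

/-- Elements of `N` only add to the flow, so they act by commuting permutations. -/
theorem commutator_le_ker_walk (N : Subgroup (FreeGroup α)) [N.Normal] :
    ⁅N, N⁆ ≤ (walk N).ker := by
  rw [Subgroup.commutator_le]
  intro g hg g' hg'
  rw [MonoidHom.mem_ker, commutatorElement_def, map_mul, map_mul, map_mul, map_inv, map_inv,
    mul_inv_eq_one, mul_inv_eq_iff_eq_mul]
  apply MulOpposite.unop_injective
  ext1 ⟨f, q⟩
  obtain ⟨h, hh⟩ := walk_apply N g
  obtain ⟨h', hh'⟩ := walk_apply N g'
  have e : (g : FreeGroup α ⧸ N) = 1 := by rwa [QuotientGroup.eq_one_iff]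
  have e' : (g' : FreeGroup α ⧸ N) = 1 := by rwa [QuotientGroup.eq_one_iff]
  simp [hh, hh', e, e', add_assoc, add_comm (h q)]

open Classical in
/-- The action on the zero flow at the base point records the path spelled by a word: its flow through
each edge and its end point. -/
theorem walk_pre (N : Subgroup (FreeGroup α)) [N.Normal] (a : ℕ → α × Bool) (k : ℕ) :
    (walk N (pre a k)).unop (0, 1) =
      (fun e => (#{t ∈ range k | edge N a t = (e, true)} : ℤ)
        - #{t ∈ range k | edge N a t = (e, false)}, (pre a k : FreeGroup α ⧸ N)) := by
  induction k with
  | zero => simp [pre]; rfl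
  | succ k ih =>
    rw [pre, map_mul, MulOpposite.unop_mul, Equiv.Perm.mul_apply, ih]
    rcases hx : a k with ⟨x, b⟩
    cases b
    · have e1 : edge N a k = (((pre a (k + 1) : FreeGroup α ⧸ N), x), false) := by simp [edge, hx]
      simp only [mk_singleton_false, walk, map_inv, FreeGroup.lift_apply_of, MulOpposite.unop_inv,
        MulOpposite.unop_op, Equiv.Perm.inv_def]
      ext1
      · funext e
        simp only [walkPerm, Equiv.symm, Equiv.coe_fn_mk, Pi.sub_apply, Finset.range_add_one,
          Finset.filter_insert, e1]
        simp only [Prod.mk.injEq, and_true, Bool.false_eq_true, and_false,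
          if_false]
        rw [pre, hx, mk_singleton_false]
        by_cases he : (((pre a k * (FreeGroup.of x)⁻¹ : FreeGroup α) : FreeGroup α ⧸ N), x) = e
        · subst he
          rw [if_pos rfl, Finset.card_insert_of_notMem
            (fun h => Finset.notMem_range_self (Finset.mem_filter.1 h).1)]
          simp; ring
        · rw [if_neg he, Pi.single_eq_of_ne]
          · simp
          · intro h; exact he (by rw [h]; rfl)
      · simp [walkPerm, Equiv.symm]
    · have e1 : edge N a k = (((pre a k : FreeGroup α ⧸ N), x), true) := by simp [edge, hx]
      simp only [mk_singleton_true, walk, FreeGroup.lift_apply_of, MulOpposite.unop_op]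
      ext1
      · funext e
        simp only [walkPerm, Equiv.coe_fn_mk, Pi.add_apply, Finset.range_add_one,
          Finset.filter_insert, e1]
        simp only [Prod.mk.injEq, and_true, and_false, Bool.true_eq_false,
          if_false]
        by_cases he : ((pre a k : FreeGroup α ⧸ N), x) = e
        · subst he
          simp; ring
        · rw [if_neg he, Pi.single_eq_of_ne]
          · simp
          · intro h; exact he h.symm
      · simp [walkPerm]

/-- Two prefixes of a word agree modulo `⁅N, N⁆` exactly if the path between them in the Cayley
graph of `F / N` has zero flow through every edge. -/
theorem eq_mod_commutator_iff_balanced (N : Subgroup (FreeGroup α)) [N.Normal] (a : ℕ → α × Bool)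
    {i j : ℕ} (hij : i ≤ j) :
    (pre a i : FreeGroup α ⧸ ⁅N, N⁆) = pre a j ↔ Balanced N a i j := by
  classical
  refine ⟨fun h e => ?_, fun h => h.eq_mod_commutator hij⟩
  have h1 : (walk N (pre a i)) = walk N (pre a j) := by
    rw [← inv_mul_eq_one, ← map_inv, ← map_mul, ← MonoidHom.mem_ker]
    exact commutator_le_ker_walk N (QuotientGroup.eq.1 h)
  have h2 := walk_pre N a i
  rw [h1, walk_pre, Prod.mk.injEq] at h2
  have h3 := congrFun h2.1 e
  have split : ∀ b, #{t ∈ range j | edge N a t = (e, b)} =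
      #{t ∈ range i | edge N a t = (e, b)} + #{t ∈ Ico i j | edge N a t = (e, b)} := by
    intro b
    simp only [Finset.card_filter]
    exact (Finset.sum_range_add_sum_Ico _ hij).symm
  simp only [split] at h3
  push_cast at h3
  omega

end Flow

end FreeSolvable

/-! ### Short elements of the derived series -/

namespace FreeSolvable

open Finset

section Girth

variable {α : Type*}

/-- The inverse letter. -/
def letterInv (l : α × Bool) : α × Bool := (l.1, !l.2)

theorem mk_letterInv (l : α × Bool) : FreeGroup.mk [letterInv l] = (FreeGroup.mk [l])⁻¹ := by
  simp [letterInv, FreeGroup.inv_mk, FreeGroup.invRev]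

theorem letterInv_ne (l : α × Bool) : letterInv l ≠ l := by
  intro h
  simpa [letterInv] using congrArg Prod.snd h

theorem letterInv_letterInv (l : α × Bool) : letterInv (letterInv l) = l := by
  simp [letterInv]

/-- The word spelled by the letters of `a` from time `i` until time `j`. -/
def seg (a : ℕ → α × Bool) (i j : ℕ) : List (α × Bool) := (List.range' i (j - i)).map a

theorem length_seg (a : ℕ → α × Bool) (i j : ℕ) : (seg a i j).length = j - i := by simp [seg]

theorem pre_eq_mul_seg (a : ℕ → α × Bool) {i j : ℕ} (h : i ≤ j) :
    pre a j = pre a i * FreeGroup.mk (seg a i j) := by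
  induction j, h using Nat.le_induction with
  | base => simp [seg, ← FreeGroup.one_eq_mk]
  | succ j hj ih =>
    have : seg a i (j + 1) = seg a i j ++ [a j] := by
      rw [seg, seg, show j + 1 - i = (j - i) + 1 by omega, List.range'_1_concat]
      simp [show i + (j - i) = j by omega]
    rw [this, ← FreeGroup.mul_mk, ← mul_assoc, ← ih, pre]

theorem isReduced_seg {a : ℕ → α × Bool} (h : ∀ k, a (k + 1) ≠ letterInv (a k)) (i j : ℕ) :
    FreeGroup.IsReduced (seg a i j) := by
  rw [seg, FreeGroup.IsReduced, List.isChain_map]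
  refine (List.isChain_range' i (j - i) 1).imp ?_
  rintro k _ rfl h1
  by_contra h2
  refine h k (Prod.ext h1.symm ?_)
  simp only [letterInv]
  revert h2
  cases (a k).2 <;> cases (a (k + 1)).2 <;> simp

theorem norm_mk_of_isReduced [DecidableEq α] {L : List (α × Bool)} (h : FreeGroup.IsReduced L) :
    (FreeGroup.mk L).norm = L.length := by
  rw [FreeGroup.norm, FreeGroup.toWord_mk, h.reduce_eq]

theorem pre_succ_mk (N : Subgroup (FreeGroup α)) [N.Normal] (a : ℕ → α × Bool) (k : ℕ) :
    (pre a (k + 1) : FreeGroup α ⧸ N) = pre a k * (FreeGroup.mk [a k] : FreeGroup α) := by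
  rw [pre, QuotientGroup.mk_mul]

/-- The steps `s` and `k` traverse the same edge in opposite directions exactly if they carry inverse
letters and `s` starts where `k` ends. -/
theorem edge_eq_flip_edge_iff (N : Subgroup (FreeGroup α)) [N.Normal] (a : ℕ → α × Bool)
    (k s : ℕ) :
    edge N a s = ((edge N a k).1, !(edge N a k).2) ↔
      a s = letterInv (a k) ∧ (pre a s : FreeGroup α ⧸ N) = pre a (k + 1) := by
  have h1 := pre_succ_mk N a s
  have h2 := pre_succ_mk N a k
  rcases hs : a s with ⟨x, b⟩
  rcases hk : a k with ⟨y, c⟩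
  rw [hs] at h1
  rw [hk] at h2
  simp only [edge, hs, hk, letterInv, Prod.mk.injEq]
  constructor
  · rintro ⟨⟨h, rfl⟩, rfl⟩
    refine ⟨⟨rfl, rfl⟩, ?_⟩
    cases c
    · simpa using h
    · have : (pre a s * (FreeGroup.mk [(x, false)] : FreeGroup α) : FreeGroup α ⧸ N) = pre a k := by
        simpa [h1] using h
      rw [h2, ← this]
      simp [mk_singleton_false, mk_singleton_true]
  · rintro ⟨⟨rfl, rfl⟩, h⟩
    cases c
    · simp [h]
    · simp [h1, h, h2, mk_singleton_false, mk_singleton_true]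

/-- A nonempty closed path without backtracking, also not at its ends, that has zero flow through
every edge of the Cayley graph of `F / N` has at least three times the girth of that graph as its
length: it contains a shortest cycle of the graph and an ear or a second cycle attached to it, and
these together have at least `3 / 2` times the girth many edges, each of which is traversed in both
directions. The path is given as the period `n` of an infinite path. -/
theorem three_mul_girth_le (N : Subgroup (FreeGroup α)) [N.Normal] [DecidableEq α] {m n : ℕ}
    (hN : ∀ g ∈ N, g ≠ 1 → m ≤ g.norm) (a : ℕ → α × Bool) (hn : 0 < n)
    (hred : ∀ k, a (k + 1) ≠ letterInv (a k)) (hper : ∀ k, a (k + n) = a k)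
    (hmem : pre a n ∈ ⁅N, N⁆) : 3 * m ≤ n := by
  classical
  set v : ℕ → FreeGroup α ⧸ N := fun k => (pre a k : FreeGroup α ⧸ N) with hv
  have vsucc : ∀ k, v (k + 1) = v k * (FreeGroup.mk [a k] : FreeGroup α) := pre_succ_mk N a
  have vstep : ∀ k l, v k = v l → a k = a l → v (k + 1) = v (l + 1) := by
    intro k l h1 h2; rw [vsucc, vsucc, h1, h2]
  have hbal : Balanced N a 0 n := by
    rw [← eq_mod_commutator_iff_balanced N a (Nat.zero_le n), eq_comm]
    rwa [pre, QuotientGroup.mk_one, QuotientGroup.eq_one_iff]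
  have vn : v n = v 0 := (hbal.closed (Nat.zero_le n)).symm
  have vper : ∀ k, v (k + n) = v k := by
    intro k
    induction k with
    | zero => simpa using vn
    | succ k ih => rw [show k + 1 + n = (k + n) + 1 by ring]; exact vstep _ _ ih (hper k)
  have vper' : ∀ q k, v (k + n * q) = v k ∧ a (k + n * q) = a k := by
    intro q
    induction q with
    | zero => simp
    | succ q ih =>
      intro k
      rw [show k + n * (q + 1) = (k + n * q) + n by ring, vper, hper]
      exact ih k
  have vmod : ∀ k, v (k % n) = v k ∧ a (k % n) = a k := by
    intro k
    have := vper' (k / n) (k % n)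
    rw [Nat.mod_add_div] at this
    exact ⟨this.1.symm, this.2.symm⟩
  -- By zero flow, each step is undone by a step of the first period.
  have opp : ∀ k, ∃ s, s < n ∧ a s = letterInv (a k) ∧ v s = v (k + 1) := by
    intro k
    have hk := vmod k
    have hk1 := vstep _ _ hk.1 hk.2
    have hlt := Nat.mod_lt k hn
    have he : ∃ s ∈ Ico 0 n, edge N a s = ((edge N a (k % n)).1, !(edge N a (k % n)).2) := by
      have hb := hbal (edge N a (k % n)).1
      have hmemk : k % n ∈ {t ∈ Ico 0 n |
          edge N a t = ((edge N a (k % n)).1, (edge N a (k % n)).2)} := by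
        simp [hlt]
      have hpos := Finset.card_pos.2 ⟨_, hmemk⟩
      have hpos' : 0 < #{t ∈ Ico 0 n |
          edge N a t = ((edge N a (k % n)).1, !(edge N a (k % n)).2)} := by
        cases hb2 : (edge N a (k % n)).2
        · rw [hb2] at hpos; exact hpos.trans_eq (by rw [Bool.not_false]; convert hb.symm)
        · rw [hb2] at hpos; exact hpos.trans_eq (by rw [Bool.not_true]; convert hb)
      obtain ⟨s, hs⟩ := Finset.card_pos.1 hpos'
      rw [mem_filter] at hs
      exact ⟨s, hs⟩
    obtain ⟨s, hs, hse⟩ := he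
    rw [edge_eq_flip_edge_iff] at hse
    refine ⟨s, (Finset.mem_Ico.1 hs).2, ?_, ?_⟩
    · rw [hse.1, hk.2]
    · rw [← hk1]; exact hse.2
  have closed : ∀ i c, 0 < c → v i = v (i + c) → m ≤ c := by
    intro i c hc h
    have hr := isReduced_seg hred i (i + c)
    have hnorm := norm_mk_of_isReduced hr
    rw [length_seg, Nat.add_sub_cancel_left] at hnorm
    have h1 := pre_eq_mul_seg a (Nat.le_add_right i c)
    rw [← hnorm]
    refine hN _ ?_ ?_
    · have h2 : v (i + c) = v i * (FreeGroup.mk (seg a i (i + c)) : FreeGroup α) := by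
        simp only [hv, h1, QuotientGroup.mk_mul]
      rw [← h, eq_comm, mul_eq_left] at h2
      rwa [QuotientGroup.eq_one_iff] at h2
    · intro h0
      rw [h0, FreeGroup.norm_one] at hnorm
      omega
  -- `c` is the length of a shortest closed subpath, a cycle of the Cayley graph.
  have hex : ∃ c, 0 < c ∧ ∃ i, v i = v (i + c) := ⟨n, hn, 0, by simpa using vn.symm⟩
  obtain ⟨c, ⟨hc0, i0, hi0⟩, hmin⟩ : ∃ c, (0 < c ∧ ∃ i, v i = v (i + c)) ∧
      ∀ i j, i < j → v i = v j → c ≤ j - i := by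
    refine ⟨Nat.find hex, Nat.find_spec hex, fun i j hij h => Nat.find_min' hex ⟨by omega, i, ?_⟩⟩
    rw [h]; congr 1; omega
  have hmc : m ≤ c := closed i0 c hc0 hi0
  -- The path does not follow the cycle forever, since it has to undo its first step on it.
  have hleave : ∃ t, a (i0 + t + c) ≠ a (i0 + t) := by
    by_contra hcon
    push Not at hcon
    have h1 : ∀ t, v (i0 + t + c) = v (i0 + t) := by
      intro t
      induction t with
      | zero => simpa using hi0.symm
      | succ t ih =>
        rw [show i0 + (t + 1) + c = (i0 + t + c) + 1 by ring]
        exact vstep _ _ ih (hcon t)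
    have h2 : ∀ q t, v (i0 + t + c * q) = v (i0 + t) ∧ a (i0 + t + c * q) = a (i0 + t) := by
      intro q
      induction q with
      | zero => simp
      | succ q ih =>
        intro t
        have e1 := hcon (t + c * q)
        have e2 := h1 (t + c * q)
        rw [show i0 + (t + c * q) + c = i0 + t + c * (q + 1) by ring,
          show i0 + (t + c * q) = i0 + t + c * q by ring] at e1 e2
        exact ⟨e2.trans (ih t).1, e1.trans (ih t).2⟩
    obtain ⟨s, -, hs1, hs2⟩ := opp i0
    obtain ⟨hp1, hp2⟩ := vper' i0 s
    obtain ⟨u, hu⟩ := Nat.exists_eq_add_of_le (show i0 ≤ s + n * i0 by nlinarith)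
    have h3 := h2 (u / c) (u % c)
    rw [add_assoc, Nat.mod_add_div, ← hu, hp1, hp2, hs1, hs2] at h3
    have hlt := Nat.mod_lt u hc0
    generalize u % c = r at h3 hlt
    rcases Nat.lt_trichotomy r 1 with hr | hr | hr
    · obtain rfl : r = 0 := by omega
      exact letterInv_ne _ h3.2
    · subst hr
      exact hred i0 h3.2.symm
    · have := hmin (i0 + 1) (i0 + r) (by omega) h3.1
      omega
  obtain ⟨i, hi, hne⟩ : ∃ i, v i = v (i + c) ∧ a (i + c) ≠ a i := by
    refine ⟨i0 + Nat.find hleave, ?_, Nat.find_spec hleave⟩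
    have : ∀ t, t ≤ Nat.find hleave → v (i0 + t) = v (i0 + t + c) := by
      intro t
      induction t with
      | zero => intro _; simpa using hi0
      | succ t ih =>
        intro ht
        have := Nat.find_min hleave (m := t) (by omega)
        push Not at this
        rw [show i0 + (t + 1) + c = (i0 + t + c) + 1 by ring]
        exact vstep _ _ (ih (by omega)) this.symm
    exact this _ le_rfl
  -- At the time `k` the path meets itself for the first time after leaving the cycle.
  have hret : ∃ k, i + c < k ∧ ∃ s, i ≤ s ∧ s < k ∧ v s = v k := by
    refine ⟨i + n * (c + 1), ?_, i, le_rfl, ?_, (vper' (c + 1) i).1.symm⟩ <;> nlinarith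
  obtain ⟨k, ⟨hk, s, his, hsk, hvs⟩, hkmin⟩ : ∃ k, (i + c < k ∧ ∃ s, i ≤ s ∧ s < k ∧ v s = v k) ∧
      ∀ t t', i ≤ t → t < t' → t' < k → v t = v t' → t = i ∧ t' = i + c := by
    refine ⟨Nat.find hret, Nat.find_spec hret, fun t t' h1 h2 h3 h4 => ?_⟩
    have h5 : ¬ i + c < t' := fun h => Nat.find_min hret h3 ⟨h, t, h1, h2, h4⟩
    have h6 := hmin t t' h2 h4
    omega
  have hear : 2 * m ≤ 2 * (k - (i + c)) + c := by
    have hks := hmin s k hsk hvs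
    by_cases hsj : i + c ≤ s
    · omega
    · push Not at hsj
      -- The ear from `i + c` to `k` and the arc of the cycle from `i` to `s` have the same ends, but
      -- differ in their first letters, so that they form a nontrivial closed path.
      have h1 := pre_eq_mul_seg a hk.le
      have h2 := pre_eq_mul_seg a his
      have h3 : FreeGroup.mk (seg a (i + c) k) ≠ FreeGroup.mk (seg a i s) := by
        intro h
        have h4 := FreeGroup.reduce.sound h
        rw [(isReduced_seg hred _ _).reduce_eq, (isReduced_seg hred _ _).reduce_eq] at h4
        have h5 := congrArg List.head? h4
        rw [seg, show k - (i + c) = (k - (i + c) - 1) + 1 by omega] at h5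
        rcases Nat.eq_zero_or_pos (s - i) with h6 | h6
        · rw [seg, h6] at h5
          simp [List.range'_succ] at h5
        · rw [seg, show s - i = (s - i - 1) + 1 by omega] at h5
          simp only [List.range'_succ, List.map_cons, List.head?_cons, Option.some.injEq] at h5
          exact hne h5
      have h4 : m ≤ (FreeGroup.mk (seg a (i + c) k) * (FreeGroup.mk (seg a i s))⁻¹).norm := by
        refine hN _ ?_ (by rwa [Ne, mul_inv_eq_one])
        have e1 : v k = v (i + c) * (FreeGroup.mk (seg a (i + c) k) : FreeGroup α) := by
          simp only [hv, h1, QuotientGroup.mk_mul]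
        have e2 : v s = v i * (FreeGroup.mk (seg a i s) : FreeGroup α) := by
          simp only [hv, h2, QuotientGroup.mk_mul]
        rw [← hvs, e2, hi, mul_right_inj] at e1
        rw [← QuotientGroup.eq_one_iff, QuotientGroup.mk_mul, QuotientGroup.mk_inv, e1,
          mul_inv_cancel]
      have h5 := FreeGroup.norm_mul_le (FreeGroup.mk (seg a (i + c) k))
        (FreeGroup.mk (seg a i s))⁻¹
      have h6 : (FreeGroup.mk (seg a (i + c) k)).norm ≤ k - (i + c) :=
        FreeGroup.norm_mk_le.trans_eq (length_seg _ _ _)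
      have h7 : (FreeGroup.mk (seg a i s)).norm ≤ s - i :=
        FreeGroup.norm_mk_le.trans_eq (length_seg _ _ _)
      rw [FreeGroup.norm_inv_eq] at h5
      omega
  -- The steps from `i` to `k` traverse distinct edges, each of which is traversed both ways.
  have hcount : 2 * (k - i) ≤ n := by
    choose o ho1 ho2 ho3 using opp
    have hvback : ∀ t t', v (t + 1) = v (t' + 1) → a t = a t' → v t = v t' := by
      intro t t' h1 h2
      rw [vsucc, vsucc, h2] at h1
      exact mul_right_cancel h1
    have same : ∀ t t', t < k - i → t < t' → t' < k - i → v (i + t) = v (i + t') →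
        a (i + t) = a (i + t') → False := by
      intro t t' h1 h2 h3 h4 h5
      obtain ⟨h6, h7⟩ := hkmin (i + t) (i + t') (by omega) (by omega) (by omega) h4
      rw [h6, h7] at h5
      exact hne h5.symm
    have cross : ∀ t t', t < t' → t' < k - i → a (i + t') = letterInv (a (i + t)) →
        v (i + t') = v (i + t + 1) → False := by
      intro t t' h1 h2 h3 h4
      rcases Nat.lt_or_ge (t + 1) t' with h | h
      · have := hkmin (i + t + 1) (i + t') (by omega) (by omega) (by omega) h4.symm
        omega
      · obtain rfl : t' = t + 1 := by omega
        exact hred (i + t) h3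
    have cross' : ∀ t t', t < k - i → t' < k - i → a (i + t) = letterInv (a (i + t')) →
        v (i + t) = v (i + t' + 1) → False := by
      intro t t' h1 h2 h3 h4
      rcases Nat.lt_trichotomy t t' with h | h | h
      · refine cross t t' h h2 (by rw [h3, letterInv_letterInv]) ?_
        rw [vsucc, h4, h3, mk_letterInv, vsucc, QuotientGroup.mk_inv, mul_inv_cancel_right]
      · subst h
        exact letterInv_ne _ h3.symm
      · exact cross t' t h h1 h3 h4
    let f : ℕ × Bool → ℕ := fun x => if x.2 then (i + x.1) % n else o (i + x.1)
    have hf : Set.InjOn f ↑(range (k - i) ×ˢ (univ : Finset Bool)) := by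
      rintro ⟨t, b⟩ ht ⟨t', b'⟩ ht' heq
      simp only [coe_product, coe_range, coe_univ, Set.mem_prod, Set.mem_Iio, Set.mem_univ,
        and_true] at ht ht'
      cases b <;> cases b' <;> simp only [f, if_true, Bool.false_eq_true, if_false] at heq
      · have h1 := ho2 (i + t)
        have h2 := ho3 (i + t)
        rw [heq, ho2] at h1
        rw [heq, ho3] at h2
        have h3 : a (i + t') = a (i + t) := by
          rw [← letterInv_letterInv (a (i + t')), h1, letterInv_letterInv]
        have h4 := hvback _ _ h2 h3
        rcases Nat.lt_trichotomy t t' with h | h | h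
        · exact (same t t' ht h ht' h4.symm h3.symm).elim
        · rw [h]
        · exact (same t' t ht' h ht h4 h3).elim
      · have h1 := ho2 (i + t)
        have h2 := ho3 (i + t)
        rw [heq, (vmod _).2] at h1
        rw [heq, (vmod _).1] at h2
        exact (cross' _ _ ht' ht h1 h2).elim
      · have h1 := ho2 (i + t')
        have h2 := ho3 (i + t')
        rw [← heq, (vmod _).2] at h1
        rw [← heq, (vmod _).1] at h2
        exact (cross' _ _ ht ht' h1 h2).elim
      · have h1 := vmod (i + t)
        have h2 := vmod (i + t')
        rw [heq] at h1
        have h3 := h1.2.symm.trans h2.2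
        have h4 := h1.1.symm.trans h2.1
        rcases Nat.lt_trichotomy t t' with h | h | h
        · exact (same t t' ht h ht' h4 h3).elim
        · rw [h]
        · exact (same t' t ht' h ht h4.symm h3.symm).elim
    have hcard := Finset.card_le_card_of_injOn (s := range (k - i) ×ˢ (univ : Finset Bool))
      (t := range n) f ?_ hf
    · simp only [card_product, card_range, card_univ, Fintype.card_bool] at hcard
      omega
    · rintro ⟨t, b⟩ _
      cases b
      · simpa [f] using ho1 _
      · simpa [f] using Nat.mod_lt _ hn
  omega

end Girth

theorem pre_eq_mk_map_range {α : Type*} (a : ℕ → α × Bool) (n : ℕ) :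
    pre a n = FreeGroup.mk ((List.range n).map a) := by
  have := pre_eq_mul_seg a (Nat.zero_le n)
  rw [this, pre, one_mul, seg, List.range_eq_range']
  rfl

theorem length_reduceCyclically_le {α : Type*} [DecidableEq α] (L : List (α × Bool)) :
    (FreeGroup.reduceCyclically L).length ≤ L.length := by
  conv_rhs => rw [← FreeGroup.reduceCyclically.conj_conjugator_reduceCyclically L]
  simp only [List.length_append]
  omega

/-- The nontrivial elements of the `d`-th term of the derived series have norm at least `3 ^ d`: the
girth of the Cayley graph triples at each level. A cyclic reduction of the element, repeated
periodically, is a path as in `three_mul_girth_le`. -/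
theorem three_pow_le_norm {α : Type*} [DecidableEq α] (d : ℕ) (g : FreeGroup α) (hg : g ≠ 1)
    (hmem : g ∈ derivedSeries (FreeGroup α) d) : 3 ^ d ≤ g.norm := by
  induction d generalizing g with
  | zero =>
    rw [pow_zero, Nat.one_le_iff_ne_zero, Ne, FreeGroup.norm_eq_zero]
    exact hg
  | succ d ih =>
    set N := derivedSeries (FreeGroup α) d with hN
    have hnormal : N.Normal := derivedSeries_normal _ _
    rw [derivedSeries_succ] at hmem
    set u := FreeGroup.reduceCyclically g.toWord with hu
    have hcr : FreeGroup.IsCyclicallyReduced u :=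
      FreeGroup.reduceCyclically.isCyclicallyReduced FreeGroup.isReduced_toWord
    have hconj := FreeGroup.reduceCyclically.conj_conjugator_reduceCyclically g.toWord
    rw [← hu] at hconj
    have hg' : g = FreeGroup.mk (FreeGroup.reduceCyclically.conjugator g.toWord) *
        FreeGroup.mk u * (FreeGroup.mk (FreeGroup.reduceCyclically.conjugator g.toWord))⁻¹ := by
      conv_lhs => rw [← FreeGroup.mk_toWord (x := g), ← hconj]
      rw [← FreeGroup.mul_mk, ← FreeGroup.mul_mk, FreeGroup.inv_mk]
    have hcmem : FreeGroup.mk u ∈ ⁅N, N⁆ := by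
      have hn2 : (⁅N, N⁆).Normal := inferInstance
      rw [hg'] at hmem
      have := hn2.conj_mem _ hmem (FreeGroup.mk (FreeGroup.reduceCyclically.conjugator g.toWord))⁻¹
      rwa [show ∀ x y : FreeGroup α, x⁻¹ * (x * y * x⁻¹) * x⁻¹⁻¹ = y by intros; group] at this
    have hcne : u ≠ [] := by
      intro h
      rw [h, ← FreeGroup.one_eq_mk] at hg'
      exact hg (hg'.trans (by rw [mul_one, mul_inv_cancel]))
    have hlen : 0 < u.length := List.length_pos_of_ne_nil hcne
    let a : ℕ → α × Bool := fun k => u[k % u.length]'(Nat.mod_lt _ hlen)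
    have hac : (List.range u.length).map a = u := by
      apply List.ext_getElem
      · simp
      · intro k h1 h2
        simp [a, Nat.mod_eq_of_lt h2]
    have hred : ∀ k, a (k + 1) ≠ letterInv (a k) := by
      intro k h
      have hkl := Nat.mod_lt k hlen
      have h1 : (a (k + 1)).1 = (a k).1 := by rw [h]; rfl
      have h2 : (a (k + 1)).2 ≠ (a k).2 := by rw [h]; simp [letterInv]
      rcases Nat.lt_or_ge (k % u.length + 1) u.length with hlt | hge
      · have e1 : (k + 1) % u.length = k % u.length + 1 := by
          rw [Nat.add_mod_eq_ite]
          rcases Nat.lt_or_ge 1 u.length with h1 | h1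
          · rw [Nat.mod_eq_of_lt h1, if_neg (by omega)]
          · omega
        have e2 := (List.isChain_iff_getElem.1 hcr.1) (k % u.length) hlt
        simp only [a, e1] at h1 h2
        exact h2 (e2 h1.symm).symm
      · have e1 : (k + 1) % u.length = 0 := by
          have e : k % u.length + 1 = u.length := by omega
          rw [← Nat.mod_add_mod, e, Nat.mod_self]
        have e2 : k % u.length = u.length - 1 := by omega
        simp only [a, e1, e2] at h1 h2
        refine h2 (hcr.2 _ ?_ _ ?_ h1.symm).symm
        · simp [List.getLast?_eq_getElem?]
        · simp [List.head?_eq_getElem?]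
    have h3 := three_mul_girth_le N (m := 3 ^ d) (fun g hg hg1 => ih g hg1 hg) a hlen hred
      (by intro k; simp [a]) (by rw [pre_eq_mk_map_range, hac]; exact hcmem)
    rw [pow_succ, mul_comm]
    refine h3.trans (length_reduceCyclically_le _)

end FreeSolvable

/-! ### A structured programming language -/

namespace RAM

/-- The variables of the structured program.
* `sym`: the input symbol read last;
* `len`, `ell`, `n`: the lengths of the code of the word, of the code of a letter, and of the word;
* `ones`: the number of digits `1` of the rank;
* `pos`, `cur`, `cnt`, `tmp`: when a letter is decoded, the position in the code, the node of the
  dictionary, the number of remaining bits, and the address of the next node;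
* `fresh`: the number of nodes of the dictionary other than the root;
* `pow`: the value of the next binary digit of the class of solvability;
* `d`: the number of levels of the derived series that remain, `lim`: two to the current level;
* `m`: the base of the codes of edges;
* `i`, `j`: times on the path spelled by the word, `val` and `jval`: their products with `m`;
* `tot`: the sum of the positive net numbers of visits to oriented edges;
* `res`: positive for the answer yes. -/
inductive Var : Type
  | sym | len | ell | ones | pos | n | cur | cnt | fresh | tmp | pow | d | lim | i | j | m | val
  | jval | tot | res
  deriving DecidableEq

/-- The arrays of the structured program.
* `bit`: the code of the word;
* `child`: the dictionary of generators, a binary tree (`IsTrie`);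
* `lab`, `sgn`: the generators and signs of the letters;
* `cls`: the classes of the prefixes of the word modulo the current level of the derived series;
* `fwd`, `bwd`: the codes of the oriented edges traversed by the word, and of their reverses;
* `net`: the positive net numbers of visits to the oriented edges (`NetCount`). -/
inductive Arr : Type
  | bit | child | lab | sgn | cls | fwd | bwd | net
  deriving DecidableEq

/-- A state of the structured language: the values of the variables and of the arrays, and the
unread part of the input. -/
structure St : Type where
  v : Var → ℕ
  a : Arr → ℕ → ℕ
  tape : List ℕ

/-- Assignment of the value `y` to the variable `x`. -/
def St.setv (σ : St) (x : Var) (y : ℕ) : St := { σ with v := Function.update σ.v x y }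

/-- Assignment of the value `y` to the entry `i` of the array `r`. -/
def St.seta (σ : St) (r : Arr) (i y : ℕ) : St :=
  { σ with a := Function.update σ.a r (Function.update (σ.a r) i y) }

/-- Reading of the next input symbol into the variable `x`. -/
def St.readv (σ : St) (x : Var) : St :=
  { σ with v := Function.update σ.v x (σ.tape.headD 0), tape := σ.tape.tail }

/-- Expressions; subtraction is truncated, and `get r e` is the entry `e` of the array `r`. -/
inductive Expr : Type
  | const (c : ℕ)
  | var (x : Var)
  | add (e f : Expr)
  | sub (e f : Expr)
  | get (r : Arr) (e : Expr)

instance : Add Expr := ⟨Expr.add⟩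
instance : Sub Expr := ⟨Expr.sub⟩

/-- The value of an expression. -/
def Expr.eval (σ : St) : Expr → ℕ
  | const c => c
  | var x => σ.v x
  | add e f => e.eval σ + f.eval σ
  | sub e f => e.eval σ - f.eval σ
  | get r e => σ.a r (e.eval σ)

/-- All constants and sums that the evaluation of the expression meets are at most `V`. -/
def Expr.ok (V : ℕ) (σ : St) : Expr → Prop
  | const c => c ≤ V
  | var _ => True
  | add e f => e.ok V σ ∧ f.ok V σ ∧ e.eval σ + f.eval σ ≤ V
  | sub e f => e.ok V σ ∧ f.ok V σ
  | get _ e => e.ok V σ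

/-- The number of instructions that evaluate the expression. -/
def Expr.len : Expr → ℕ
  | const _ => 1
  | var _ => 1
  | add e f => e.len + f.len + 1
  | sub e f => e.len + f.len + 1
  | get _ e => e.len + 7

/-- Structured programs. A condition counts as true if it is positive. -/
inductive Stmt : Type
  | skip
  | assign (x : Var) (e : Expr)
  | set (r : Arr) (e f : Expr)
  | read (x : Var)
  | seq (s t : Stmt)
  | ite (e : Expr) (s t : Stmt)
  | loop (e : Expr) (s : Stmt)

/-- Sequential composition of a list of programs. -/
def Stmt.block : List Stmt → Stmt
  | [] => skip
  | s :: l => seq s (block l)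

/-- The number of instructions of the compiled program. -/
def Stmt.len : Stmt → ℕ
  | skip => 0
  | assign _ e => e.len + 1
  | set _ e f => e.len + 6 + f.len + 1
  | read _ => 1
  | seq s t => s.len + t.len
  | ite e s t => e.len + 1 + t.len + 2 + s.len
  | .loop e s => e.len + 3 + s.len + 2

/-- `Exec V s σ σ' n`: the program `s` leads from the state `σ` to the state `σ'` in `n` steps of
the compiled program, and all constants and sums on the way are at most `V`. -/
inductive Exec (V : ℕ) : Stmt → St → St → ℕ → Prop
  | skip {σ} : Exec V .skip σ σ 0
  | assign {σ x e} : e.ok V σ → Exec V (.assign x e) σ (σ.setv x (e.eval σ)) (e.len + 1)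
  | set {σ r e f} : e.ok V σ → f.ok V σ →
      Exec V (.set r e f) σ (σ.seta r (e.eval σ) (f.eval σ)) (e.len + 6 + f.len + 1)
  | read {σ x} : Exec V (.read x) σ (σ.readv x) 1
  | seq {s t σ σ' σ'' n m} : Exec V s σ σ' n → Exec V t σ' σ'' m → Exec V (.seq s t) σ σ'' (n + m)
  | ite_pos {e s t σ σ' n} : e.ok V σ → 0 < e.eval σ → Exec V s σ σ' n →
      Exec V (.ite e s t) σ σ' (e.len + 1 + n)
  | ite_zero {e s t σ σ' n} : e.ok V σ → e.eval σ = 0 → Exec V t σ σ' n →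
      Exec V (.ite e s t) σ σ' (e.len + 1 + (n + 2))
  | loop_pos {e s σ σ' σ'' n m} : e.ok V σ → 0 < e.eval σ → Exec V s σ σ' n →
      Exec V (.loop e s) σ' σ'' m → Exec V (.loop e s) σ σ'' (e.len + 1 + (n + 2) + m)
  | loop_zero {e s σ} : e.ok V σ → e.eval σ = 0 → Exec V (.loop e s) σ σ (e.len + 3)

/-! ### Compilation of structured programs -/

/-- The position of an array in the interleaved memory layout. -/
def Arr.code (r : Arr) : ℕ := r.ctorIdx

theorem Arr.code_lt (r : Arr) : r.code < 8 := by cases r <;> decide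

theorem Arr.code_injective : Function.Injective Arr.code := by
  intro r r' h
  cases r <;> cases r' <;> first | rfl | exact absurd h (by decide)

/-- The number of a variable. -/
def Var.code (x : Var) : ℕ := x.ctorIdx

theorem Var.code_injective : Function.Injective Var.code := by
  intro x y h
  rw [← Var.ofNat_ctorIdx x, ← Var.ofNat_ctorIdx y]
  exact congrArg _ h

/-- The register of a variable. The registers are divided up by their residues modulo `16`: the
residues below `8` belong to the arrays, `8` to the variables, `9` to the intermediate results of
expressions, and register `10` always holds zero. -/
def varReg (x : Var) : ℕ := 16 * x.code + 8

/-- The register of the intermediate result number `d`. -/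
def tmpReg (d : ℕ) : ℕ := 16 * d + 9

/-- The register of an array entry. -/
def arrReg (r : Arr) (i : ℕ) : ℕ := 16 * i + r.code

/-- Instructions replacing an index in `tmpReg d` by the register of that entry of the array `r`. -/
def addrCode (r : Arr) (d : ℕ) : List Instr :=
  [.add (tmpReg d) (tmpReg d) (tmpReg d), .add (tmpReg d) (tmpReg d) (tmpReg d),
    .add (tmpReg d) (tmpReg d) (tmpReg d), .add (tmpReg d) (tmpReg d) (tmpReg d),
    .const (tmpReg (d + 1)) r.code, .add (tmpReg d) (tmpReg d) (tmpReg (d + 1))]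

/-- Instructions computing the value of an expression in `tmpReg d`. -/
def Expr.compile : Expr → ℕ → List Instr
  | const c, d => [.const (tmpReg d) c]
  | var x, d => [.add (tmpReg d) (varReg x) 10]
  | add e f, d => e.compile d ++ (f.compile (d + 1) ++
      [.add (tmpReg d) (tmpReg d) (tmpReg (d + 1))])
  | sub e f, d => e.compile d ++ (f.compile (d + 1) ++
      [.sub (tmpReg d) (tmpReg d) (tmpReg (d + 1))])
  | get r e, d => e.compile d ++ (addrCode r d ++ [.load (tmpReg d) (tmpReg d)])

/-- The compiled program, to be placed at the position `o`. -/
def Stmt.compile : Stmt → ℕ → List Instr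
  | skip, _ => []
  | assign x e, _ => e.compile 0 ++ [.add (varReg x) (tmpReg 0) 10]
  | set r e f, _ => e.compile 0 ++ (addrCode r 0 ++ (f.compile 1 ++
      [.store (tmpReg 0) (tmpReg 1)]))
  | read x, _ => [.read (varReg x)]
  | seq s t, o => s.compile o ++ t.compile (o + s.len)
  | ite e s t, o => e.compile 0 ++ ([.jump (tmpReg 0) (o + e.len + 1 + t.len + 2)] ++
      (t.compile (o + e.len + 1) ++
      ([.const (tmpReg 0) 1, .jump (tmpReg 0) (o + e.len + 1 + t.len + 2 + s.len)] ++
      s.compile (o + e.len + 1 + t.len + 2))))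
  | .loop e s, o => e.compile 0 ++ ([.jump (tmpReg 0) (o + e.len + 3), .const (tmpReg 0) 1,
      .jump (tmpReg 0) (o + e.len + 3 + s.len + 2)] ++ (s.compile (o + e.len + 3) ++
      [.const (tmpReg 0) 1, .jump (tmpReg 0) o]))

theorem Expr.length_compile (e : Expr) (d : ℕ) : (e.compile d).length = e.len := by
  induction e generalizing d with
  | const | var => rfl
  | add e f he hf | sub e f he hf => simp [compile, len, he, hf]; omega
  | get r e he => simp [compile, len, he, addrCode]

theorem Stmt.length_compile (s : Stmt) (o : ℕ) : (s.compile o).length = s.len := by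
  induction s generalizing o with
  | skip | read => rfl
  | assign => simp [compile, len, Expr.length_compile]
  | set => simp [compile, len, Expr.length_compile, addrCode]; omega
  | seq s t hs ht => simp [compile, len, hs, ht]
  | ite e s t hs ht => simp [compile, len, hs, ht, Expr.length_compile]; omega
  | loop e s hs => simp [compile, len, hs, Expr.length_compile]; omega

/-- The code `l` stands at the position `o` of the program `P`. -/
def At (P : Program) (o : ℕ) (l : List Instr) : Prop :=
  ∀ i (h : i < l.length), P[o + i]? = some l[i]

theorem At.append {P : Program} {o : ℕ} {l l' : List Instr} (h : At P o (l ++ l')) :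
    At P o l ∧ At P (o + l.length) l' := by
  constructor
  · intro i hi
    rw [h i (by rw [List.length_append]; omega), List.getElem_append_left hi]
  · intro i hi
    rw [add_assoc, h (l.length + i) (by rw [List.length_append]; omega),
      List.getElem_append_right (by omega)]
    simp

theorem At.cons {P : Program} {o : ℕ} {I : Instr} {l : List Instr} (h : At P o (I :: l)) :
    P[o]? = some I ∧ At P (o + 1) l := by
  have := At.append (l := [I]) h
  exact ⟨by simpa using this.1 0 (by simp), this.2⟩

/-- From `c` the program reaches `c'` with cost at most `n * κ`. This is phrased through the runs that
start in `c'`, so that it composes with `HaltsFrom`. -/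
def Reach (P : Program) (κ : ℕ) (c c' : Config) (n : ℕ) : Prop :=
  ∃ t ≤ n * κ, ∀ t' b, HaltsFrom P c' t' b → HaltsFrom P c (t + t') b

theorem Reach.refl {P : Program} {κ : ℕ} {c : Config} : Reach P κ c c 0 :=
  ⟨0, by simp, fun t' b h => by simpa using h⟩

theorem Reach.trans {P : Program} {κ n m : ℕ} {c c' c'' : Config} (h : Reach P κ c c' n)
    (h' : Reach P κ c' c'' m) : Reach P κ c c'' (n + m) := by
  obtain ⟨t, ht, H⟩ := h
  obtain ⟨t', ht', H'⟩ := h'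
  refine ⟨t + t', by rw [add_mul]; omega, fun u b hu => ?_⟩
  rw [add_assoc]
  exact H _ _ (H' _ _ hu)

theorem Reach.step {P : Program} {κ : ℕ} {c c' : Config} {I : Instr} (h : P[c.pc]? = some I)
    (h' : I.next c = some c') (hc : I.cost c ≤ κ) : Reach P κ c c' 1 :=
  ⟨I.cost c, by simpa using hc, fun _ _ h'' => .step h h' h''⟩

theorem Reach.cast {P : Program} {κ n p p' : ℕ} {c : Config} {ρ : ℕ → ℕ} {τ : List ℕ}
    (h : Reach P κ c ⟨p, ρ, τ⟩ n) (hp : p = p') : Reach P κ c ⟨p', ρ, τ⟩ n := hp ▸ h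

/-- The registers represent the state. -/
structure Rel (σ : St) (ρ : ℕ → ℕ) : Prop where
  var : ∀ x, ρ (varReg x) = σ.v x
  arr : ∀ r i, ρ (arrReg r i) = σ.a r i
  zero : ρ 10 = 0

/-- All numbers in the state are at most `V`. -/
structure Bounded (V : ℕ) (σ : St) : Prop where
  var : ∀ x, σ.v x ≤ V
  arr : ∀ r i, σ.a r i ≤ V
  tape : ∀ x ∈ σ.tape, x ≤ V

/-- A bound for the cost of one instruction when the numbers in the state are at most `V`. -/
def unitCost (V : ℕ) : ℕ := 2 * bitLen (16 * V + 16)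

theorem bitLen_mono {m n : ℕ} (h : m ≤ n) : bitLen m ≤ bitLen n :=
  max_le_max le_rfl (Nat.size_le_size h)

theorem bitLen_le_unitCost {V m : ℕ} (hm : m ≤ 16 * V + 16) : bitLen m ≤ unitCost V := by
  have := bitLen_mono hm
  unfold unitCost
  omega

theorem bitLen_add_bitLen_le {V m n : ℕ} (hm : m ≤ 16 * V + 16) (hn : n ≤ 16 * V + 16) :
    bitLen m + bitLen n ≤ unitCost V := by
  have := bitLen_mono hm
  have := bitLen_mono hn
  unfold unitCost
  omega

theorem Expr.eval_le {V : ℕ} {σ : St} (hσ : Bounded V σ) {e : Expr} (h : e.ok V σ) :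
    e.eval σ ≤ V := by
  induction e with
  | const c => exact h
  | var x => exact hσ.var x
  | add e f he hf => exact h.2.2
  | sub e f he hf => exact (Nat.sub_le _ _).trans (he h.1)
  | get r e he => exact hσ.arr _ _

theorem Bounded.setv {V : ℕ} {σ : St} (hσ : Bounded V σ) {x : Var} {y : ℕ} (hy : y ≤ V) :
    Bounded V (σ.setv x y) where
  var z := by
    simp only [St.setv, Function.update_apply]
    split
    exacts [hy, hσ.var z]
  arr := hσ.arr
  tape := hσ.tape

theorem Bounded.seta {V : ℕ} {σ : St} (hσ : Bounded V σ) {r : Arr} {i y : ℕ} (hy : y ≤ V) :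
    Bounded V (σ.seta r i y) where
  var := hσ.var
  arr r' k := by
    simp only [St.seta, Function.update_apply]
    split
    · rw [Function.update_apply]
      split
      exacts [hy, hσ.arr _ _]
    · exact hσ.arr _ _
  tape := hσ.tape

theorem Bounded.readv {V : ℕ} {σ : St} (hσ : Bounded V σ) {x : Var} : Bounded V (σ.readv x) where
  var z := by
    simp only [St.readv, Function.update_apply]
    split
    · cases ht : σ.tape with
      | nil => simp
      | cons y l => exact hσ.tape y (by rw [ht]; simp)
    · exact hσ.var z
  arr := hσ.arr
  tape y hy := hσ.tape y (List.mem_of_mem_tail hy)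

theorem Exec.bounded {V : ℕ} {s : Stmt} {σ σ' : St} {n : ℕ} (h : Exec V s σ σ' n)
    (hσ : Bounded V σ) : Bounded V σ' := by
  induction h with
  | skip => exact hσ
  | assign he => exact hσ.setv (Expr.eval_le hσ he)
  | set he hf => exact hσ.seta (Expr.eval_le hσ hf)
  | read => exact hσ.readv
  | seq _ _ ih ih' => exact ih' (ih hσ)
  | ite_pos _ _ _ ih => exact ih hσ
  | ite_zero _ _ _ ih => exact ih hσ
  | loop_pos _ _ _ _ ih ih' => exact ih' (ih hσ)
  | loop_zero => exact hσ

theorem Rel.update_tmp {σ : St} {ρ : ℕ → ℕ} (h : Rel σ ρ) (d y : ℕ) :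
    Rel σ (Function.update ρ (tmpReg d) y) where
  var x := by rw [Function.update_of_ne (by simp only [varReg, tmpReg]; omega), h.var]
  arr r i := by
    have := r.code_lt
    rw [Function.update_of_ne (by simp only [arrReg, tmpReg]; omega), h.arr]
  zero := by rw [Function.update_of_ne (by simp only [tmpReg]; omega), h.zero]

theorem Rel.update_var {σ : St} {ρ : ℕ → ℕ} (h : Rel σ ρ) (x : Var) (y : ℕ) :
    Rel (σ.setv x y) (Function.update ρ (varReg x) y) where
  var z := by
    simp only [St.setv, Function.update_apply]
    by_cases hz : z = x
    · simp [hz]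
    · rw [if_neg, if_neg hz, h.var]
      intro he
      exact hz (Var.code_injective (by simp only [varReg] at he; omega))
  arr r i := by
    have := r.code_lt
    rw [Function.update_of_ne (by simp only [arrReg, varReg]; omega), h.arr]
    rfl
  zero := by rw [Function.update_of_ne (by simp only [varReg]; omega), h.zero]

theorem Rel.update_arr {σ : St} {ρ : ℕ → ℕ} (h : Rel σ ρ) (r : Arr) (i y : ℕ) :
    Rel (σ.seta r i y) (Function.update ρ (arrReg r i) y) where
  var x := by
    have := r.code_lt
    rw [Function.update_of_ne (by simp only [arrReg, varReg]; omega), h.var]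
    rfl
  arr r' k := by
    have h1 := r.code_lt
    have h2 := r'.code_lt
    simp only [St.seta, Function.update_apply]
    by_cases hr : r' = r
    · subst hr
      by_cases hk : k = i
      · simp [hk]
      · rw [if_neg (by simp only [arrReg]; omega), if_pos rfl, Function.update_of_ne hk, h.arr]
    · rw [if_neg, if_neg hr, h.arr]
      intro he
      exact hr (Arr.code_injective (by simp only [arrReg] at he; omega))
  zero := by
    have := r.code_lt
    rw [Function.update_of_ne (by simp only [arrReg]; omega), h.zero]

theorem Rel.readv {σ : St} {ρ : ℕ → ℕ} (h : Rel σ ρ) (x : Var) :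
    Rel (σ.readv x) (Function.update ρ (varReg x) (σ.tape.headD 0)) :=
  ⟨(h.update_var x _).var, (h.update_var x _).arr, (h.update_var x _).zero⟩

theorem reach_addrCode {P : Program} {V : ℕ} {σ : St} {r : Arr} {d o : ℕ} {ρ : ℕ → ℕ}
    {τ : List ℕ} (hρ : Rel σ ρ) (hP : At P o (addrCode r d)) (hV : ρ (tmpReg d) ≤ V) :
    ∃ ρ', Reach P (unitCost V) ⟨o, ρ, τ⟩ ⟨o + 6, ρ', τ⟩ 6 ∧ Rel σ ρ' ∧
      ρ' (tmpReg d) = arrReg r (ρ (tmpReg d)) ∧ ∀ d' < d, ρ' (tmpReg d') = ρ (tmpReg d') := by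
  have hr := r.code_lt
  obtain ⟨h1, hP⟩ := hP.cons
  obtain ⟨h2, hP⟩ := hP.cons
  obtain ⟨h3, hP⟩ := hP.cons
  obtain ⟨h4, hP⟩ := hP.cons
  obtain ⟨h5, hP⟩ := hP.cons
  obtain ⟨h6, -⟩ := hP.cons
  have hne : tmpReg (d + 1) ≠ tmpReg d := by simp only [tmpReg]; omega
  refine ⟨_, ((((((Reach.step h1 rfl ?_).trans (Reach.step h2 rfl ?_)).trans
    (Reach.step h3 rfl ?_)).trans (Reach.step h4 rfl ?_)).trans (Reach.step h5 rfl ?_)).trans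
    (Reach.step h6 rfl ?_)), ?_, ?_, ?_⟩
  · exact bitLen_add_bitLen_le (by dsimp only; omega) (by dsimp only; omega)
  · simp only [Instr.cost, Function.update_self]
    exact bitLen_add_bitLen_le (by omega) (by omega)
  · simp only [Instr.cost, Function.update_self]
    exact bitLen_add_bitLen_le (by omega) (by omega)
  · simp only [Instr.cost, Function.update_self]
    exact bitLen_add_bitLen_le (by omega) (by omega)
  · exact bitLen_le_unitCost (by omega)
  · simp only [Instr.cost, Function.update_self, Function.update_of_ne hne.symm]
    exact bitLen_add_bitLen_le (by omega) (by omega)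
  · exact (((((hρ.update_tmp _ _).update_tmp _ _).update_tmp _ _).update_tmp _ _).update_tmp
      _ _).update_tmp _ _
  · simp only [Function.update_self, Function.update_of_ne hne.symm, arrReg]
    omega
  · intro d' hd'
    have h1 : tmpReg d' ≠ tmpReg d := by simp only [tmpReg]; omega
    have h2 : tmpReg d' ≠ tmpReg (d + 1) := by simp only [tmpReg]; omega
    simp only [Function.update_of_ne h1, Function.update_of_ne h2]

theorem Expr.reach_compile {P : Program} {V : ℕ} {σ : St} (hσ : Bounded V σ) {e : Expr} {d o : ℕ}
    {ρ : ℕ → ℕ} {τ : List ℕ} (hρ : Rel σ ρ) (he : e.ok V σ) (hP : At P o (e.compile d)) :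
    ∃ ρ', Reach P (unitCost V) ⟨o, ρ, τ⟩ ⟨o + e.len, ρ', τ⟩ e.len ∧ Rel σ ρ' ∧
      ρ' (tmpReg d) = e.eval σ ∧ ∀ d' < d, ρ' (tmpReg d') = ρ (tmpReg d') := by
  induction e generalizing d o ρ with
  | const c =>
    refine ⟨_, Reach.step hP.cons.1 rfl (bitLen_le_unitCost ?_), hρ.update_tmp _ _,
      Function.update_self .., fun d' hd' => Function.update_of_ne ?_ ..⟩
    · have : c ≤ V := he
      omega
    · simp only [tmpReg]; omega
  | var x =>
    refine ⟨_, Reach.step hP.cons.1 rfl (bitLen_add_bitLen_le ?_ ?_), hρ.update_tmp _ _, ?_,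
      fun d' hd' => Function.update_of_ne ?_ ..⟩
    · have := hσ.var x
      simp only [hρ.var]
      omega
    · simp [hρ.zero]
    · simp [hρ.zero, hρ.var, eval]
    · simp only [tmpReg]; omega
  | add e f ihe ihf =>
    obtain ⟨hP1, hP2⟩ := hP.append
    obtain ⟨hP2, hP3⟩ := hP2.append
    rw [length_compile] at hP2 hP3
    rw [length_compile] at hP3
    obtain ⟨ρ1, r1, hρ1, hd1, h1⟩ := ihe hρ he.1 hP1
    obtain ⟨ρ2, r2, hρ2, hd2, h2⟩ := ihf hρ1 he.2.1 hP2
    have he' := eval_le hσ he.1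
    have hf' := eval_le hσ he.2.1
    have hd3 := h2 d (by omega)
    refine ⟨_, ((r1.trans r2).trans (Reach.step hP3.cons.1 rfl
      (bitLen_add_bitLen_le ?_ ?_))).cast (by simp only [len, add_assoc]),
      hρ2.update_tmp _ _, ?_, fun d' hd' => ?_⟩
    · dsimp only; omega
    · dsimp only; omega
    · simp only [Function.update_self, hd3, hd1, hd2, eval]
    · rw [Function.update_of_ne (by simp only [tmpReg]; omega)]
      exact (h2 d' (by omega)).trans (h1 d' hd')
  | sub e f ihe ihf =>
    obtain ⟨hP1, hP2⟩ := hP.append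
    obtain ⟨hP2, hP3⟩ := hP2.append
    rw [length_compile] at hP2 hP3
    rw [length_compile] at hP3
    obtain ⟨ρ1, r1, hρ1, hd1, h1⟩ := ihe hρ he.1 hP1
    obtain ⟨ρ2, r2, hρ2, hd2, h2⟩ := ihf hρ1 he.2 hP2
    have he' := eval_le hσ he.1
    have hf' := eval_le hσ he.2
    have hd3 := h2 d (by omega)
    refine ⟨_, ((r1.trans r2).trans (Reach.step hP3.cons.1 rfl
      (bitLen_add_bitLen_le ?_ ?_))).cast (by simp only [len, add_assoc]),
      hρ2.update_tmp _ _, ?_, fun d' hd' => ?_⟩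
    · dsimp only; omega
    · dsimp only; omega
    · simp only [Function.update_self, hd3, hd1, hd2, eval]
    · rw [Function.update_of_ne (by simp only [tmpReg]; omega)]
      exact (h2 d' (by omega)).trans (h1 d' hd')
  | get r e ihe =>
    obtain ⟨hP1, hP2⟩ := hP.append
    obtain ⟨hP2, hP3⟩ := hP2.append
    rw [length_compile] at hP2 hP3
    obtain ⟨ρ1, r1, hρ1, hd1, h1⟩ := ihe hρ he hP1
    have he' : e.eval σ ≤ V := eval_le hσ he
    obtain ⟨ρ2, r2, hρ2, hd2, h2⟩ := reach_addrCode (τ := τ) hρ1 hP2 (V := V) (by omega)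
    have hr := r.code_lt
    have hval := hσ.arr r (e.eval σ)
    rw [hd1] at hd2
    refine ⟨_, ((r1.trans r2).trans (Reach.step hP3.cons.1 rfl
      (bitLen_add_bitLen_le ?_ ?_))).cast (by simp only [len, add_assoc]),
      hρ2.update_tmp _ _, ?_, fun d' hd' => ?_⟩
    · simp only [hd2, arrReg]; omega
    · simp only [hd2, hρ2.arr]; omega
    · simp only [Function.update_self, hd2, hρ2.arr, eval]
    · rw [Function.update_of_ne (by simp only [tmpReg]; omega)]
      exact (h2 d' (by omega)).trans (h1 d' hd')

/-- The compiled program simulates the structured program. -/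
theorem Exec.reach_compile {P : Program} {V : ℕ} {s : Stmt} {σ σ' : St} {n o : ℕ} {ρ : ℕ → ℕ}
    (h : Exec V s σ σ' n) (hσ : Bounded V σ) (hρ : Rel σ ρ) (hP : At P o (s.compile o)) :
    ∃ ρ', Reach P (unitCost V) ⟨o, ρ, σ.tape⟩ ⟨o + s.len, ρ', σ'.tape⟩ n ∧ Rel σ' ρ' := by
  induction h generalizing o ρ with
  | skip => exact ⟨ρ, Reach.refl, hρ⟩
  | @assign σ x e he =>
    obtain ⟨hP1, hP2⟩ := hP.append
    rw [Expr.length_compile] at hP2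
    obtain ⟨ρ1, r1, hρ1, hd1, -⟩ := Expr.reach_compile (τ := σ.tape) hσ hρ he hP1
    have he' := Expr.eval_le hσ he
    refine ⟨_, r1.trans (Reach.step hP2.cons.1 rfl (bitLen_add_bitLen_le ?_ ?_)), ?_⟩
    · dsimp only; omega
    · simp [hρ1.zero]
    · simp only [hρ1.zero, hd1, add_zero]
      exact hρ1.update_var _ _
  | @set σ r e f he hf =>
    obtain ⟨hP1, hP2⟩ := hP.append
    obtain ⟨hP2, hP3⟩ := hP2.append
    obtain ⟨hP3, hP4⟩ := hP3.append
    rw [Expr.length_compile] at hP2 hP3 hP4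
    rw [Expr.length_compile] at hP4
    obtain ⟨ρ1, r1, hρ1, hd1, -⟩ := Expr.reach_compile (τ := σ.tape) hσ hρ he hP1
    have he' := Expr.eval_le hσ he
    have hf' := Expr.eval_le hσ hf
    have hr := r.code_lt
    obtain ⟨ρ2, r2, hρ2, hd2, -⟩ := reach_addrCode (τ := σ.tape) hρ1 hP2 (V := V) (by omega)
    obtain ⟨ρ3, r3, hρ3, hd3, h3⟩ := Expr.reach_compile (τ := σ.tape) hσ hρ2 hf hP3
    have hd4 := h3 0 (by omega)
    rw [hd2, hd1] at hd4
    refine ⟨_, (((r1.trans r2).trans r3).trans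
      (Reach.step hP4.cons.1 rfl (bitLen_add_bitLen_le ?_ ?_))).cast
      (by simp only [Stmt.len, add_assoc, addrCode, List.length_cons, List.length_nil,
        Nat.reduceAdd]), ?_⟩
    · simp only [hd4, arrReg]; omega
    · dsimp only; omega
    · simp only [hd4, hd3]
      exact hρ3.update_arr _ _ _
  | @read σ x =>
    refine ⟨_, Reach.step hP.cons.1 rfl (bitLen_le_unitCost ?_), hρ.readv x⟩
    have := hσ.readv (x := x).var x
    simp only [St.readv, Function.update_self] at this
    dsimp only
    omega
  | @seq s t σ σ' σ'' n m h1 h2 ih1 ih2 =>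
    obtain ⟨hP1, hP2⟩ := hP.append
    rw [Stmt.length_compile] at hP2
    obtain ⟨ρ1, r1, hρ1⟩ := ih1 hσ hρ hP1
    obtain ⟨ρ2, r2, hρ2⟩ := ih2 (h1.bounded hσ) hρ1 hP2
    refine ⟨ρ2, ?_, hρ2⟩
    rw [Stmt.len, ← add_assoc]
    exact r1.trans r2
  | @ite_pos e s t σ σ' n he hpos h1 ih =>
    obtain ⟨hP1, hP2⟩ := hP.append
    obtain ⟨hP2, hP3⟩ := hP2.append
    obtain ⟨hP3, hP4⟩ := hP3.append
    obtain ⟨hP4, hP5⟩ := hP4.append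
    simp only [Expr.length_compile, Stmt.length_compile, List.length_cons, List.length_nil]
      at hP2 hP3 hP4 hP5
    obtain ⟨ρ1, r1, hρ1, hd1, -⟩ := Expr.reach_compile (τ := σ.tape) hσ hρ he hP1
    have he' := Expr.eval_le hσ he
    obtain ⟨ρ2, r2, hρ2⟩ := ih hσ hρ1 hP5
    refine ⟨ρ2, ?_, hρ2⟩
    have r3 := Reach.step (κ := unitCost V) (c := ⟨o + e.len, ρ1, σ.tape⟩) hP2.cons.1 rfl
      (bitLen_le_unitCost (by dsimp only; omega))
    simp only [hd1, hpos, if_true] at r3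
    have := (r1.trans r3).trans r2
    simp only [Stmt.len, zero_add, ← add_assoc] at this ⊢
    exact this
  | @ite_zero e s t σ σ' n he hzero h1 ih =>
    obtain ⟨hP1, hP2⟩ := hP.append
    obtain ⟨hP2, hP3⟩ := hP2.append
    obtain ⟨hP3, hP4⟩ := hP3.append
    obtain ⟨hP4, -⟩ := hP4.append
    simp only [Expr.length_compile, Stmt.length_compile, List.length_cons, List.length_nil]
      at hP2 hP3 hP4
    obtain ⟨ρ1, r1, hρ1, hd1, -⟩ := Expr.reach_compile (τ := σ.tape) hσ hρ he hP1
    have he' := Expr.eval_le hσ he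
    obtain ⟨ρ2, r2, hρ2⟩ := ih hσ hρ1 hP3
    have r3 := Reach.step (κ := unitCost V) (c := ⟨o + e.len, ρ1, σ.tape⟩) hP2.cons.1 rfl
      (bitLen_le_unitCost (by dsimp only; omega))
    simp only [hd1, hzero, lt_irrefl, if_false] at r3
    obtain ⟨hJ1, hJ2⟩ := hP4.cons
    have r4 := Reach.step (κ := unitCost V) (c := ⟨o + e.len + 1 + t.len, ρ2, σ'.tape⟩) hJ1 rfl
      (bitLen_le_unitCost (by omega))
    have r5 := Reach.step (κ := unitCost V) (c := ⟨o + e.len + 1 + t.len + 1,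
      Function.update ρ2 (tmpReg 0) 1, σ'.tape⟩) hJ2.cons.1 rfl
      (bitLen_le_unitCost (by simp))
    simp only [Function.update_self, zero_lt_one, if_true] at r5
    refine ⟨_, ?_, hρ2.update_tmp 0 1⟩
    have := (r1.trans r3).trans ((r2.trans r4).trans r5)
    simp only [Stmt.len, ← add_assoc] at this ⊢
    exact this
  | @loop_pos e s σ σ' σ'' n m he hpos h1 h2 ih1 ih2 =>
    obtain ⟨hP1, hP2⟩ := id hP.append
    obtain ⟨hP2, hP3⟩ := hP2.append
    obtain ⟨hP3, hP4⟩ := hP3.append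
    simp only [Expr.length_compile, Stmt.length_compile, List.length_cons, List.length_nil]
      at hP2 hP3 hP4
    obtain ⟨ρ1, r1, hρ1, hd1, -⟩ := Expr.reach_compile (τ := σ.tape) hσ hρ he hP1
    have he' := Expr.eval_le hσ he
    obtain ⟨ρ2, r2, hρ2⟩ := ih1 hσ hρ1 hP3
    have r3 := Reach.step (κ := unitCost V) (c := ⟨o + e.len, ρ1, σ.tape⟩) hP2.cons.1 rfl
      (bitLen_le_unitCost (by dsimp only; omega))
    simp only [hd1, hpos, if_true] at r3
    obtain ⟨hJ1, hJ2⟩ := hP4.cons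
    have r4 := Reach.step (κ := unitCost V) (c := ⟨o + e.len + 3 + s.len, ρ2, σ'.tape⟩) hJ1 rfl
      (bitLen_le_unitCost (by omega))
    have r5 := Reach.step (κ := unitCost V) (c := ⟨o + e.len + 3 + s.len + 1,
      Function.update ρ2 (tmpReg 0) 1, σ'.tape⟩) hJ2.cons.1 rfl
      (bitLen_le_unitCost (by simp))
    simp only [Function.update_self, zero_lt_one, if_true] at r5
    obtain ⟨ρ3, r6, hρ3⟩ := ih2 (h1.bounded hσ) (hρ2.update_tmp 0 1) hP
    exact ⟨ρ3, ((r1.trans r3).trans ((r2.trans r4).trans r5)).trans r6, hρ3⟩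
  | @loop_zero e s σ he hzero =>
    obtain ⟨hP1, hP2⟩ := hP.append
    obtain ⟨hP2, -⟩ := hP2.append
    rw [Expr.length_compile] at hP2
    obtain ⟨ρ1, r1, hρ1, hd1, -⟩ := Expr.reach_compile (τ := σ.tape) hσ hρ he hP1
    have he' := Expr.eval_le hσ he
    have r3 := Reach.step (κ := unitCost V) (c := ⟨o + e.len, ρ1, σ.tape⟩) hP2.cons.1 rfl
      (bitLen_le_unitCost (by dsimp only; omega))
    simp only [hd1, hzero, lt_irrefl, if_false] at r3
    obtain ⟨hJ1, hJ2⟩ := hP2.cons.2.cons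
    have r4 := Reach.step (κ := unitCost V) (c := ⟨o + e.len + 1, ρ1, σ.tape⟩) hJ1 rfl
      (bitLen_le_unitCost (by omega))
    have r5 := Reach.step (κ := unitCost V) (c := ⟨o + e.len + 1 + 1,
      Function.update ρ1 (tmpReg 0) 1, σ.tape⟩) hJ2.cons.1 rfl
      (bitLen_le_unitCost (by simp))
    simp only [Function.update_self, zero_lt_one, if_true] at r5
    refine ⟨_, ?_, hρ1.update_tmp 0 1⟩
    have := r1.trans (r3.trans (r4.trans r5))
    simp only [Stmt.len, ← add_assoc] at this ⊢
    exact this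

/-- The machine program that runs `s` and accepts if `res` is positive at the end. -/
def Stmt.toProgram (s : Stmt) : Program :=
  s.compile 0 ++ [.jump (varReg .res) (s.len + 2), .reject, .accept]

/-- A structured program that takes `n` steps with numbers at most `V` yields a machine program with
running time `O(n log V)`. -/
theorem Exec.halts {V : ℕ} {s : Stmt} {τ : List ℕ} {σ' : St} {n : ℕ}
    (h : Exec V s ⟨fun _ => 0, fun _ _ => 0, τ⟩ σ' n) (hτ : ∀ x ∈ τ, x ≤ V) :
    ∃ t, Halts s.toProgram τ t (decide (0 < σ'.v .res)) ∧ t ≤ (n + 2) * unitCost V := by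
  have hσ : Bounded V ⟨fun _ => 0, fun _ _ => 0, τ⟩ :=
    ⟨fun _ => Nat.zero_le _, fun _ _ => Nat.zero_le _, hτ⟩
  have hat : ∀ i (hi : i < s.toProgram.length), s.toProgram[0 + i]? = some s.toProgram[i] := by
    intro i hi
    rw [zero_add, List.getElem?_eq_getElem hi]
  have hat : At s.toProgram 0 (s.compile 0 ++
    [.jump (varReg .res) (s.len + 2), .reject, .accept]) := hat
  obtain ⟨h1, h2⟩ := hat.append
  rw [Stmt.length_compile] at h2
  obtain ⟨ρ, ⟨t, ht, H⟩, hρ⟩ := h.reach_compile hσ (ρ := fun _ => 0)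
    ⟨fun _ => rfl, fun _ _ => rfl, rfl⟩ h1
  obtain ⟨hJ, h2⟩ := h2.cons
  obtain ⟨hR, h2⟩ := h2.cons
  obtain ⟨hA, -⟩ := h2.cons
  have hone : 1 ≤ unitCost V :=
    le_trans (le_max_left _ _) (bitLen_le_unitCost (m := 0) (Nat.zero_le _))
  have hcost : bitLen (ρ (varReg .res)) ≤ unitCost V := by
    refine bitLen_le_unitCost ?_
    have := (h.bounded hσ).var .res
    rw [hρ.var]
    omega
  refine ⟨t + (bitLen (ρ (varReg .res)) + 1), H _ _ ?_, by nlinarith⟩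
  refine HaltsFrom.step (c := ⟨0 + s.len, ρ, σ'.tape⟩) (I := .jump (varReg .res) (s.len + 2))
    hJ rfl ?_
  by_cases hres : 0 < σ'.v .res
  · simp only [hρ.var, hres, if_true, decide_true]
    exact HaltsFrom.accept (by rw [← hA]; congr 1; dsimp only; omega)
  · simp only [hρ.var, hres, if_false, decide_false]
    exact HaltsFrom.reject hR

/-! ### Rules for reasoning about structured programs -/

/-- From `σ`, the program `s` ends in a state with the property `Q` after at most `n` steps,
with all constants and sums on the way at most `V`. -/
def Runs (V : ℕ) (s : Stmt) (σ : St) (n : ℕ) (Q : St → Prop) : Prop :=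
  ∃ σ' t, Exec V s σ σ' t ∧ t ≤ n ∧ Q σ'

theorem Runs.mono {V : ℕ} {s : Stmt} {σ : St} {n n' : ℕ} {Q Q' : St → Prop} (h : Runs V s σ n Q)
    (hn : n ≤ n') (hQ : ∀ σ', Q σ' → Q' σ') : Runs V s σ n' Q' := by
  obtain ⟨σ', t, h1, h2, h3⟩ := h
  exact ⟨σ', t, h1, h2.trans hn, hQ _ h3⟩

theorem Runs.seq {V : ℕ} {s t : Stmt} {σ : St} {n m : ℕ} {Q R : St → Prop} (h : Runs V s σ n Q)
    (h' : ∀ σ', Q σ' → Runs V t σ' m R) : Runs V (.seq s t) σ (n + m) R := by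
  obtain ⟨σ', k, h1, h2, h3⟩ := h
  obtain ⟨σ'', k', h1', h2', h3'⟩ := h' _ h3
  exact ⟨σ'', k + k', .seq h1 h1', by omega, h3'⟩

theorem Runs.block_nil {V : ℕ} {σ : St} {Q : St → Prop} (h : Q σ) : Runs V (.block []) σ 0 Q :=
  ⟨σ, 0, .skip, le_rfl, h⟩

theorem Runs.ite {V : ℕ} {e : Expr} {s t : Stmt} {σ : St} {n : ℕ} {Q : St → Prop}
    (he : e.ok V σ) (h1 : 0 < e.eval σ → Runs V s σ n Q) (h2 : e.eval σ = 0 → Runs V t σ n Q) :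
    Runs V (.ite e s t) σ (n + e.len + 3) Q := by
  rcases Nat.eq_zero_or_pos (e.eval σ) with h | h
  · obtain ⟨σ', k, h3, h4, h5⟩ := h2 h
    exact ⟨σ', _, .ite_zero he h h3, by omega, h5⟩
  · obtain ⟨σ', k, h3, h4, h5⟩ := h1 h
    exact ⟨σ', _, .ite_pos he h h3, by omega, h5⟩

/-- A loop with the invariant `I`, whose first argument bounds the number of remaining rounds. -/
theorem Runs.loop {V : ℕ} {e : Expr} {s : Stmt} {B : ℕ} (I : ℕ → St → Prop)
    (hok : ∀ k σ, I k σ → e.ok V σ)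
    (hstep : ∀ k σ, I k σ → 0 < e.eval σ → 0 < k ∧ Runs V s σ B (I (k - 1)))
    {k : ℕ} {σ : St} (h : I k σ) :
    Runs V (.loop e s) σ (k * (B + e.len + 3) + (e.len + 3))
      (fun σ' => (∃ k', I k' σ') ∧ e.eval σ' = 0) := by
  induction k generalizing σ with
  | zero =>
    rcases Nat.eq_zero_or_pos (e.eval σ) with h0 | h0
    · exact ⟨σ, _, .loop_zero (hok _ _ h) h0, by omega, ⟨_, h⟩, h0⟩
    · exact absurd (hstep _ _ h h0).1 (lt_irrefl 0)
  | succ k ih =>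
    rcases Nat.eq_zero_or_pos (e.eval σ) with h0 | h0
    · exact ⟨σ, _, .loop_zero (hok _ _ h) h0, by omega, ⟨_, h⟩, h0⟩
    · obtain ⟨-, σ1, t1, h1, h2, h3⟩ := hstep _ _ h h0
      obtain ⟨σ2, t2, h4, h5, h6⟩ := ih h3
      refine ⟨σ2, _, .loop_pos (hok _ _ h) h0 h1 h4, ?_, h6⟩
      rw [Nat.succ_mul]
      omega

/-- The weakest precondition of a program without loops; programs with loops get `False`. -/
def Stmt.wp (V : ℕ) : Stmt → (St → Prop) → St → Prop
  | skip, Q, σ => Q σ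
  | assign x e, Q, σ => e.ok V σ ∧ Q (σ.setv x (e.eval σ))
  | set r e f, Q, σ => e.ok V σ ∧ f.ok V σ ∧ Q (σ.seta r (e.eval σ) (f.eval σ))
  | read x, Q, σ => Q (σ.readv x)
  | seq s t, Q, σ => s.wp V (t.wp V Q) σ
  | ite e s t, Q, σ => e.ok V σ ∧ (0 < e.eval σ → s.wp V Q σ) ∧ (e.eval σ = 0 → t.wp V Q σ)
  | .loop _ _, _, _ => False

theorem Stmt.wp.runs {V : ℕ} {s : Stmt} {Q : St → Prop} {σ : St} (h : s.wp V Q σ) :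
    Runs V s σ s.len Q := by
  induction s generalizing σ Q with
  | skip => exact ⟨σ, 0, .skip, le_rfl, h⟩
  | assign x e => exact ⟨_, _, .assign h.1, le_rfl, h.2⟩
  | set r e f => exact ⟨_, _, .set h.1 h.2.1, le_rfl, h.2.2⟩
  | read x => exact ⟨_, _, .read, le_rfl, h⟩
  | seq s t ihs iht =>
    exact Runs.seq (ihs h) fun σ' h' => iht h'
  | ite e s t ihs iht =>
    rcases Nat.eq_zero_or_pos (e.eval σ) with h0 | h0
    · obtain ⟨σ', k, h1, h2, h3⟩ := iht (h.2.2 h0)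
      exact ⟨σ', _, .ite_zero h.1 h0 h1, by rw [len]; omega, h3⟩
    · obtain ⟨σ', k, h1, h2, h3⟩ := ihs (h.2.1 h0)
      exact ⟨σ', _, .ite_pos h.1 h0 h1, by rw [len]; omega, h3⟩
  | loop e s ih => exact h.elim

theorem Stmt.wp.runs_le {V B : ℕ} {s : Stmt} {Q : St → Prop} {σ : St} (h : s.wp V Q σ)
    (hB : s.len ≤ B) : Runs V s σ B Q :=
  h.runs.mono hB fun _ h => h

/-- The variables that a program changes. -/
def Stmt.vars : Stmt → List Var
  | skip => []
  | assign x _ => [x]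
  | set _ _ _ => []
  | read x => [x]
  | seq s t => s.vars ++ t.vars
  | ite _ s t => s.vars ++ t.vars
  | .loop _ s => s.vars

/-- The arrays that a program changes. -/
def Stmt.arrs : Stmt → List Arr
  | skip => []
  | assign _ _ => []
  | set r _ _ => [r]
  | read _ => []
  | seq s t => s.arrs ++ t.arrs
  | ite _ s t => s.arrs ++ t.arrs
  | .loop _ s => s.arrs

/-- The states agree in the variables and arrays that the program `s` does not change. -/
structure Frame (s : Stmt) (σ σ' : St) : Prop where
  v : ∀ x, x ∉ s.vars → σ'.v x = σ.v x
  a : ∀ r, r ∉ s.arrs → σ'.a r = σ.a r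

theorem Exec.frame {V : ℕ} {s : Stmt} {σ σ' : St} {n : ℕ} (h : Exec V s σ σ' n) :
    Frame s σ σ' := by
  induction h with
  | skip => exact ⟨fun _ _ => rfl, fun _ _ => rfl⟩
  | assign =>
    refine ⟨fun x hx => Function.update_of_ne ?_ .., fun _ _ => rfl⟩
    simpa [Stmt.vars] using hx
  | set =>
    refine ⟨fun _ _ => rfl, fun r hr => Function.update_of_ne ?_ ..⟩
    simpa [Stmt.arrs] using hr
  | read =>
    refine ⟨fun x hx => Function.update_of_ne ?_ .., fun _ _ => rfl⟩
    simpa [Stmt.vars] using hx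
  | seq _ _ ih ih' =>
    refine ⟨fun x hx => ?_, fun r hr => ?_⟩
    · simp only [Stmt.vars, List.mem_append, not_or] at hx
      rw [ih'.v x hx.2, ih.v x hx.1]
    · simp only [Stmt.arrs, List.mem_append, not_or] at hr
      rw [ih'.a r hr.2, ih.a r hr.1]
  | ite_pos _ _ _ ih =>
    refine ⟨fun x hx => ?_, fun r hr => ?_⟩
    · simp only [Stmt.vars, List.mem_append, not_or] at hx
      exact ih.v x hx.1
    · simp only [Stmt.arrs, List.mem_append, not_or] at hr
      exact ih.a r hr.1
  | ite_zero _ _ _ ih =>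
    refine ⟨fun x hx => ?_, fun r hr => ?_⟩
    · simp only [Stmt.vars, List.mem_append, not_or] at hx
      exact ih.v x hx.2
    · simp only [Stmt.arrs, List.mem_append, not_or] at hr
      exact ih.a r hr.2
  | loop_pos _ _ _ _ ih ih' =>
    exact ⟨fun x hx => (ih'.v x hx).trans (ih.v x hx), fun r hr => (ih'.a r hr).trans (ih.a r hr)⟩
  | loop_zero => exact ⟨fun _ _ => rfl, fun _ _ => rfl⟩

theorem Runs.frame {V : ℕ} {s : Stmt} {σ : St} {n : ℕ} {Q : St → Prop} (h : Runs V s σ n Q) :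
    Runs V s σ n fun σ' => Q σ' ∧ Frame s σ σ' := by
  obtain ⟨σ', t, h1, h2, h3⟩ := h
  exact ⟨σ', t, h1, h2, h3, h1.frame⟩

theorem St.setv_self (σ : St) (x : Var) : σ.setv x (σ.v x) = σ := by
  simp [St.setv, Function.update_eq_self]

section Simp

variable (σ : St) (x z : Var) (r r' : Arr) (i y : ℕ) (e f : Expr) (V : ℕ)

@[simp] theorem St.setv_v : (σ.setv x y).v z = if z = x then y else σ.v z :=
  Function.update_apply ..
@[simp] theorem St.setv_a : (σ.setv x y).a = σ.a := rfl
@[simp] theorem St.setv_tape : (σ.setv x y).tape = σ.tape := rfl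
@[simp] theorem St.seta_v : (σ.seta r i y).v = σ.v := rfl
@[simp] theorem St.seta_a : (σ.seta r i y).a r' =
    if r' = r then Function.update (σ.a r) i y else σ.a r' :=
  Function.update_apply ..
@[simp] theorem St.seta_tape : (σ.seta r i y).tape = σ.tape := rfl
@[simp] theorem St.readv_v : (σ.readv x).v z = if z = x then σ.tape.headD 0 else σ.v z :=
  Function.update_apply ..
@[simp] theorem St.readv_a : (σ.readv x).a = σ.a := rfl
@[simp] theorem St.readv_tape : (σ.readv x).tape = σ.tape.tail := rfl
@[simp] theorem Expr.eval_const : (Expr.const y).eval σ = y := rfl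
@[simp] theorem Expr.eval_var : (Expr.var x).eval σ = σ.v x := rfl
@[simp] theorem Expr.eval_add : (e + f).eval σ = e.eval σ + f.eval σ := rfl
@[simp] theorem Expr.eval_sub : (e - f).eval σ = e.eval σ - f.eval σ := rfl
@[simp] theorem Expr.eval_get : (Expr.get r e).eval σ = σ.a r (e.eval σ) := rfl
@[simp] theorem Expr.ok_const : (Expr.const y).ok V σ ↔ y ≤ V := Iff.rfl
@[simp] theorem Expr.ok_var : (Expr.var x).ok V σ ↔ True := Iff.rfl
@[simp] theorem Expr.ok_add :
    (e + f).ok V σ ↔ e.ok V σ ∧ f.ok V σ ∧ e.eval σ + f.eval σ ≤ V := Iff.rfl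
@[simp] theorem Expr.ok_sub : (e - f).ok V σ ↔ e.ok V σ ∧ f.ok V σ := Iff.rfl
@[simp] theorem Expr.ok_get : (Expr.get r e).ok V σ ↔ e.ok V σ := Iff.rfl

end Simp

attribute [simp] Stmt.wp Stmt.block

end RAM

/-! ### The refinement of the classes of prefixes from one level to the next -/

namespace FreeSolvable

open Finset

section Level

variable {α : Type*} {N : Subgroup (FreeGroup α)} {a : ℕ → α × Bool} {u s fwd bwd : ℕ → ℕ} {n : ℕ}

/-- The numbers `fwd k` and `bwd k`, for `k < n`, encode the oriented edge that the `k`-th step of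
the path spelled by `a` traverses and the reverse of that edge: the parity is the direction, and
the other digits `u k` determine the edge. -/
structure Encodes (N : Subgroup (FreeGroup α)) (a : ℕ → α × Bool) (n : ℕ) (u fwd bwd : ℕ → ℕ) :
    Prop where
  inj : ∀ k < n, ∀ k' < n, u k = u k' ↔ (edge N a k).1 = (edge N a k').1
  fwd : ∀ k < n, fwd k = 2 * u k + (a k).2.toNat
  bwd : ∀ k < n, bwd k = 2 * u k + (1 - (a k).2.toNat)

/-- The number of the times in `Ico i j` at which the sequence `f` takes the value `o`. -/
def visits (f : ℕ → ℕ) (i j o : ℕ) : ℕ := #{k ∈ Ico i j | f k = o}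

theorem visits_eq_add (f : ℕ → ℕ) {i j : ℕ} (h : i < j) (o : ℕ) :
    visits f i j o = visits f (i + 1) j o + if f i = o then 1 else 0 := by
  have : Ico i j = insert i (Ico (i + 1) j) := by
    ext k
    simp only [mem_Ico, mem_insert]
    omega
  rw [visits, this, Finset.filter_insert]
  split
  · rw [Finset.card_insert_of_notMem (by simp), visits]
  · rw [visits, add_zero]

theorem visits_self (f : ℕ → ℕ) (i o : ℕ) : visits f i i o = 0 := by simp [visits]

open Classical in
theorem Encodes.visits_fwd (h : Encodes N a n u fwd bwd) {i j : ℕ} (hj : j ≤ n) {k : ℕ}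
    (hk : k < n) (b : Bool) :
    visits fwd i j (2 * u k + b.toNat) = #{t ∈ Ico i j | edge N a t = ((edge N a k).1, b)} := by
  rw [visits]
  congr 1
  refine Finset.filter_congr fun t ht => ?_
  have htn : t < n := (Finset.mem_Ico.1 ht).2.trans_le hj
  rw [h.fwd t htn, Prod.ext_iff, ← h.inj t htn k hk]
  have h2 : (edge N a t).2 = (a t).2 := rfl
  rw [h2]
  cases b <;> cases (a t).2 <;> simp <;> omega

open Classical in
theorem Encodes.visits_bwd (h : Encodes N a n u fwd bwd) {i j : ℕ} (hj : j ≤ n) {k : ℕ}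
    (hk : k < n) (b : Bool) :
    visits bwd i j (2 * u k + b.toNat) = #{t ∈ Ico i j | edge N a t = ((edge N a k).1, !b)} := by
  rw [visits]
  congr 1
  refine Finset.filter_congr fun t ht => ?_
  have htn : t < n := (Finset.mem_Ico.1 ht).2.trans_le hj
  rw [h.bwd t htn, Prod.ext_iff, ← h.inj t htn k hk]
  have h2 : (edge N a t).2 = (a t).2 := rfl
  rw [h2]
  cases b <;> cases (a t).2 <;> simp <;> omega

/-- Zero flow in terms of the codes of edges. The code of an edge and of its reverse are both tested,
so that inequalities suffice. -/
theorem Encodes.balanced_iff (h : Encodes N a n u fwd bwd) {i j : ℕ} (hj : j ≤ n) :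
    Balanced N a i j ↔ ∀ k < j, visits fwd i j (fwd k) ≤ visits bwd i j (fwd k) ∧
      visits fwd i j (bwd k) ≤ visits bwd i j (bwd k) := by
  classical
  constructor
  · intro hb k hk
    have hkn := hk.trans_le hj
    have e := hb (edge N a k).1
    have e1 := h.visits_fwd (i := i) hj hkn true
    have e2 := h.visits_fwd (i := i) hj hkn false
    have e3 := h.visits_bwd (i := i) hj hkn true
    have e4 := h.visits_bwd (i := i) hj hkn false
    simp only [Bool.not_true, Bool.not_false, Bool.toNat_true, Bool.toNat_false] at e1 e2 e3 e4
    have e' : #{t ∈ Ico i j | edge N a t = ((edge N a k).1, true)} =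
      #{t ∈ Ico i j | edge N a t = ((edge N a k).1, false)} := by convert e
    rw [h.fwd k hkn, h.bwd k hkn]
    cases (a k).2 <;> simp only [Bool.toNat_true, Bool.toNat_false, Nat.sub_zero, Nat.sub_self] <;>
      constructor <;> omega
  · intro hv e
    by_cases he : ∃ k ∈ Ico i j, (edge N a k).1 = e
    · obtain ⟨k, hk, rfl⟩ := he
      have hkj := (Finset.mem_Ico.1 hk).2
      have hkn := hkj.trans_le hj
      have e1 := h.visits_fwd (i := i) hj hkn true
      have e2 := h.visits_fwd (i := i) hj hkn false
      have e3 := h.visits_bwd (i := i) hj hkn true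
      have e4 := h.visits_bwd (i := i) hj hkn false
      simp only [Bool.not_true, Bool.not_false, Bool.toNat_true, Bool.toNat_false] at e1 e2 e3 e4
      have hvk := hv k hkj
      rw [h.fwd k hkn, h.bwd k hkn] at hvk
      have : #{t ∈ Ico i j | edge N a t = ((edge N a k).1, true)} =
          #{t ∈ Ico i j | edge N a t = ((edge N a k).1, false)} := by
        cases hak : (a k).2 <;> rw [hak] at hvk <;>
          simp only [Bool.toNat_true, Bool.toNat_false, Nat.sub_zero, Nat.sub_self] at hvk <;> omega
      convert this
    · push Not at he
      rw [Finset.filter_false_of_mem, Finset.filter_false_of_mem]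
      · intro k hk hke
        exact he k hk (by rw [hke])
      · intro k hk hke
        exact he k hk (by rw [hke])

theorem sum_update_add {ι : Type*} [DecidableEq ι] {T : Finset ι} {o : ι} (ho : o ∈ T)
    (h : ι → ℕ) (y : ℕ) : ∑ x ∈ T, Function.update h o y x + h o = ∑ x ∈ T, h x + y := by
  rw [Finset.sum_update_of_mem ho, ← Finset.sum_sdiff (Finset.singleton_subset_iff.2 ho),
    Finset.sum_singleton]
  ring

/-- On the finite set `T`, the table `net` holds the net numbers of visits between the times `i` and
`j` to each oriented edge, as far as they are positive, and `tot` is the sum of its entries. -/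
structure NetCount (fwd bwd : ℕ → ℕ) (T : Finset ℕ) (i j : ℕ) (net : ℕ → ℕ) (tot : ℕ) : Prop where
  entry : ∀ o ∈ T, net o = visits fwd i j o - visits bwd i j o
  total : tot = ∑ o ∈ T, net o

/-- Extending the path by a step at its beginning either cancels an earlier step on the reverse edge
or increases the net number of visits to the edge of that step. -/
theorem Encodes.netCount_step (h : Encodes N a n u fwd bwd) {T : Finset ℕ} {i j : ℕ} (hij : i < j)
    (hj : j ≤ n) (hf : fwd i ∈ T) (hb : bwd i ∈ T) {net : ℕ → ℕ} {tot : ℕ}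
    (H : NetCount fwd bwd T (i + 1) j net tot) :
    (0 < net (bwd i) →
      NetCount fwd bwd T i j (Function.update net (bwd i) (net (bwd i) - 1)) (tot - 1)) ∧
    (net (bwd i) = 0 →
      NetCount fwd bwd T i j (Function.update net (fwd i) (net (fwd i) + 1)) (tot + 1)) := by
  classical
  have hin := hij.trans_le hj
  have hne : fwd i ≠ bwd i := by
    rw [h.fwd i hin, h.bwd i hin]
    cases (a i).2 <;> simp
  -- Reversing all edges interchanges the two numbers of visits.
  have hflip : visits fwd (i + 1) j (fwd i) = visits bwd (i + 1) j (bwd i) ∧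
      visits bwd (i + 1) j (fwd i) = visits fwd (i + 1) j (bwd i) := by
    have e1 := h.visits_fwd (i := i + 1) hj hin true
    have e2 := h.visits_fwd (i := i + 1) hj hin false
    have e3 := h.visits_bwd (i := i + 1) hj hin true
    have e4 := h.visits_bwd (i := i + 1) hj hin false
    simp only [Bool.not_true, Bool.not_false, Bool.toNat_true, Bool.toNat_false] at e1 e2 e3 e4
    rw [h.fwd i hin, h.bwd i hin]
    cases (a i).2 <;> simp only [Bool.toNat_true, Bool.toNat_false, Nat.sub_zero, Nat.sub_self] <;>
      constructor <;> omega
  have hnf := H.entry _ hf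
  have hnb := H.entry _ hb
  constructor
  · intro hpos
    refine ⟨fun o ho => ?_, ?_⟩
    · rw [visits_eq_add fwd hij, visits_eq_add bwd hij, Function.update_apply]
      have hno := H.entry o ho
      by_cases h1 : o = bwd i
      · subst h1
        rw [if_pos rfl, if_neg hne, if_pos rfl]
        omega
      · rw [if_neg h1, if_neg (Ne.symm h1)]
        by_cases h2 : fwd i = o
        · subst h2
          rw [if_pos rfl]
          omega
        · rw [if_neg h2]
          omega
    · have := sum_update_add hb net (net (bwd i) - 1)
      rw [← H.total] at this
      omega
  · intro hzero
    refine ⟨fun o ho => ?_, ?_⟩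
    · rw [visits_eq_add fwd hij, visits_eq_add bwd hij, Function.update_apply]
      have hno := H.entry o ho
      by_cases h1 : o = fwd i
      · subst h1
        rw [if_pos rfl, if_pos rfl, if_neg hne.symm]
        omega
      · rw [if_neg h1, if_neg (Ne.symm h1)]
        by_cases h2 : bwd i = o
        · subst h2
          rw [if_pos rfl]
          omega
        · rw [if_neg h2]
          omega
    · have := sum_update_add hf net (net (fwd i) + 1)
      rw [← H.total] at this
      omega

theorem NetCount.zero {T : Finset ℕ} {j : ℕ} {net : ℕ → ℕ} (h : ∀ o ∈ T, net o = 0) :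
    NetCount fwd bwd T j j net 0 :=
  ⟨fun o ho => by rw [h o ho, visits_self, Nat.zero_sub], (Finset.sum_eq_zero h).symm⟩

/-- The codes of the oriented edges traversed before the time `j` and of their reverses. -/
def codes (fwd bwd : ℕ → ℕ) (j : ℕ) : Finset ℕ := (range j).image fwd ∪ (range j).image bwd

theorem mem_codes {fwd bwd : ℕ → ℕ} {j o : ℕ} :
    o ∈ codes fwd bwd j ↔ ∃ k < j, o = fwd k ∨ o = bwd k := by
  simp only [codes, mem_union, mem_image, mem_range]
  constructor
  · rintro (⟨k, hk, rfl⟩ | ⟨k, hk, rfl⟩)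
    exacts [⟨k, hk, .inl rfl⟩, ⟨k, hk, .inr rfl⟩]
  · rintro ⟨k, hk, rfl | rfl⟩
    exacts [.inl ⟨k, hk, rfl⟩, .inr ⟨k, hk, rfl⟩]

/-- The path between two prefixes has zero flow exactly if all net numbers of visits vanish. -/
theorem Encodes.tot_eq_zero_iff [N.Normal] (h : Encodes N a n u fwd bwd) {i j : ℕ} (hij : i ≤ j)
    (hj : j ≤ n) {net : ℕ → ℕ} {tot : ℕ} (H : NetCount fwd bwd (codes fwd bwd j) i j net tot) :
    tot = 0 ↔ (pre a i : FreeGroup α ⧸ ⁅N, N⁆) = pre a j := by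
  rw [eq_mod_commutator_iff_balanced N a hij, h.balanced_iff hj, H.total, Finset.sum_eq_zero_iff]
  constructor
  · intro h0 k hk
    have m1 : fwd k ∈ codes fwd bwd j := mem_codes.2 ⟨k, hk, .inl rfl⟩
    have m2 : bwd k ∈ codes fwd bwd j := mem_codes.2 ⟨k, hk, .inr rfl⟩
    have e1 := h0 _ m1
    have e2 := h0 _ m2
    rw [H.entry _ m1] at e1
    rw [H.entry _ m2] at e2
    omega
  · intro hv o ho
    rw [H.entry o ho]
    obtain ⟨k, hk, rfl | rfl⟩ := mem_codes.1 ho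
    · have := (hv k hk).1
      omega
    · have := (hv k hk).2
      omega

/-- The prefix `i` is the shortest among those that agree with the prefix `j` modulo `N`. -/
def IsRep (N : Subgroup (FreeGroup α)) (a : ℕ → α × Bool) (j i : ℕ) : Prop :=
  i ≤ j ∧ (pre a i : FreeGroup α ⧸ N) = pre a j ∧
    ∀ i' < i, (pre a i' : FreeGroup α ⧸ N) ≠ pre a j

theorem IsRep.eq_iff {i i' j j' : ℕ} (h : IsRep N a j i) (h' : IsRep N a j' i') :
    i = i' ↔ (pre a j : FreeGroup α ⧸ N) = pre a j' := by
  constructor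
  · rintro rfl
    rw [← h.2.1, h'.2.1]
  · intro e
    rcases Nat.lt_trichotomy i i' with hlt | heq | hlt
    · exact absurd (h.2.1.trans e) (h'.2.2 _ hlt)
    · exact heq
    · exact absurd (h'.2.1.trans e.symm) (h.2.2 _ hlt)

/-- The table `cls` represents each of the prefixes of length at most `n` by `M` times a number at
most `n`, two of them by the same number exactly if they agree modulo `N`. -/
structure Classes (N : Subgroup (FreeGroup α)) (a : ℕ → α × Bool) (n M : ℕ) (cls : ℕ → ℕ) :
    Prop where
  eq_iff : ∀ i ≤ n, ∀ j ≤ n, cls i = cls j ↔ (pre a i : FreeGroup α ⧸ N) = pre a j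
  mul : ∀ i ≤ n, ∃ c ≤ n, cls i = M * c
  zero : cls 0 = 0

theorem classes_of_isRep {M : ℕ} (hM : 0 < M) {cls : ℕ → ℕ}
    (h : ∀ j ≤ n, ∃ i, IsRep N a j i ∧ cls j = M * i) : Classes N a n M cls where
  eq_iff i hi j hj := by
    obtain ⟨i', h1, h2⟩ := h i hi
    obtain ⟨j', h3, h4⟩ := h j hj
    rw [h2, h4, ← h1.eq_iff h3]
    exact ⟨fun e => Nat.eq_of_mul_eq_mul_left hM e, fun e => by rw [e]⟩
  mul j hj := by
    obtain ⟨i, h1, h2⟩ := h j hj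
    exact ⟨i, h1.1.trans hj, h2⟩
  zero := by
    obtain ⟨i, h1, h2⟩ := h 0 (Nat.zero_le _)
    rw [h2, Nat.le_zero.1 h1.1, mul_zero]

/-- The labels `lab k` represent the generators at the times `k < n` by even numbers, and leave room
for one more digit below the base `M`. -/
structure Labels (a : ℕ → α × Bool) (n M : ℕ) (lab : ℕ → ℕ) : Prop where
  eq_iff : ∀ k < n, ∀ k' < n, lab k = lab k' ↔ (a k).1 = (a k').1
  even : ∀ k < n, 2 ∣ lab k
  lt : ∀ k < n, lab k + 1 < M
  base : 2 ∣ M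

/-- The class of the initial vertex, the label and the direction are the digits of the code of an
oriented edge, with respect to the bases `M` and `2`. -/
theorem Classes.encodes {M : ℕ} {cls lab : ℕ → ℕ} (hC : Classes N a n M cls)
    (hL : Labels a n M lab)
    (hf : ∀ k < n, fwd k = cls (if (a k).2 then k else k + 1) + lab k + (a k).2.toNat)
    (hb : ∀ k < n, bwd k = cls (if (a k).2 then k else k + 1) + lab k + (1 - (a k).2.toNat)) :
    Encodes N a n (fun k => (cls (if (a k).2 then k else k + 1) + lab k) / 2) fwd bwd := by
  have hle : ∀ k < n, (if (a k).2 then k else k + 1) ≤ n := by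
    intro k hk
    split <;> omega
  have heven : ∀ k < n, 2 * ((cls (if (a k).2 then k else k + 1) + lab k) / 2) =
      cls (if (a k).2 then k else k + 1) + lab k := by
    intro k hk
    obtain ⟨c, -, hc⟩ := hC.mul _ (hle k hk)
    exact Nat.mul_div_cancel' (dvd_add (hc ▸ (hL.base.mul_right c)) (hL.even k hk))
  refine ⟨fun k hk k' hk' => ?_, fun k hk => ?_, fun k hk => ?_⟩
  · have e1 := heven k hk
    have e2 := heven k' hk'
    have key : (cls (if (a k).2 then k else k + 1) + lab k) / 2 =
        (cls (if (a k').2 then k' else k' + 1) + lab k') / 2 ↔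
        cls (if (a k).2 then k else k + 1) = cls (if (a k').2 then k' else k' + 1) ∧
          lab k = lab k' := by
      obtain ⟨c, -, hc⟩ := hC.mul _ (hle k hk)
      obtain ⟨c', -, hc'⟩ := hC.mul _ (hle k' hk')
      rw [hc] at e1
      rw [hc'] at e2
      rw [hc, hc']
      have l1 := hL.lt k hk
      have l2 := hL.lt k' hk'
      constructor
      · intro e
        have e3 : M * c + lab k = M * c' + lab k' := by omega
        have e4 : (M * c + lab k) / M = c := by
          rw [Nat.mul_add_div (by omega), Nat.div_eq_of_lt (by omega), add_zero]
        have e5 : (M * c' + lab k') / M = c' := by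
          rw [Nat.mul_add_div (by omega), Nat.div_eq_of_lt (by omega), add_zero]
        rw [e3, e5] at e4
        subst e4
        omega
      · rintro ⟨e3, e4⟩
        rw [e3, e4]
    have base : ∀ k, (edge N a k).1 =
        ((pre a (if (a k).2 then k else k + 1) : FreeGroup α ⧸ N), (a k).1) := by
      intro k
      simp only [edge]
      cases (a k).2 <;> rfl
    rw [key, base, base, Prod.mk.injEq, hC.eq_iff _ (hle k hk) _ (hle k' hk'),
      hL.eq_iff k hk k' hk']
  · rw [hf k hk, heven k hk]
  · rw [hb k hk, heven k hk]

end Level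

/-! ### The dictionary of generators -/

section Trie

/-- In the binary tree whose node `c` has the children `child (2 * c)` and `child (2 * c + 1)`, where
`0` stands for a missing child, the first `t` digits of `β` lead from the root `0` to the node `c`. -/
def PathTo (child : ℕ → ℕ) (β : ℕ → Bool) : ℕ → ℕ → Prop
  | 0, c => c = 0
  | t + 1, c => ∃ c', PathTo child β t c' ∧ child (2 * c' + (β t).toNat) = c ∧ 0 < c

theorem PathTo.det {child : ℕ → ℕ} {β β' : ℕ → Bool} {t c c' : ℕ} (h : PathTo child β t c)
    (h' : PathTo child β' t c') (he : ∀ s < t, β s = β' s) : c = c' := by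
  induction t generalizing c c' with
  | zero => exact h.trans h'.symm
  | succ t ih =>
    obtain ⟨e, h1, rfl, -⟩ := h
    obtain ⟨e', h2, rfl, -⟩ := h'
    rw [ih h1 h2 fun s hs => he s (by omega), he t (by omega)]

theorem PathTo.mono {child child' : ℕ → ℕ} {β : ℕ → Bool} {t c : ℕ} (h : PathTo child β t c)
    (hc : ∀ x, 0 < child x → child' x = child x) : PathTo child' β t c := by
  induction t generalizing c with
  | zero => exact h
  | succ t ih =>
    obtain ⟨e, h1, rfl, h2⟩ := h
    exact ⟨e, ih h1, hc _ h2, h2⟩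

/-- The nodes other than the root are numbered from `1` to at most `f`, without repetition. -/
structure IsTrie (child : ℕ → ℕ) (f : ℕ) : Prop where
  le : ∀ x, child x ≤ f
  inj : ∀ x y, 0 < child x → child x = child y → x = y

theorem IsTrie.pathTo_inj {child : ℕ → ℕ} {f : ℕ} (hT : IsTrie child f) {β β' : ℕ → Bool}
    {t c : ℕ} (h : PathTo child β t c) (h' : PathTo child β' t c) : ∀ s < t, β s = β' s := by
  induction t generalizing c with
  | zero => intro s hs; omega
  | succ t ih =>
    obtain ⟨e, h1, h2, h3⟩ := h
    obtain ⟨e', h1', h2', h3'⟩ := h'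
    have he := hT.inj _ _ (h2 ▸ h3) (h2.trans h2'.symm)
    have hb : β t = β' t := by
      revert he
      cases β t <;> cases β' t <;> simp <;> omega
    have hee : e = e' := by rw [hb] at he; omega
    subst hee
    intro s hs
    rcases Nat.lt_succ_iff_lt_or_eq.1 hs with hs | rfl
    · exact ih h1 h1' s hs
    · exact hb

theorem IsTrie.pathTo_le {child : ℕ → ℕ} {f : ℕ} (hT : IsTrie child f) {β : ℕ → Bool}
    {t c : ℕ} (h : PathTo child β t c) : c ≤ f := by
  cases t with
  | zero => rw [show c = 0 from h]; exact Nat.zero_le _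
  | succ t =>
    obtain ⟨e, -, rfl, -⟩ := h
    exact hT.le _

theorem IsTrie.insert {child : ℕ → ℕ} {f : ℕ} (hT : IsTrie child f) (x : ℕ) :
    IsTrie (Function.update child x (f + 1)) (f + 1) where
  le y := by
    rw [Function.update_apply]
    split
    · exact le_rfl
    · exact (hT.le y).trans (Nat.le_succ f)
  inj y z := by
    rw [Function.update_apply, Function.update_apply]
    have h1 := hT.le y
    have h2 := hT.le z
    split <;> split
    · intros; simp [*]
    · intros; omega
    · intros; omega
    · exact hT.inj y z

/-- An index below `r` is determined by the digits that occur in the code of a letter. -/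
theorem fin_eq_of_testBit {r : ℕ} {x y : Fin r}
    (h : ∀ t < Nat.clog 2 r, (x : ℕ).testBit t = (y : ℕ).testBit t) : x = y := by
  apply Fin.ext
  apply Nat.eq_of_testBit_eq
  intro t
  rcases Nat.lt_or_ge t (Nat.clog 2 r) with ht | ht
  · exact h t ht
  · have hr := (Nat.le_pow_clog Nat.one_lt_two r).trans (Nat.pow_le_pow_right two_pos ht)
    rw [Nat.testBit_lt_two_pow (x.2.trans_le hr), Nat.testBit_lt_two_pow (y.2.trans_le hr)]

end Trie

/-! ### The codes of words and numbers -/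

section Codes

theorem length_letterCode {r : ℕ} (a : Fin r × Bool) :
    (letterCode a).length = Nat.clog 2 r + 1 := by simp [letterCode]

theorem length_code {r : ℕ} (w : Word r) : (code w).length = w.length * (Nat.clog 2 r + 1) := by
  induction w with
  | nil => simp [code]
  | cons a w ih =>
    rw [code, List.flatMap_cons, List.length_append, length_letterCode, ← code, ih,
      List.length_cons]
    ring

theorem code_getElem? {r : ℕ} (w : Word r) (k t : ℕ) (hk : k < w.length)
    (ht : t < Nat.clog 2 r + 1) :
    (code w)[k * (Nat.clog 2 r + 1) + t]? = (letterCode w[k])[t]? := by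
  induction w generalizing k with
  | nil => simp at hk
  | cons a w ih =>
    rw [code, List.flatMap_cons, ← code]
    cases k with
    | zero =>
      rw [List.getElem?_append_left (by rw [length_letterCode]; omega)]
      simp
    | succ k =>
      rw [List.getElem?_append_right (by rw [length_letterCode, Nat.succ_mul]; omega),
        length_letterCode,
        show (k + 1) * (Nat.clog 2 r + 1) + t - (Nat.clog 2 r + 1) =
          k * (Nat.clog 2 r + 1) + t by rw [Nat.succ_mul]; omega,
        ih k (by simpa using hk)]
      simp

theorem code_sign {r : ℕ} (w : Word r) (k : ℕ) (hk : k < w.length) :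
    (code w)[k * (Nat.clog 2 r + 1)]? = some w[k].2 := by
  have := code_getElem? w k 0 hk (Nat.succ_pos _)
  simpa [letterCode] using this

theorem code_digit {r : ℕ} (w : Word r) (k t : ℕ) (hk : k < w.length) (ht : t < Nat.clog 2 r) :
    (code w)[k * (Nat.clog 2 r + 1) + 1 + t]? = some ((w[k].1 : ℕ).testBit t) := by
  have := code_getElem? w k (t + 1) hk (by omega)
  rw [show k * (Nat.clog 2 r + 1) + 1 + t = k * (Nat.clog 2 r + 1) + (t + 1) by ring, this]
  simp [letterCode, ht]

theorem two_pow_size_le {r : ℕ} (hr : 0 < r) :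
    2 ^ (Nat.size r - 1) ≤ r := by
  rw [← Nat.lt_size]
  have := Nat.size_pos.2 hr
  omega

/-- The number of ones among the binary digits tells whether a number is a power of two. -/
theorem count_true_bits {r : ℕ} (hr : 0 < r) :
    1 ≤ (Nat.bits r).count true ∧
      ((Nat.bits r).count true = 1 ↔ r = 2 ^ (Nat.size r - 1)) := by
  induction r using Nat.binaryRec' with
  | zero => omega
  | bit b m hb ih =>
    rw [Nat.bits_append_bit m b hb]
    rcases Nat.eq_zero_or_pos m with rfl | hm
    · obtain rfl : b = true := hb rfl
      simp
    · have hs : Nat.size (Nat.bit b m) = Nat.size m + 1 := Nat.size_bit hr.ne'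
      obtain ⟨h1, h2⟩ := ih hm
      have h3 := Nat.size_pos.2 hm
      obtain ⟨s, hs'⟩ : ∃ s, Nat.size m = s + 1 := ⟨Nat.size m - 1, by omega⟩
      rw [hs', Nat.add_sub_cancel] at h2
      rw [hs, hs', Nat.add_sub_cancel, Nat.bit_val, pow_succ]
      cases b
      · simp only [List.count_cons, Bool.toNat_false, beq_iff_eq, Bool.false_eq_true, if_false,
          add_zero, h2]
        exact ⟨h1, by omega⟩
      · simp only [List.count_cons, Bool.toNat_true, beq_self_eq_true, if_true]
        constructor <;> omega

/-- `⌈log₂ r⌉` in terms of the binary digits of `r`. -/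
theorem clog_eq {r : ℕ} (hr : 0 < r) :
    Nat.clog 2 r + 1 = if 1 < (Nat.bits r).count true then Nat.size r + 1 else Nat.size r := by
  obtain ⟨h1, h2⟩ := count_true_bits hr
  have h3 := two_pow_size_le hr
  have h4 := Nat.lt_size_self r
  have h5 := Nat.size_pos.2 hr
  have h6 : Nat.clog 2 r ≤ Nat.size r := (Nat.clog_le_iff_le_pow Nat.one_lt_two).2 h4.le
  split
  · have h7 : ¬ Nat.clog 2 r ≤ Nat.size r - 1 := by
      rw [Nat.clog_le_iff_le_pow Nat.one_lt_two]
      have : r ≠ 2 ^ (Nat.size r - 1) := fun h => by rw [← h2] at h; omega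
      omega
    omega
  · have h7 : r = 2 ^ (Nat.size r - 1) := h2.1 (by omega)
    have h8 : Nat.clog 2 r = Nat.size r - 1 := by
      conv_lhs => rw [h7]
      exact Nat.clog_pow 2 _ Nat.one_lt_two
    omega

end Codes

end FreeSolvable

/-! ### The program -/

namespace FreeSolvable

open RAM RAM.Stmt RAM.Expr Finset

/-- Store the symbols of the input up to the next separator in the array `bit`. -/
def readWord : Stmt :=
  .loop (const 2 - var .sym) (block [
    set .bit (var .len) (var .sym),
    assign .len (var .len + const 1),
    read .sym])

/-- Count the digits of the rank `r` and those of them that are `1`. These numbers determine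
`⌈log₂ r⌉`, see `clog_eq`, and the value of `r` is not needed. -/
def readRank : Stmt :=
  .loop (const 2 - var .sym) (block [
    assign .ones (var .ones + var .sym),
    assign .ell (var .ell + const 1),
    read .sym])

/-- Read the class `d`; stop reading once it is known to exceed `len`, so that the time does not
depend on `d`. -/
def readClass : Stmt :=
  .loop (const 2 - var .sym) (ite (var .pow - var .len)
    (block [
      assign .d (var .pow),
      assign .sym (const 2)])
    (block [
      ite (var .sym) (assign .d (var .d + var .pow)) skip,
      assign .pow (var .pow + var .pow),
      read .sym]))

/-- Follow the path that is given by the next `cnt` bits in the tree of generators, adding new nodes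
where necessary. -/
def descend : Stmt :=
  .loop (var .cnt) (block [
    assign .tmp (var .cur + var .cur + get .bit (var .pos)),
    assign .pos (var .pos + const 1),
    assign .cur (get .child (var .tmp)),
    ite (var .cur) skip (block [
      assign .fresh (var .fresh + const 1),
      assign .cur (var .fresh),
      set .child (var .tmp) (var .fresh)]),
    assign .cnt (var .cnt - const 1)])

/-- Split the word into letters. -/
def decode : Stmt :=
  .loop (var .len - var .pos) (block [
    block [
      set .sgn (var .n) (get .bit (var .pos)),
      assign .pos (var .pos + const 1),
      assign .cur (const 0),
      assign .cnt (var .ell - const 1)],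
    descend,
    block [
      set .lab (var .n) (var .cur + var .cur),
      assign .n (var .n + const 1)]])

/-- Compute the codes of the oriented edges that the steps of the path traverse. -/
def computeEdges : Stmt :=
  .loop (var .n - var .j) (block [
    ite (get .sgn (var .j))
      (block [
        set .fwd (var .j) (get .cls (var .j) + get .lab (var .j) + const 1),
        set .bwd (var .j) (get .cls (var .j) + get .lab (var .j))])
      (block [
        set .fwd (var .j) (get .cls (var .j + const 1) + get .lab (var .j)),
        set .bwd (var .j) (get .cls (var .j + const 1) + get .lab (var .j) + const 1)]),
    assign .j (var .j + const 1)])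

/-- Clear the table `net` at the edges traversed before the time `i`. -/
def clearNet : Stmt :=
  .loop (var .i) (block [
    assign .i (var .i - const 1),
    set .net (get .fwd (var .i)) (const 0),
    set .net (get .bwd (var .i)) (const 0)])

/-- Find the first prefix in the class of the prefix `j`, going backwards from the prefix `i`. The
table `net` and the sum `tot` of its entries are updated as in `Encodes.netCount_step`; whenever `tot`
is zero, the prefixes `i` and `j` are in the same class of the next level. -/
def scan : Stmt :=
  .loop (var .i) (block [
    assign .i (var .i - const 1),
    assign .val (var .val - var .m),
    ite (get .net (get .bwd (var .i)))
      (block [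
        set .net (get .bwd (var .i)) (get .net (get .bwd (var .i)) - const 1),
        assign .tot (var .tot - const 1)])
      (block [
        set .net (get .fwd (var .i)) (get .net (get .fwd (var .i)) + const 1),
        assign .tot (var .tot + const 1)]),
    ite (var .tot) skip (set .cls (var .j) (var .val))])

/-- Compute the classes of all prefixes on the next level from the codes of edges on the current one. -/
def computeClasses : Stmt :=
  .loop (var .n + const 1 - var .j) (block [
    assign .i (var .j),
    clearNet,
    block [
      assign .i (var .j),
      assign .val (var .jval),
      assign .tot (const 0),
      set .cls (var .j) (var .val)],
    scan,
    block [
      assign .j (var .j + const 1),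
      assign .jval (var .jval + var .m)]])

/-- Compute the classes level by level. The loop also ends when two to the current level exceeds `n`,
because by then a word of length `n` is trivial only if it is trivial in the free group. -/
def levels : Stmt :=
  .loop (var .d) (block [
    assign .j (const 0),
    computeEdges,
    block [
      assign .j (const 0),
      assign .jval (const 0)],
    computeClasses,
    block [
      assign .d (var .d - const 1),
      assign .lim (var .lim + var .lim),
      ite (var .lim - var .n) (assign .d (const 0)) skip]])

/-- The decision procedure: the word is trivial if its last prefix is in the class of the empty one.
The empty word, for which the rank may be zero, is accepted at once. -/
def wordProblem : Stmt :=
  block [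
    read .sym,
    ite (var .sym - const 1) (assign .res (const 1)) (block [
      readWord,
      read .sym,
      readRank,
      block [
        ite (var .ones - const 1) (assign .ell (var .ell + const 1)) skip,
        assign .pow (const 1),
        read .sym],
      readClass,
      decode,
      block [
        assign .m (var .fresh + var .fresh + const 2),
        assign .lim (const 1)],
      levels,
      ite (get .cls (var .n)) skip (assign .res (const 1))])]

/-! ### Correctness of the parts of the program -/

theorem bitsToTape_cons (b : Bool) (l : List Bool) :
    bitsToTape (b :: l) = b.toNat :: bitsToTape l := rfl

theorem readWord_runs {V : ℕ} {σ : St} {l : List Bool} {rest : List ℕ}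
    (hV : l.length + 2 ≤ V) (hlen : σ.v .len = 0)
    (htape : σ.v .sym :: σ.tape = bitsToTape l ++ 2 :: rest) :
    Runs V readWord σ (50 * (l.length + 1)) fun σ' =>
      σ'.v .len = l.length ∧ σ'.tape = rest ∧
      ∀ i b, l[i]? = some b → σ'.a .bit i = b.toNat := by
  let I : ℕ → St → Prop := fun k σ => σ.v .len + k = l.length ∧
    σ.v .sym :: σ.tape = bitsToTape (l.drop (σ.v .len)) ++ 2 :: rest ∧
    ∀ i < σ.v .len, ∀ b, l[i]? = some b → σ.a .bit i = b.toNat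
  refine (Runs.loop (B := 40) I ?_ ?_ (k := l.length) (σ := σ) ?_).mono ?_ ?_
  · intro k σ _
    simp only [ok_sub, ok_const, ok_var, and_true]
    omega
  · rintro k σ ⟨h1, h2, h3⟩ hpos
    have hk : 0 < k := by
      by_contra hk
      rw [List.drop_eq_nil_of_le (by omega)] at h2
      simp only [bitsToTape, List.map_nil, List.nil_append, List.cons.injEq] at h2
      simp [h2.1] at hpos
    refine ⟨hk, Stmt.wp.runs_le ?_ (by decide)⟩
    have hlt : σ.v .len < l.length := by omega
    rw [List.drop_eq_getElem_cons hlt, bitsToTape_cons, List.cons_append, List.cons.injEq] at h2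
    have hV' : σ.v .len + 1 ≤ V := by omega
    have hbody : I (k - 1) (((σ.seta .bit (σ.v .len) (σ.v .sym)).setv .len (σ.v .len + 1)).readv
        .sym) := by
      refine ⟨?_, ?_, ?_⟩
      · simp; omega
      · simp only [St.readv_v, St.setv_v, St.seta_v, St.readv_tape, St.setv_tape, St.seta_tape,
          reduceCtorEq, if_true, if_false, h2.2]
        cases hd : l.drop (σ.v .len + 1) <;> simp [bitsToTape]
      · intro i hi b hb
        simp only [St.readv_v, St.setv_v, reduceCtorEq, if_false, if_true] at hi
        simp only [St.readv_a, St.setv_a, St.seta_a, if_true, Function.update_apply]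
        split
        · rename_i hi'
          subst hi'
          rw [List.getElem?_eq_getElem hlt, Option.some.injEq] at hb
          rw [h2.1, hb]
        · exact h3 i (by omega) b hb
    simpa [hV', show 1 ≤ V by omega] using hbody
  · refine ⟨by omega, ?_, fun i hi => by omega⟩
    rw [hlen, List.drop_zero, htape]
  · have : (const 2 - var Var.sym).len = 3 := rfl
    rw [this]; omega
  · rintro σ' ⟨⟨k, h1, h2, h3⟩, h0⟩
    simp only [eval_sub, eval_const, eval_var] at h0
    have hlen' : l.length ≤ σ'.v .len := by
      by_contra hlt
      push Not at hlt
      rw [List.drop_eq_getElem_cons hlt, bitsToTape_cons, List.cons_append, List.cons.injEq] at h2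
      have := Bool.toNat_le l[σ'.v .len]
      omega
    have hlen'' : σ'.v .len = l.length := by omega
    refine ⟨hlen'', ?_, fun i b hb => h3 i ?_ b hb⟩
    · rw [List.drop_eq_nil_of_le hlen'] at h2
      simp only [bitsToTape, List.map_nil, List.nil_append, List.cons.injEq] at h2
      exact h2.2
    · rw [hlen'']
      exact (List.getElem?_eq_some_iff.1 hb).1

end FreeSolvable

namespace FreeSolvable

open RAM RAM.Stmt RAM.Expr Finset

theorem readRank_runs {V : ℕ} {σ : St} {l : List Bool} {rest : List ℕ}
    (hV : l.length + 2 ≤ V) (hell : σ.v .ell = 0) (hones : σ.v .ones = 0)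
    (htape : σ.v .sym :: σ.tape = bitsToTape l ++ 2 :: rest) :
    Runs V readRank σ (50 * (l.length + 1)) fun σ' =>
      σ'.v .ell = l.length ∧ σ'.v .ones = l.count true ∧ σ'.tape = rest := by
  let I : ℕ → St → Prop := fun k σ => σ.v .ell + k = l.length ∧
    σ.v .sym :: σ.tape = bitsToTape (l.drop (σ.v .ell)) ++ 2 :: rest ∧
    σ.v .ones + (l.drop (σ.v .ell)).count true = l.count true
  refine (Runs.loop (B := 40) I ?_ ?_ (k := l.length) (σ := σ) ?_).mono ?_ ?_
  · intro k σ _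
    simp only [ok_sub, ok_const, ok_var, and_true]
    omega
  · rintro k σ ⟨h1, h2, h3⟩ hpos
    have hk : 0 < k := by
      by_contra hk
      rw [List.drop_eq_nil_of_le (by omega)] at h2
      simp only [bitsToTape, List.map_nil, List.nil_append, List.cons.injEq] at h2
      simp [h2.1] at hpos
    refine ⟨hk, Stmt.wp.runs_le ?_ (by decide)⟩
    have hlt : σ.v .ell < l.length := by omega
    have hcount := List.count_le_length (a := true) (l := l)
    rw [List.drop_eq_getElem_cons hlt, bitsToTape_cons, List.cons_append, List.cons.injEq] at h2
    rw [List.drop_eq_getElem_cons hlt, List.count_cons] at h3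
    have hbit : σ.v .sym = if l[σ.v .ell] = true then 1 else 0 := by
      rw [h2.1]
      cases l[σ.v .ell] <;> rfl
    simp only [beq_iff_eq] at h3
    rw [← hbit] at h3
    simp only [block, Stmt.wp, ok_add, ok_var, ok_const, eval_add, eval_var, eval_const,
      true_and, St.setv_v, reduceCtorEq, if_false]
    refine ⟨by omega, ⟨by omega, by omega⟩, ?_, ?_, ?_⟩
    · simp; omega
    · simp only [St.readv_v, St.setv_v, St.readv_tape, St.setv_tape,
        reduceCtorEq, if_true, if_false, h2.2]
      cases hd : l.drop (σ.v .ell + 1) <;> simp [bitsToTape]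
    · simp
      omega
  · refine ⟨by omega, ?_, ?_⟩
    · rw [hell, List.drop_zero, htape]
    · rw [hell, hones, List.drop_zero, zero_add]
  · have : (const 2 - var Var.sym).len = 3 := rfl
    rw [this]; omega
  · rintro σ' ⟨⟨k, h1, h2, h3⟩, h0⟩
    simp only [eval_sub, eval_const, eval_var] at h0
    have hlen' : l.length ≤ σ'.v .ell := by
      by_contra hlt
      push Not at hlt
      rw [List.drop_eq_getElem_cons hlt, bitsToTape_cons, List.cons_append, List.cons.injEq] at h2
      have := Bool.toNat_le l[σ'.v .ell]
      omega
    rw [List.drop_eq_nil_of_le hlen'] at h2 h3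
    simp only [bitsToTape, List.map_nil, List.nil_append, List.cons.injEq] at h2
    exact ⟨by omega, by simpa using h3, h2.2⟩

theorem bits_of_pos {e : ℕ} (he : 0 < e) :
    ∃ b m, Nat.bits e = b :: Nat.bits m ∧ e = 2 * m + b.toNat := by
  refine ⟨e.bodd, e.div2, ?_, ?_⟩
  · conv_lhs => rw [← Nat.bit_bodd_div2 e]
    refine Nat.bits_append_bit _ _ fun h => ?_
    have := Nat.bodd_add_div2 e
    rw [h] at this
    cases hb : e.bodd
    · rw [hb] at this
      simp at this
      omega
    · rfl
  · have := Nat.bodd_add_div2 e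
    omega

theorem readClass_runs {V : ℕ} {σ : St} {e L : ℕ} (hV : 2 * L + 2 ≤ V) (hL : 0 < L)
    (hlen : σ.v .len = L) (hd : σ.v .d = 0) (hpow : σ.v .pow = 1)
    (htape : σ.v .sym :: σ.tape = bitsToTape (Nat.bits e) ++ [2]) :
    Runs V readClass σ (60 * (Nat.size L + 2)) fun σ' =>
      σ'.v .d = e ∨ (L < σ'.v .d ∧ L < e) := by
  let I : ℕ → St → Prop := fun k σ => σ.v .len = L ∧
    ((∃ e' t, σ.v .pow = 2 ^ t ∧ t + k = Nat.size L + 1 ∧ t ≤ Nat.size L ∧ σ.v .pow ≤ 2 * L ∧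
      σ.v .sym :: σ.tape = bitsToTape (Nat.bits e') ++ [2] ∧ e = σ.v .d + σ.v .pow * e' ∧
      σ.v .d < σ.v .pow) ∨
    (σ.v .sym = 2 ∧ L < σ.v .d ∧ L < e))
  refine (Runs.loop (B := 50) I ?_ ?_ (k := Nat.size L + 1) (σ := σ) ?_).mono ?_ ?_
  · intro k σ _
    simp only [ok_sub, ok_const, ok_var, and_true]
    omega
  · rintro k σ ⟨hlen, hI⟩ hpos
    simp only [eval_sub, eval_const, eval_var] at hpos
    rcases hI with ⟨e', t, hp, htk, htl, hpl, htape, he, hdp⟩ | ⟨h, -⟩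
    swap
    · omega
    refine ⟨by omega, Stmt.wp.runs_le ?_ (by decide)⟩
    have he' : 0 < e' := by
      by_contra h
      obtain rfl : e' = 0 := by omega
      simp only [Nat.zero_bits, bitsToTape, List.map_nil, List.nil_append, List.cons.injEq]
        at htape
      omega
    obtain ⟨b, m, hb, hm⟩ := bits_of_pos he'
    rw [hb, bitsToTape_cons, List.cons_append, List.cons.injEq] at htape
    have hhead : ∀ l : List Bool, (bitsToTape l ++ [2]).headD 0 :: (bitsToTape l ++ [2]).tail =
        bitsToTape l ++ [2] := by
      intro l
      cases l <;> simp [bitsToTape]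
    have hnext : σ.v .pow ≤ L → ∃ e' t, σ.v .pow + σ.v .pow = 2 ^ t ∧
        t + (k - 1) = Nat.size L + 1 ∧ t ≤ Nat.size L ∧
        (bitsToTape (Nat.bits m) ++ [2]) = bitsToTape (Nat.bits e') ++ [2] ∧
        e = σ.v .d + σ.v .sym * σ.v .pow + (σ.v .pow + σ.v .pow) * e' := by
      intro hle
      have ht : t < Nat.size L := Nat.lt_size.2 (hp ▸ hle)
      refine ⟨m, t + 1, by rw [hp, pow_succ]; ring, by omega, by omega, rfl, ?_⟩
      rw [he, hm, htape.1]
      ring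
    simp only [block, Stmt.wp, ok_add, ok_sub, ok_var, ok_const, eval_add, eval_sub, eval_var,
      eval_const, true_and, St.setv_v, reduceCtorEq, if_false, hlen]
    refine ⟨fun hgt => ⟨by omega, ?_⟩, fun hle => ⟨fun hs => ⟨by omega, by omega, ?_⟩,
      fun hs => ⟨by omega, ?_⟩⟩⟩
    · refine ⟨by simp [hlen], .inr ⟨by simp, by simp; omega, ?_⟩⟩
      have := Nat.le_mul_of_pos_right (σ.v .pow) he'
      omega
    · obtain ⟨e2, t2, h1, h2, h3, h4, h5⟩ := hnext (by omega)
      have hs1 : σ.v .sym = 1 := by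
        have := Bool.toNat_le b
        omega
      rw [hs1, one_mul] at h5
      refine ⟨by simp [hlen], .inl ⟨e2, t2, by simpa using h1, h2, h3, by simp; omega, ?_,
        by simpa using h5, by simp; omega⟩⟩
      simp only [St.readv_v, St.setv_v, St.readv_tape, St.setv_tape, if_true, htape.2]
      rw [hhead, h4]
    · obtain ⟨e2, t2, h1, h2, h3, h4, h5⟩ := hnext (by omega)
      rw [hs, zero_mul, add_zero] at h5
      refine ⟨by simp [hlen], .inl ⟨e2, t2, by simpa using h1, h2, h3, by simp; omega, ?_,
        by simpa using h5, by simp; omega⟩⟩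
      simp only [St.readv_v, St.setv_v, St.readv_tape, St.setv_tape, if_true, htape.2]
      rw [hhead, h4]
  · refine ⟨hlen, .inl ⟨e, 0, by simp [hpow], by omega, by omega, by omega, htape, ?_, by omega⟩⟩
    rw [hd, hpow]
    ring
  · have : (const 2 - var Var.sym).len = 3 := rfl
    rw [this]; omega
  · rintro σ' ⟨⟨k, hlen, hI⟩, h0⟩
    simp only [eval_sub, eval_const, eval_var] at h0
    rcases hI with ⟨e', t, hp, htk, htl, hpl, htape, he, hdp⟩ | ⟨-, h⟩
    · left
      rcases Nat.eq_zero_or_pos e' with rfl | he'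
      · rw [he, mul_zero, add_zero]
      · obtain ⟨b, m, hb, hm⟩ := bits_of_pos he'
        rw [hb, bitsToTape_cons, List.cons_append, List.cons.injEq] at htape
        have := Bool.toNat_le b
        omega
    · exact .inr h

theorem descend_runs {V : ℕ} {σ : St} {β : ℕ → Bool} {c : ℕ}
    (hcnt : σ.v .cnt = c) (hcur : σ.v .cur = 0)
    (hbit : ∀ t < c, σ.a .bit (σ.v .pos + t) = (β t).toNat)
    (hT : IsTrie (σ.a .child) (σ.v .fresh)) (hV : 2 * (σ.v .fresh + c) + 1 ≤ V)
    (hV' : σ.v .pos + c ≤ V) :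
    Runs V descend σ (80 * (c + 1)) fun σ' =>
      σ'.v .pos = σ.v .pos + c ∧ PathTo (σ'.a .child) β c (σ'.v .cur) ∧
      IsTrie (σ'.a .child) (σ'.v .fresh) ∧ σ'.v .fresh ≤ σ.v .fresh + c ∧
      ∀ x, 0 < σ.a .child x → σ'.a .child x = σ.a .child x := by
  let I : ℕ → St → Prop := fun k σ' => σ'.v .cnt = k ∧ ∃ t, t + k = c ∧
    σ'.v .pos = σ.v .pos + t ∧ PathTo (σ'.a .child) β t (σ'.v .cur) ∧
      IsTrie (σ'.a .child) (σ'.v .fresh) ∧ σ'.v .fresh ≤ σ.v .fresh + t ∧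
      (∀ x, 0 < σ.a .child x → σ'.a .child x = σ.a .child x) ∧ σ'.a .bit = σ.a .bit
  refine (Runs.loop (B := 60) I ?_ ?_ (k := c) (σ := σ) ?_).mono ?_ ?_
  · intro k σ' _
    simp
  · rintro k σ' ⟨h1, t, htk, hpos, hpath, hT', hf, hext, hbit'⟩ hk
    simp only [eval_var, h1] at hk
    refine ⟨hk, Stmt.wp.runs_le ?_ (by decide)⟩
    have hx : σ'.v .cur + σ'.v .cur + σ'.a .bit (σ'.v .pos) = 2 * σ'.v .cur + (β t).toNat := by
      rw [hbit', hpos, hbit t (by omega)]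
      ring
    have hb := Bool.toNat_le (β t)
    have hc := hT'.pathTo_le hpath
    simp only [block, Stmt.wp, ok_add, ok_sub, ok_var, ok_const, ok_get, eval_add, eval_sub,
      eval_var, eval_const, eval_get, true_and, St.setv_v, St.setv_a, reduceCtorEq,
      if_false, if_true, St.seta_v, hx]
    refine ⟨⟨by omega, by omega⟩, ⟨by omega, by omega⟩, fun hp => ⟨by omega, ?_⟩,
      fun h0 => ⟨⟨by omega, by omega⟩, by omega, ?_⟩⟩
    · refine ⟨by simp [h1], t + 1, by omega, by simp [hpos, add_assoc], ?_, by simpa using hT',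
        by simp; omega, by simpa using hext, by simp [hbit']⟩
      simp only [St.setv_v, St.setv_a, reduceCtorEq, if_false, if_true]
      exact ⟨_, hpath, rfl, hp⟩
    · have hmono : ∀ x, 0 < σ'.a .child x →
          Function.update (σ'.a .child) (2 * σ'.v .cur + (β t).toNat) (σ'.v .fresh + 1) x =
            σ'.a .child x := by
        intro x hx
        rw [Function.update_of_ne]
        rintro rfl
        omega
      refine ⟨by simp [h1], t + 1, by omega, by simp [hpos, add_assoc], ?_, ?_,
        by simp; omega, ?_, by simp [hbit']⟩
      · simp only [St.setv_v, St.setv_a, St.seta_v, St.seta_a, reduceCtorEq, if_false, if_true]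
        exact ⟨_, hpath.mono hmono, Function.update_self .., Nat.succ_pos _⟩
      · simp only [St.setv_v, St.setv_a, St.seta_v, St.seta_a, reduceCtorEq, if_false, if_true]
        exact hT'.insert _
      · intro x hx
        have := hext x hx
        simp only [St.setv_a, St.seta_a, if_true]
        rw [hmono x (by omega), this]
  · exact ⟨hcnt, 0, by omega, by simp, hcur, hT, by omega, fun _ _ => rfl, rfl⟩
  · have : (var Var.cnt).len = 1 := rfl
    rw [this]; omega
  · rintro σ' ⟨⟨k, h1, t, htk, hpos, hpath, hT', hf, hext, -⟩, h0⟩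
    rw [eval_var, h1] at h0
    obtain rfl : t = c := by omega
    exact ⟨hpos, hpath, hT', hf, hext⟩

theorem decode_runs {V r n : ℕ} {σ : St} {a : ℕ → Fin r × Bool}
    (hell : σ.v .ell = Nat.clog 2 r + 1) (hlen : σ.v .len = n * (Nat.clog 2 r + 1))
    (hsgn : ∀ k < n, σ.a .bit (k * (Nat.clog 2 r + 1)) = (a k).2.toNat)
    (hdigit : ∀ k < n, ∀ t < Nat.clog 2 r,
      σ.a .bit (k * (Nat.clog 2 r + 1) + 1 + t) = (((a k).1 : ℕ).testBit t).toNat)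
    (hpos : σ.v .pos = 0) (hn : σ.v .n = 0) (hfresh : σ.v .fresh = 0)
    (hchild : ∀ x, σ.a .child x = 0) (hV : 2 * σ.v .len + 2 ≤ V) :
    Runs V decode σ (300 * (σ.v .len + 1)) fun σ' =>
      σ'.v .n = n ∧ σ'.v .fresh ≤ σ.v .len ∧
      (∀ k < n, σ'.a .sgn k = (a k).2.toNat) ∧
      Labels a n (2 * σ'.v .fresh + 2) (σ'.a .lab) := by
  set ℓ := Nat.clog 2 r + 1 with hℓ
  let I : ℕ → St → Prop := fun k σ' => σ'.v .n + k = n ∧ σ'.v .pos = σ'.v .n * ℓ ∧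
    σ'.v .len = σ.v .len ∧ σ'.v .ell = ℓ ∧ σ'.a .bit = σ.a .bit ∧
    IsTrie (σ'.a .child) (σ'.v .fresh) ∧ σ'.v .fresh ≤ σ'.v .pos ∧
    (∀ k < σ'.v .n, σ'.a .sgn k = (a k).2.toNat) ∧
    (∀ k < σ'.v .n, ∃ c, σ'.a .lab k = c + c ∧
      PathTo (σ'.a .child) (fun t => ((a k).1 : ℕ).testBit t) (Nat.clog 2 r) c)
  refine (Runs.loop (B := 80 * ℓ + 100) I ?_ ?_ (k := n) (σ := σ) ?_).mono ?_ ?_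
  · intro k σ' _
    simp
  · rintro k σ' ⟨h1, h2, h3, h4, h5, h6, h7, h8, h9⟩ hk
    simp only [eval_sub, eval_var, h2, h3, hlen] at hk
    have hlt : σ'.v .n < n := by
      by_contra h
      push Not at h
      have := Nat.mul_le_mul_right ℓ h
      omega
    have hle : (σ'.v .n + 1) * ℓ ≤ n * ℓ := Nat.mul_le_mul_right ℓ hlt
    have hle' : σ'.v .n + 1 ≤ (σ'.v .n + 1) * ℓ := Nat.le_mul_of_pos_right _ (by omega)
    rw [Nat.succ_mul] at hle hle'
    have hpre : Runs V (block [
        set .sgn (var .n) (get .bit (var .pos)),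
        assign .pos (var .pos + const 1),
        assign .cur (const 0),
        assign .cnt (var .ell - const 1)]) σ' 40 fun σ1 => σ1 =
        (((σ'.seta .sgn (σ'.v .n) (σ'.a .bit (σ'.v .pos))).setv .pos (σ'.v .pos + 1)).setv
          .cur 0).setv .cnt (σ'.v .ell - 1) := by
      refine Stmt.wp.runs_le ?_ (by decide)
      have hV1 : 1 ≤ V := by omega
      have hV2 : σ'.v .pos < V := by omega
      simp [hV1, hV2]
    refine ⟨by omega, (Runs.seq hpre fun σ1 hσ1 => Runs.seq (descend_runs
      (β := fun t => ((a (σ'.v .n)).1 : ℕ).testBit t) (c := Nat.clog 2 r) ?_ ?_ ?_ ?_ ?_ ?_).frame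
      fun σ2 hσ2 => Runs.seq (n := 30) (Stmt.wp.runs_le (Q := I (k - 1)) ?_ (by decide))
      fun σ3 hσ3 => Runs.block_nil hσ3).mono (by omega) fun _ h => h⟩
    · simp [hσ1, h4, hℓ]
    · simp [hσ1]
    · intro t ht
      have := hdigit _ hlt t ht
      simpa [hσ1, h2, h5] using this
    · simpa [hσ1] using h6
    · simp [hσ1]
      omega
    · simp [hσ1]
      omega
    · obtain ⟨⟨e1, e2, e3, e4, e5⟩, hF⟩ := hσ2
      have f1 := hF.v .n (by decide)
      have f2 := hF.v .len (by decide)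
      have f3 := hF.v .ell (by decide)
      have f4 := hF.a .bit (by decide)
      have f5 := hF.a .sgn (by decide)
      have f6 := hF.a .lab (by decide)
      simp [hσ1] at f1 f2 f3 f4 f5 f6 e1 e2 e3 e4 e5
      have hc := e3.pathTo_le e2
      simp only [block, Stmt.wp, ok_add, ok_var, ok_const, eval_add, eval_var, eval_const,
        true_and, St.seta_v, f1]
      refine ⟨by omega, ⟨by omega, by omega⟩, by simp; omega, ?_, by simp [f2, h3],
        by simp [f3, h4], by simp [f4, h5], by simpa using e3, by simp; omega, ?_, ?_⟩
      · simp [e1, h2, hℓ]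
        ring
      · intro k hk
        simp only [St.setv_v, if_true] at hk
        simp only [St.setv_a, St.seta_a, reduceCtorEq, if_false, f5, Function.update_apply]
        split
        · rename_i hkn
          rw [hkn, h5, h2, hsgn _ hlt]
        · exact h8 k (by omega)
      · intro k hk
        simp only [St.setv_v, if_true] at hk
        simp only [St.setv_a, St.seta_a, reduceCtorEq, if_false, if_true, f6,
          Function.update_apply]
        split
        · rename_i hkn
          rw [hkn]
          exact ⟨_, rfl, e2⟩
        · obtain ⟨c, hc1, hc2⟩ := h9 k (by omega)
          exact ⟨c, hc1, hc2.mono e5⟩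
  · refine ⟨by omega, by simp [hpos, hn], rfl, hell, rfl, ⟨fun x => ?_, fun x y hx => ?_⟩,
      by omega, fun k hk => by omega, fun k hk => by omega⟩
    · simp [hchild]
    · simp [hchild] at hx
  · have : (var Var.len - var Var.pos).len = 3 := rfl
    rw [this, hlen]
    have : n ≤ n * ℓ := Nat.le_mul_of_pos_right _ (by omega)
    rw [show n * (80 * ℓ + 100 + 3 + 3) = 80 * (n * ℓ) + 106 * n by ring]
    omega
  · rintro σ' ⟨⟨k, h1, h2, h3, h4, h5, h6, h7, h8, h9⟩, h0⟩
    simp only [eval_sub, eval_var, h2, h3, hlen] at h0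
    have hnn : σ'.v .n = n := by
      have h : n * ℓ ≤ σ'.v .n * ℓ := by omega
      have := Nat.le_of_mul_le_mul_right h (by omega)
      omega
    rw [hnn] at h2 h8 h9
    refine ⟨hnn, by omega, h8, ?_, ?_, ?_, ⟨σ'.v .fresh + 1, by ring⟩⟩
    · intro k hk k' hk'
      obtain ⟨c, hc1, hc2⟩ := h9 k hk
      obtain ⟨c', hc1', hc2'⟩ := h9 k' hk'
      rw [hc1, hc1']
      constructor
      · intro h
        obtain rfl : c = c' := by omega
        exact fin_eq_of_testBit (h6.pathTo_inj hc2 hc2')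
      · intro h
        rw [hc2.det hc2' fun s _ => by rw [h]]
    · intro k hk
      obtain ⟨c, hc1, -⟩ := h9 k hk
      exact ⟨c, by omega⟩
    · intro k hk
      obtain ⟨c, hc1, hc2⟩ := h9 k hk
      have := h6.pathTo_le hc2
      omega

end FreeSolvable

/-! ### Correctness of the passage from one level to the next -/

namespace FreeSolvable

open RAM RAM.Stmt RAM.Expr Finset

section Levels

variable {α : Type*} {N : Subgroup (FreeGroup α)} {a : ℕ → α × Bool} {u : ℕ → ℕ} {n M V : ℕ}

theorem computeEdges_runs {σ : St} (hn : σ.v .n = n) (hj : σ.v .j = 0)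
    (hsgn : ∀ k < n, σ.a .sgn k = (a k).2.toNat)
    (hV : ∀ i ≤ n, ∀ k < n, σ.a .cls i + σ.a .lab k + 1 ≤ V) (hV' : n + 1 ≤ V) :
    Runs V computeEdges σ (150 * (n + 1)) fun σ' =>
      (∀ k < n, σ'.a .fwd k =
        σ.a .cls (if (a k).2 then k else k + 1) + σ.a .lab k + (a k).2.toNat) ∧
      (∀ k < n, σ'.a .bwd k =
        σ.a .cls (if (a k).2 then k else k + 1) + σ.a .lab k + (1 - (a k).2.toNat)) := by
  let I : ℕ → St → Prop := fun k σ' => σ'.v .j + k = n ∧ σ'.v .n = n ∧ σ'.a .sgn = σ.a .sgn ∧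
    σ'.a .cls = σ.a .cls ∧ σ'.a .lab = σ.a .lab ∧
    (∀ k < σ'.v .j, σ'.a .fwd k =
        σ.a .cls (if (a k).2 then k else k + 1) + σ.a .lab k + (a k).2.toNat) ∧
    (∀ k < σ'.v .j, σ'.a .bwd k =
        σ.a .cls (if (a k).2 then k else k + 1) + σ.a .lab k + (1 - (a k).2.toNat))
  refine (Runs.loop (B := 130) I ?_ ?_ (k := n) (σ := σ) ?_).mono ?_ ?_
  · intro k σ' _
    simp
  · rintro k σ' ⟨h1, h2, h3, h4, h5, h6, h7⟩ hk
    simp only [eval_sub, eval_var, h2] at hk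
    refine ⟨by omega, Stmt.wp.runs_le ?_ (by decide)⟩
    have hlt : σ'.v .j < n := by omega
    have hs := hsgn _ hlt
    have v1 := hV (σ'.v .j) hlt.le _ hlt
    have v2 := hV (σ'.v .j + 1) hlt _ hlt
    simp only [block, Stmt.wp, ok_add, ok_var, ok_const, ok_get, eval_add,
      eval_var, eval_const, eval_get, true_and, St.seta_v, St.seta_a, reduceCtorEq,
      if_false, h3, h4, h5, hs]
    cases hb : (a (σ'.v .j)).2
    · refine ⟨fun h => by simp at h, fun _ => ⟨⟨⟨by omega, by omega⟩, by omega⟩,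
        ⟨⟨⟨by omega, by omega⟩, by omega⟩, by omega, by omega⟩,
        ⟨by omega, by omega⟩, ?_, ?_, ?_, ?_, ?_, ?_, ?_⟩⟩
      · simp; omega
      · simp [h2]
      · simp [h3]
      · simp [h4]
      · simp [h5]
      · intro k hk
        simp only [St.setv_v, if_true] at hk
        simp only [St.setv_a, St.seta_a, reduceCtorEq, if_false, if_true, Function.update_apply]
        split
        · rename_i hkj
          rw [hkj, hb]
          simp
        · exact h6 k (by omega)
      · intro k hk
        simp only [St.setv_v, if_true] at hk
        simp only [St.setv_a, St.seta_a, reduceCtorEq, if_false, if_true, Function.update_apply]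
        split
        · rename_i hkj
          rw [hkj, hb]
          simp
        · exact h7 k (by omega)
    · refine ⟨fun _ => ⟨⟨by omega, by omega, by omega⟩, by omega, ⟨by omega, by omega⟩,
        ?_, ?_, ?_, ?_, ?_, ?_, ?_⟩, fun h => by simp at h⟩
      · simp; omega
      · simp [h2]
      · simp [h3]
      · simp [h4]
      · simp [h5]
      · intro k hk
        simp only [St.setv_v, if_true] at hk
        simp only [St.setv_a, St.seta_a, reduceCtorEq, if_false, if_true, Function.update_apply]
        split
        · rename_i hkj
          rw [hkj, hb]
          simp
        · exact h6 k (by omega)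
      · intro k hk
        simp only [St.setv_v, if_true] at hk
        simp only [St.setv_a, St.seta_a, reduceCtorEq, if_false, if_true, Function.update_apply]
        split
        · rename_i hkj
          rw [hkj, hb]
          simp
        · exact h7 k (by omega)
  · exact ⟨by omega, hn, rfl, rfl, rfl, fun k hk => by omega, fun k hk => by omega⟩
  · have : (var Var.n - var Var.j).len = 3 := rfl
    rw [this]; omega
  · rintro σ' ⟨⟨k, h1, h2, h3, h4, h5, h6, h7⟩, h0⟩
    simp only [eval_sub, eval_var, h2] at h0
    have hjn : σ'.v .j = n := by omega
    rw [hjn] at h6 h7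
    exact ⟨h6, h7⟩

theorem clearNet_runs {σ : St} {j : ℕ} (hi : σ.v .i = j) (hV : 1 ≤ V) :
    Runs V clearNet σ (60 * (j + 1)) fun σ' =>
      ∀ o ∈ codes (σ.a .fwd) (σ.a .bwd) j, σ'.a .net o = 0 := by
  let I : ℕ → St → Prop := fun k σ' => σ'.v .i = k ∧ σ'.a .fwd = σ.a .fwd ∧
    σ'.a .bwd = σ.a .bwd ∧ ∀ t, k ≤ t → t < j →
      σ'.a .net (σ.a .fwd t) = 0 ∧ σ'.a .net (σ.a .bwd t) = 0
  refine (Runs.loop (B := 50) I ?_ ?_ (k := j) (σ := σ) ?_).mono ?_ ?_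
  · intro k σ' _
    simp
  · rintro k σ' ⟨h1, h2, h3, h4⟩ hk
    simp only [eval_var, h1] at hk
    refine ⟨hk, Stmt.wp.runs_le ?_ (by decide)⟩
    simp only [block, Stmt.wp, ok_sub, ok_var, ok_const, ok_get, eval_sub,
      eval_var, eval_const, eval_get, true_and, St.setv_v, St.setv_a, St.seta_v,
      St.seta_a, reduceCtorEq, if_false, if_true, h1, h2, h3]
    refine ⟨by omega, by omega, by omega, by simp, by simp [h2], by simp [h3],
      fun t ht htj => ?_⟩
    simp only [St.seta_a, St.setv_a, if_true, Function.update_apply]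
    by_cases h : t = k - 1
    · subst h
      simp
    · have := h4 t (by omega) htj
      simp [this]
  · exact ⟨hi, rfl, rfl, fun t h1 h2 => by omega⟩
  · have : (var Var.i).len = 1 := rfl
    rw [this]; omega
  · rintro σ' ⟨⟨k, h1, h2, h3, h4⟩, h0⟩ o ho
    rw [eval_var, h1] at h0
    obtain ⟨t, ht, rfl | rfl⟩ := mem_codes.1 ho
    · exact (h4 t (by omega) ht).1
    · exact (h4 t (by omega) ht).2

/-- The invariant of the loop: `net` and `tot` describe the path between the times `i` and `j`, and
`cls j` is `M` times the first time in `[i, j]` whose prefix agrees with the prefix `j`. -/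
theorem scan_runs [N.Normal] {σ : St} {j : ℕ} (hE : Encodes N a n u (σ.a .fwd) (σ.a .bwd))
    (hj : σ.v .j = j) (hjn : j ≤ n) (hm : σ.v .m = M) (hi : σ.v .i = j)
    (hval : σ.v .val = M * j) (htot : σ.v .tot = 0) (hcls : σ.a .cls j = M * j)
    (hnet : ∀ o ∈ codes (σ.a .fwd) (σ.a .bwd) j, σ.a .net o = 0) (hV : n + 1 ≤ V) :
    Runs V scan σ (160 * (n + 1)) fun σ' =>
      (∃ i, IsRep ⁅N, N⁆ a j i ∧ σ'.a .cls j = M * i) ∧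
      ∀ j', j' ≠ j → σ'.a .cls j' = σ.a .cls j' := by
  let I : ℕ → St → Prop := fun k σ' => σ'.v .i = k ∧ k ≤ j ∧ σ'.v .j = j ∧ σ'.v .m = M ∧
    σ'.v .val = M * k ∧ σ'.a .fwd = σ.a .fwd ∧ σ'.a .bwd = σ.a .bwd ∧
    NetCount (σ.a .fwd) (σ.a .bwd) (codes (σ.a .fwd) (σ.a .bwd) j) k j (σ'.a .net) (σ'.v .tot) ∧
    σ'.v .tot + k ≤ j ∧
    (∃ i, k ≤ i ∧ i ≤ j ∧ (pre a i : FreeGroup α ⧸ ⁅N, N⁆) = pre a j ∧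
      (∀ i', k ≤ i' → i' < i → (pre a i' : FreeGroup α ⧸ ⁅N, N⁆) ≠ pre a j) ∧
      σ'.a .cls j = M * i) ∧
    ∀ j', j' ≠ j → σ'.a .cls j' = σ.a .cls j'
  refine (Runs.loop (B := 140) I ?_ ?_ (k := j) (σ := σ) ?_).mono ?_ ?_
  · intro k σ' _
    simp
  · rintro k σ' ⟨h1, hkj, h2, h3, h4, h5, h6, h7, h8, ⟨i, h9, h10, h11, h12, h13⟩, h14⟩ hk
    simp only [eval_var, h1] at hk
    obtain ⟨k, rfl⟩ : ∃ k', k = k' + 1 := ⟨k - 1, by omega⟩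
    refine ⟨hk, Stmt.wp.runs_le ?_ (by decide)⟩
    have m1 : σ.a .fwd k ∈ codes (σ.a .fwd) (σ.a .bwd) j :=
      mem_codes.2 ⟨k, by omega, .inl rfl⟩
    have m2 : σ.a .bwd k ∈ codes (σ.a .fwd) (σ.a .bwd) j :=
      mem_codes.2 ⟨k, by omega, .inr rfl⟩
    have hstep := hE.netCount_step (by omega) hjn m1 m2 h7
    have hle : σ'.a .net (σ.a .fwd k) ≤ σ'.v .tot := by
      rw [h7.total]
      exact Finset.single_le_sum (fun _ _ => Nat.zero_le _) m1
    have hMk : M * (k + 1) - M = M * k := by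
      rw [Nat.mul_succ, Nat.add_sub_cancel]
    simp only [block, Stmt.wp, ok_sub, ok_add, ok_var, ok_const, ok_get, eval_sub, eval_add,
      eval_var, eval_const, eval_get, true_and, and_true, St.setv_v, St.setv_a, St.seta_v,
      reduceCtorEq, if_false, if_true, h1, h2, h3, h4, h5, h6, hMk,
      Nat.add_sub_cancel]
    have finish : ∀ (σ'' : St) (t : ℕ) (net : ℕ → ℕ), σ''.v .i = k → σ''.v .j = j →
        σ''.v .m = M → σ''.v .val = M * k → σ''.a .fwd = σ.a .fwd → σ''.a .bwd = σ.a .bwd →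
        σ''.v .tot = t → σ''.a .net = net → t + k ≤ j →
        NetCount (σ.a .fwd) (σ.a .bwd) (codes (σ.a .fwd) (σ.a .bwd) j) k j net t →
        σ''.a .cls = σ'.a .cls →
        (0 < t → I k σ'') ∧ (t = 0 → I k (σ''.seta .cls j (M * k))) := by
      intro σ'' t net e1 e2 e3 e4 e5 e6 e7 e8 ht hnc e9
      have hiff := hE.tot_eq_zero_iff (i := k) (by omega) hjn hnc
      constructor
      · intro htp
        refine ⟨e1, by omega, e2, e3, e4, e5, e6, by rw [e8, e7]; exact hnc, by omega,
          ⟨i, by omega, h10, h11, fun i' hi1 hi2 => ?_, by rw [e9, h13]⟩, by rw [e9]; exact h14⟩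
        rcases Nat.lt_or_ge k i' with hlt | hge
        · exact h12 i' hlt hi2
        · obtain rfl : i' = k := by omega
          rw [Ne, ← hiff]
          omega
      · intro ht0
        refine ⟨by simp [e1], by omega, by simp [e2], by simp [e3], by simp [e4], by simp [e5],
          by simp [e6], by simpa [e7, e8] using hnc, by simp [e7]; omega,
          ⟨k, le_rfl, by omega, hiff.1 ht0, fun i' hi1 hi2 => by omega, by simp⟩,
          fun j' hj' => ?_⟩
        simp [hj', e9, h14 j' hj']
    refine ⟨by omega, fun hp => ⟨by omega, by omega, ?_⟩, fun hz => ⟨⟨by omega, by omega⟩,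
      ⟨by omega, by omega⟩, ?_⟩⟩
    · refine finish _ _ _ ?_ ?_ ?_ ?_ ?_ ?_ rfl ?_ ?_ (hstep.1 hp) ?_
      · simp
      · simp [h2]
      · simp [h3]
      · simp
      · simp [h5]
      · simp [h6]
      · simp
      · omega
      · simp
    · refine ⟨fun h => (finish _ _ _ ?_ ?_ ?_ ?_ ?_ ?_ ?_ ?_ ?_ (hstep.2 hz) ?_).1 h, False.elim⟩
      · simp
      · simp [h2]
      · simp [h3]
      · simp
      · simp [h5]
      · simp [h6]
      · simp
      · simp
      · omega
      · simp
  · refine ⟨hi, le_rfl, hj, hm, hval, rfl, rfl, by rw [htot]; exact NetCount.zero hnet, by omega,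
      ⟨j, le_rfl, le_rfl, rfl, fun i' h1 h2 => by omega, hcls⟩, fun _ _ => rfl⟩
  · have : (var Var.i).len = 1 := rfl
    rw [this]; omega
  · rintro σ' ⟨⟨k, h1, hkj, h2, h3, h4, h5, h6, h7, h8, ⟨i, h9, h10, h11, h12, h13⟩, h14⟩, h0⟩
    rw [eval_var, h1] at h0
    exact ⟨⟨i, ⟨h10, h11, fun i' hi' => h12 i' (by omega) hi'⟩, h13⟩, h14⟩

theorem computeClasses_runs [N.Normal] {σ : St}
    (hE : Encodes N a n u (σ.a .fwd) (σ.a .bwd)) (hM : 0 < M)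
    (hn : σ.v .n = n) (hm : σ.v .m = M) (hj : σ.v .j = 0) (hjval : σ.v .jval = 0)
    (hV : n + 1 ≤ V) (hV' : M * (n + 2) ≤ V) :
    Runs V computeClasses σ (600 * (n + 1) ^ 2) fun σ' =>
      Classes ⁅N, N⁆ a n M (σ'.a .cls) := by
  let I : ℕ → St → Prop := fun k σ' => σ'.v .j + k = n + 1 ∧ σ'.v .n = n ∧ σ'.v .m = M ∧
    σ'.v .jval = M * σ'.v .j ∧ σ'.a .fwd = σ.a .fwd ∧ σ'.a .bwd = σ.a .bwd ∧
    ∀ j < σ'.v .j, ∃ i, IsRep ⁅N, N⁆ a j i ∧ σ'.a .cls j = M * i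
  refine (Runs.loop (B := 270 * (n + 1)) I ?_ ?_ (k := n + 1) (σ := σ) ?_).mono ?_ ?_
  · rintro k σ' ⟨h1, h2, -⟩
    simp only [ok_sub, ok_add, ok_var, ok_const, eval_var, eval_const]
    refine ⟨⟨trivial, by omega, by omega⟩, trivial⟩
  · rintro k σ' ⟨h1, h2, h3, h4, h5, h6, h7⟩ hk
    simp only [eval_sub, eval_add, eval_var, eval_const, h2] at hk
    have hjn : σ'.v .j ≤ n := by omega
    have hMj : M * σ'.v .j + M ≤ M * (n + 2) := by
      rw [← Nat.mul_succ]
      exact Nat.mul_le_mul_left M (by omega)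
    have hpre : ∀ σ1 : St, Runs V (block [
        assign .i (var .j),
        assign .val (var .jval),
        assign .tot (const 0),
        set .cls (var .j) (var .val)]) σ1 20 fun σ2 => σ2 =
        (((σ1.setv .i (σ1.v .j)).setv .val (σ1.v .jval)).setv .tot 0).seta .cls (σ1.v .j)
          (σ1.v .jval) := by
      intro σ1
      refine Stmt.wp.runs_le ?_ (by decide)
      simp
    refine ⟨by omega, (Runs.seq (n := 10) (Stmt.wp.runs_le
      (Q := fun σ1 => σ1 = σ'.setv .i (σ'.v .j)) (by simp) (by decide)) fun σ1 hσ1 =>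
      Runs.seq (clearNet_runs (j := σ'.v .j) ?_ ?_).frame fun σ2 hσ2 =>
      Runs.seq (hpre σ2) fun σ3 hσ3 =>
      Runs.seq (scan_runs (N := N) (a := a) (u := u) (n := n) (M := M) (j := σ'.v .j)
        ?_ ?_ ?_ ?_ ?_ ?_ ?_ ?_ ?_ hV).frame
      fun σ4 hσ4 => Runs.seq (n := 20) (Stmt.wp.runs_le (Q := I (k - 1)) ?_ (by decide))
      fun σ5 hσ5 => Runs.block_nil hσ5).mono (by omega) fun _ h => h⟩
    · simp [hσ1]
    · omega
    all_goals
      obtain ⟨c1, hF⟩ := hσ2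
      have f1 := hF.v .j (by decide)
      have f2 := hF.v .m (by decide)
      have f3 := hF.v .jval (by decide)
      have f4 := hF.a .fwd (by decide)
      have f5 := hF.a .bwd (by decide)
      have f6 := hF.a .cls (by decide)
      have f7 := hF.v .n (by decide)
      simp only [hσ1, St.setv_v, St.setv_a, reduceCtorEq, if_false] at f1 f2 f3 f4 f5 f6 f7 c1
    · simpa [hσ3, f4, f5, h5, h6] using hE
    · simp [hσ3, f1]
    · exact hjn
    · simp [hσ3, f2, h3]
    · simp [hσ3, f1]
    · simp [hσ3, f3, h4]
    · simp [hσ3]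
    · simp [hσ3, f1, f3, h4]
    · simpa [hσ3, f4, f5] using c1
    · obtain ⟨⟨⟨i, r1, r2⟩, r3⟩, hF'⟩ := hσ4
      have g1 := hF'.v .j (by decide)
      have g2 := hF'.v .m (by decide)
      have g3 := hF'.v .jval (by decide)
      have g4 := hF'.a .fwd (by decide)
      have g5 := hF'.a .bwd (by decide)
      have g7 := hF'.v .n (by decide)
      simp only [hσ3, St.setv_v, St.setv_a, St.seta_v, St.seta_a, reduceCtorEq, if_false, if_true,
        f1, f2, f3, f4, f5, f6, f7] at g1 g2 g3 g4 g5 g7 r3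
      simp only [block, Stmt.wp, ok_add, ok_var, ok_const, eval_add, eval_var, eval_const,
        true_and, St.setv_v, reduceCtorEq, if_false, g1, g2, g3]
      refine ⟨⟨by omega, by omega⟩, by rw [h3, h4]; omega, by simp; omega, by simp [g7, h2],
        by simp [g2, h3], by simp [h3, h4]; ring, by simp [g4, h5], by simp [g5, h6],
        fun j hj => ?_⟩
      simp only [St.setv_v, reduceCtorEq, if_false, if_true] at hj
      simp only [St.setv_a]
      by_cases hjj : j = σ'.v .j
      · rw [hjj]
        exact ⟨i, r1, r2⟩
      · obtain ⟨i', e1, e2⟩ := h7 j (by omega)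
        refine ⟨i', e1, ?_⟩
        rw [r3 j hjj, Function.update_of_ne hjj, e2]
  · exact ⟨by omega, hn, hm, by rw [hj, hjval, mul_zero], rfl, rfl, fun j hj' => by omega⟩
  · have : (var Var.n + const 1 - var Var.j).len = 5 := rfl
    rw [this]
    ring_nf
    nlinarith [sq_nonneg n]
  · rintro σ' ⟨⟨k, h1, h2, h3, h4, h5, h6, h7⟩, h0⟩
    simp only [eval_sub, eval_add, eval_var, eval_const, h2] at h0
    exact classes_of_isRep hM fun j hj => h7 j (by omega)

end Levels

/-- On level zero all prefixes agree. -/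
theorem classes_top {α : Type*} {a : ℕ → α × Bool} {n M : ℕ} :
    Classes (⊤ : Subgroup (FreeGroup α)) a n M fun _ => 0 where
  eq_iff i _ j _ := by
    simp only [true_iff]
    exact QuotientGroup.eq.2 (Subgroup.mem_top _)
  mul i _ := ⟨0, Nat.zero_le _, rfl⟩
  zero := rfl

/-- At the end the classes belong to a level `D` which is `d`, or at which no nontrivial element of norm
at most `n` is left. -/
theorem levels_runs {α : Type*} {a : ℕ → α × Bool} {n M V d : ℕ} {σ : St} (hM : 0 < M)
    (hn : σ.v .n = n) (hn0 : 0 < n) (hm : σ.v .m = M) (hd : σ.v .d = d) (hlim : σ.v .lim = 1)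
    (hsgn : ∀ k < n, σ.a .sgn k = (a k).2.toNat) (hlab : Labels a n M (σ.a .lab))
    (hcls : σ.a .cls = fun _ => 0) (hV : 2 * n + 1 ≤ V) (hV' : M * (n + 2) ≤ V) :
    Runs V levels σ (1000 * (n + 1) ^ 2 * (Nat.size n + 1)) fun σ' =>
      ∃ D, Classes (derivedSeries (FreeGroup α) D) a n M (σ'.a .cls) ∧ D ≤ d ∧
        (D = d ∨ n < 2 ^ D) := by
  let I : ℕ → St → Prop := fun k σ' => σ'.v .n = n ∧ σ'.v .m = M ∧ σ'.a .sgn = σ.a .sgn ∧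
    σ'.a .lab = σ.a .lab ∧ ∃ D, Classes (derivedSeries (FreeGroup α) D) a n M (σ'.a .cls) ∧
      D ≤ d ∧ ((σ'.v .d = d - D ∧ σ'.v .lim = 2 ^ D ∧ 2 ^ D ≤ n ∧ D + k = Nat.size n) ∨
        (σ'.v .d = 0 ∧ n < 2 ^ D))
  refine (Runs.loop (B := 800 * (n + 1) ^ 2) I ?_ ?_ (k := Nat.size n) (σ := σ) ?_).mono ?_ ?_
  · intro k σ' _
    simp
  · rintro k σ' ⟨h1, h2, h3, h4, D, hC, hD, hI⟩ hk
    simp only [eval_var] at hk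
    rcases hI with ⟨i1, i2, i3, i4⟩ | ⟨i1, -⟩
    swap
    · omega
    have hDs : D < Nat.size n := Nat.lt_size.2 i3
    have hle : n + 1 ≤ (n + 1) ^ 2 := Nat.le_self_pow two_ne_zero _
    refine ⟨by omega, (Runs.seq (n := 10) (Stmt.wp.runs_le
      (Q := fun σ1 => σ1 = σ'.setv .j 0) (by simp) (by decide)) fun σ1 hσ1 =>
      Runs.seq (computeEdges_runs (a := a) (n := n) ?_ ?_ ?_ ?_ ?_).frame fun σ2 hσ2 =>
      Runs.seq (n := 10) (Stmt.wp.runs_le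
        (Q := fun σ3 => σ3 = (σ2.setv .j 0).setv .jval 0) (by simp) (by decide)) fun σ3 hσ3 =>
      Runs.seq (computeClasses_runs (N := derivedSeries (FreeGroup α) D) (a := a)
        (u := fun k => (σ'.a .cls (if (a k).2 then k else k + 1) + σ'.a .lab k) / 2)
        ?_ hM ?_ ?_ ?_ ?_ ?_ hV').frame fun σ4 hσ4 =>
      Runs.seq (n := 40) (Stmt.wp.runs_le (Q := I (k - 1)) ?_ (by decide))
      fun σ5 hσ5 => Runs.block_nil hσ5).mono (by omega) fun _ h => h⟩
    · simp [hσ1, h1]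
    · simp [hσ1]
    · simpa [hσ1, h3] using hsgn
    · intro i hi k hk
      obtain ⟨c, hc1, hc2⟩ := hC.mul i hi
      have l1 := hlab.lt k hk
      simp only [hσ1, St.setv_a, h4, hc2]
      have : M * c ≤ M * n := Nat.mul_le_mul_left M hc1
      rw [Nat.mul_add] at hV'
      omega
    · omega
    all_goals
      obtain ⟨⟨c1, c2⟩, hF⟩ := hσ2
      have f1 := hF.v .n (by decide)
      have f2 := hF.v .m (by decide)
      have f3 := hF.v .d (by decide)
      have f4 := hF.v .lim (by decide)
      have f5 := hF.a .sgn (by decide)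
      have f6 := hF.a .lab (by decide)
      simp only [hσ1, St.setv_v, St.setv_a, reduceCtorEq, if_false] at f1 f2 f3 f4 f5 f6 c1 c2
    · refine hC.encodes (h4 ▸ hlab) ?_ ?_
      · simpa [hσ3] using c1
      · simpa [hσ3] using c2
    · simp [hσ3, f1, h1]
    · simp [hσ3, f2, h2]
    · simp [hσ3]
    · simp [hσ3]
    · omega
    · obtain ⟨hC', hF'⟩ := hσ4
      have g1 := hF'.v .n (by decide)
      have g2 := hF'.v .m (by decide)
      have g3 := hF'.v .d (by decide)
      have g4 := hF'.v .lim (by decide)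
      have g5 := hF'.a .sgn (by decide)
      have g6 := hF'.a .lab (by decide)
      simp only [hσ3, St.setv_v, St.setv_a, reduceCtorEq, if_false,
        f1, f2, f3, f4, f5, f6] at g1 g2 g3 g4 g5 g6
      rw [← derivedSeries_succ] at hC'
      have hpow : 2 ^ (D + 1) = 2 ^ D + 2 ^ D := by rw [pow_succ]; ring
      simp only [block, Stmt.wp, ok_sub, ok_add, ok_var, ok_const, eval_add, eval_sub, eval_var,
        eval_const, true_and, St.setv_v, reduceCtorEq, if_false, if_true, g1, g3, g4, h1, i1, i2]
      refine ⟨by omega, by omega, fun hgt => ⟨by omega, ?_⟩, fun hle => ?_⟩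
      · refine ⟨by simp [g1, h1], by simp [g2, h2], by simp [g5, h3], by simp [g6, h4], D + 1,
          by simpa using hC', by omega, .inr ⟨by simp, by omega⟩⟩
      · refine ⟨by simp [g1, h1], by simp [g2, h2], by simp [g5, h3], by simp [g6, h4], D + 1,
          by simpa using hC', by omega, .inl ⟨by simp; omega, by simp [hpow], by omega, by omega⟩⟩
  · refine ⟨hn, hm, rfl, rfl, 0, ?_, Nat.zero_le _, .inl ⟨by omega, by simpa using hlim, by simpa,
      by omega⟩⟩
    rw [derivedSeries_zero, hcls]
    exact classes_top
  · have : (var Var.d).len = 1 := rfl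
    rw [this]
    have : 1 ≤ (n + 1) ^ 2 := Nat.one_le_pow _ _ (by omega)
    nlinarith [Nat.zero_le (Nat.size n)]
  · rintro σ' ⟨⟨k, h1, h2, h3, h4, D, hC, hD, hI⟩, h0⟩
    rw [eval_var] at h0
    refine ⟨D, hC, hD, ?_⟩
    rcases hI with ⟨i1, -⟩ | ⟨-, i2⟩
    · left; omega
    · exact .inr i2

end FreeSolvable

/-! ### The decision procedure -/

namespace FreeSolvable

open RAM RAM.Stmt RAM.Expr

theorem eq_one_of_mem_derivedSeries {α : Type*} [DecidableEq α] {D n : ℕ} {g : FreeGroup α}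
    (hg : g.norm ≤ n) (hD : n < 2 ^ D) : g ∈ derivedSeries (FreeGroup α) D ↔ g = 1 := by
  refine ⟨fun h => ?_, fun h => h ▸ one_mem _⟩
  by_contra hne
  have h1 := three_pow_le_norm D g hne h
  have h2 : 2 ^ D ≤ 3 ^ D := Nat.pow_le_pow_left (by norm_num) D
  omega

/-- The levels `d` and `D` of the derived series contain the same elements of norm at most `n`: the
number `e` is `d` or both exceed `n`, and `D` is `e` or large enough for the bound `3 ^ D`. -/
theorem mem_derivedSeries_iff {α : Type*} [DecidableEq α] {d e D n : ℕ} {g : FreeGroup α}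
    (hg : g.norm ≤ n) (he : e = d ∨ (n < e ∧ n < d)) (hDe : D ≤ e) (hD : D = e ∨ n < 2 ^ D) :
    g ∈ derivedSeries (FreeGroup α) D ↔ g ∈ derivedSeries (FreeGroup α) d := by
  have hlarge : ∀ m, n < m → n < 2 ^ m := fun m hm => hm.trans Nat.lt_two_pow_self
  rcases eq_or_ne D d with rfl | hne
  · rfl
  have h1 : n < 2 ^ D := by
    rcases hD with rfl | hD
    · exact hlarge _ (by omega)
    · exact hD
  have h2 : n < 2 ^ d := by
    rcases he with rfl | he
    · exact h1.trans_le (Nat.pow_le_pow_right (by norm_num) hDe)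
    · exact hlarge _ he.2
  rw [eq_one_of_mem_derivedSeries hg h1, eq_one_of_mem_derivedSeries hg h2]

theorem headD_cons_tail {α : Type*} {l : List α} (h : l ≠ []) (x : α) : l.headD x :: l.tail = l := by
  cases l with
  | nil => exact absurd rfl h
  | cons y l => rfl

theorem le_two_of_mem_inputTape {r d x : ℕ} {w : Word r} (h : x ∈ inputTape r d w) : x ≤ 2 := by
  have hb : ∀ l : List Bool, x ∈ bitsToTape l → x ≤ 2 := by
    intro l hl
    obtain ⟨b, -, rfl⟩ := List.mem_map.1 hl
    cases b <;> simp
  simp only [inputTape, List.mem_append, List.mem_cons, List.not_mem_nil, or_false] at h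
  rcases h with h | h | h | h | h | h
  · exact hb _ h
  · exact h.le
  · exact hb _ h
  · exact h.le
  · exact hb _ h
  · exact h.le

/-- The state in which the program starts on the given tape. -/
def start (τ : List ℕ) : St := ⟨fun _ => 0, fun _ _ => 0, τ⟩

/-- The bound for the numbers that the decision procedure handles on a code of length `L`. -/
def numBound (L : ℕ) : ℕ := 4 * (L + 2) ^ 2

theorem wordProblem_runs_nil (r d : ℕ) :
    Runs (numBound 0) wordProblem (start (inputTape r d [])) 50 fun σ' =>
      0 < σ'.v .res ↔ eval r d [] = 1 := by
  have hsym : ((start (inputTape r d [])).readv .sym).v .sym = 2 := rfl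
  have h1 : eval r d [] = 1 := rfl
  refine (Runs.seq (n := 10) (Stmt.wp.runs_le (Q := fun σ =>
      σ = (start (inputTape r d [])).readv .sym) (by simp) (by decide)) fun σ hσ => Runs.seq (n := 30)
    ((Runs.ite (n := 10) ?_ (fun _ => Stmt.wp.runs_le ?_ (by decide)) ?_).mono (by decide)
      fun _ h => h) fun σ' h => Runs.block_nil h).mono (by decide) fun _ h => h
  · simp [numBound]
  · simp [numBound, h1]
  · intro h
    rw [hσ, eval_sub, eval_var, hsym, eval_const] at h
    exact absurd h (by decide)
theorem wordProblem_runs {r d n L : ℕ} {w : Word r} (hw : w ≠ []) (hn : w.length = n)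
    (hL : (code w).length = L) :
    Runs (numBound L) wordProblem (start (inputTape r d w))
      (1000 * (L + 1) + 1000 * (n + 1) ^ 2 * (Nat.size n + 1)) fun σ' =>
      0 < σ'.v .res ↔ eval r d w = 1 := by
  set a : ℕ → Fin r × Bool := fun k => w.getD k (w.head hw) with ha
  have hak : ∀ k (hk : k < w.length), a k = w[k] := fun k hk => by
    simp [ha, List.getD_eq_getElem?_getD, hk]
  have hwa : (List.range n).map a = w := by
    refine List.ext_getElem (by simp [hn]) fun k h1 h2 => ?_
    simp [hak k h2]
  have hr : 0 < r := (w.head hw).1.pos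
  have hn0 : 0 < n := hn ▸ List.length_pos_iff.2 hw
  have hLn : L = n * (Nat.clog 2 r + 1) := by rw [← hL, length_code, hn]
  have hnL : n ≤ L := hLn ▸ Nat.le_mul_of_pos_right n (Nat.succ_pos _)
  have hsize : Nat.size r ≤ L := by
    have h1 := clog_eq hr
    have h2 : Nat.clog 2 r + 1 ≤ L := hLn ▸ Nat.le_mul_of_pos_left _ hn0
    split at h1 <;> omega
  have hsizeL : Nat.size L ≤ L := Nat.size_le.2 Nat.lt_two_pow_self
  have hV : 8 * L + 8 ≤ numBound L := by
    have : numBound L = 4 * L ^ 2 + 16 * L + 16 := by rw [numBound]; ring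
    omega
  set V := numBound L with hVdef
  set σ0 := start (inputTape r d w) with hσ0
  have htape1 : ∀ (l : List Bool) (t : List ℕ), bitsToTape l ++ 2 :: t ≠ [] := by simp
  have hsym : (inputTape r d w).headD 0 - 1 = 0 := by
    obtain ⟨b, l, h⟩ : ∃ b l, code w = b :: l := by
      cases h : code w with
      | nil => rw [h] at hL; simp at hL; omega
      | cons b l => exact ⟨b, l, rfl⟩
    rw [inputTape, h, bitsToTape_cons]
    cases b <;> rfl
  have hcode : ∀ {i b}, (code w)[i]? = some b → i < L := by
    intro i b h
    rw [← hL]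
    exact (List.getElem?_eq_some_iff.1 h).1
  have hread : ∀ {σ τ : St}, τ = σ.readv .sym → ∀ {l : List Bool} {t : List ℕ},
      σ.tape = bitsToTape l ++ 2 :: t → τ.v .sym :: τ.tape = bitsToTape l ++ 2 :: t := by
    rintro σ _ rfl l t h
    rw [St.readv_v, if_pos rfl, St.readv_tape, h]
    exact headD_cons_tail (by simp) 0
  refine Runs.mono (n := 10 + ((50 * (L + 1) + (10 + (50 * ((Nat.bits r).length + 1) + (30 +
    (60 * (Nat.size L + 2) + (300 * (L + 1) + (20 + (1000 * (n + 1) ^ 2 * (Nat.size n + 1) +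
    (20 + 0)))))))) + (var .sym - const 1 : Expr).len + 3) + 0)) ?_ ?_ fun _ h => h
  swap
  · have h1 : (var Var.sym - const 1 : Expr).len = 3 := rfl
    have h2 : (Nat.bits r).length = Nat.size r := Nat.size_eq_bits_len r
    rw [h1, h2]
    omega
  refine Runs.seq (Stmt.wp.runs_le (Q := fun σ => σ = σ0.readv .sym) (by simp) (by decide))
    fun σ hσ => Runs.seq (Runs.ite ?_ ?_ fun _ => ?_) fun σ' h => Runs.block_nil h
  · simp only [ok_sub, ok_var, ok_const, true_and]
    omega
  · intro h
    rw [hσ, eval_sub, eval_var, eval_const, St.readv_v, if_pos rfl] at h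
    exact absurd hsym h.ne'
  -- Read the word.
  refine Runs.seq (hL ▸ readWord_runs (l := code w) (by omega) (by rw [hσ]; rfl)
    (hread hσ rfl)).frame fun σ1 hσ1 => ?_
  obtain ⟨⟨a1, a2, a3⟩, hF1⟩ := hσ1
  have z1 : ∀ x, x ∉ readWord.vars → x ≠ .sym → σ1.v x = 0 := fun x hx hxs => by
    rw [hF1.v x hx, hσ, St.readv_v, if_neg hxs]
    rfl
  have y1 : ∀ x, x ∉ readWord.arrs → ∀ i, σ1.a x i = 0 := fun x hx i => by
    rw [hF1.a x hx, hσ]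
    rfl
  -- Read the rank.
  refine Runs.seq (Stmt.wp.runs_le (Q := fun σ' => σ' = σ1.readv .sym) (by simp) (by decide))
    fun σ2 hσ2 => ?_
  refine Runs.seq (readRank_runs (l := Nat.bits r) ?_ ?_ ?_ (hread hσ2 a2)).frame
    fun σ3 hσ3 => ?_
  · rw [Nat.size_eq_bits_len]
    omega
  · simp [hσ2, z1 .ell (by decide)]
  · simp [hσ2, z1 .ones (by decide)]
  obtain ⟨⟨b1, b2, b3⟩, hF3⟩ := hσ3
  have z3 : ∀ x, x ∉ readWord.vars → x ∉ readRank.vars → x ≠ .sym → σ3.v x = 0 :=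
    fun x h1 h2 h3 => by
      rw [hF3.v x h2, hσ2, St.readv_v, if_neg h3, z1 x h1 h3]
  have y3 : σ3.a = σ1.a := funext fun x => by rw [hF3.a x (by simp [readRank, Stmt.arrs]), hσ2]; rfl
  have len3 : σ3.v .len = L := by
    rw [hF3.v .len (by decide), hσ2, St.readv_v, if_neg (by decide), a1]
  refine Runs.seq (Stmt.wp.runs_le (Q := fun σ' => σ' =
      ((σ3.setv .ell (Nat.clog 2 r + 1)).setv .pow 1).readv .sym) ?_ (by decide)) fun σ4 hσ4 => ?_
  · rw [Nat.size_eq_bits_len] at b1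
    rw [clog_eq hr]
    simp only [block, Stmt.wp, ok_sub, ok_add, ok_var, ok_const, eval_sub, eval_add, eval_var,
      eval_const, true_and, b1, b2]
    refine ⟨by omega, fun h => ⟨⟨by omega, by omega⟩, by omega, ?_⟩, fun h => ⟨by omega, ?_⟩⟩
    · rw [if_pos (by omega)]
    · rw [if_neg (by omega), ← b1, St.setv_self]
  -- Read the class.
  refine Runs.seq (readClass_runs (e := d) (L := L) ?_ ?_ ?_ ?_ ?_ ?_).frame fun σ5 hσ5 => ?_
  · omega
  · omega
  · simp [hσ4, len3]
  · simp [hσ4, z3 .d (by decide) (by decide)]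
  · simp [hσ4]
  · exact hread hσ4 b3
  obtain ⟨hd5, hF5⟩ := hσ5
  have z5 : ∀ x, x ∉ readWord.vars → x ∉ readRank.vars → x ∉ readClass.vars → x ≠ .sym →
      x ≠ .ell → x ≠ .pow → σ5.v x = 0 :=
    fun x h1 h2 h3 h4 h5 h6 => by
      rw [hF5.v x h3, hσ4, St.readv_v, if_neg h4, St.setv_v, if_neg h6, St.setv_v, if_neg h5,
        z3 x h1 h2 h4]
  have y5 : σ5.a = σ1.a := funext fun x => by
    rw [hF5.a x (by simp [readClass, Stmt.arrs]), hσ4, ← y3]; rfl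
  have len5 : σ5.v .len = L := by
    rw [hF5.v .len (by decide), hσ4]
    simpa using len3
  have ell5 : σ5.v .ell = Nat.clog 2 r + 1 := by
    rw [hF5.v .ell (by decide), hσ4]
    simp
  -- Split the word into letters.
  refine Runs.seq ((decode_runs (a := a) (n := n) ell5 (len5.trans hLn) ?_ ?_ ?_ ?_ ?_ ?_
    ?_).frame.mono (by rw [len5]) fun _ h => h) fun σ6 hσ6 => ?_
  · intro k hk
    rw [y5, hak k (hn ▸ hk)]
    exact a3 _ _ (code_sign w k (hn ▸ hk))
  · intro k hk t ht
    rw [y5, hak k (hn ▸ hk)]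
    exact a3 _ _ (code_digit w k t (hn ▸ hk) ht)
  · exact z5 .pos (by decide) (by decide) (by decide) (by decide) (by decide) (by decide)
  · exact z5 .n (by decide) (by decide) (by decide) (by decide) (by decide) (by decide)
  · exact z5 .fresh (by decide) (by decide) (by decide) (by decide) (by decide) (by decide)
  · intro x
    rw [y5, y1 .child (by decide)]
  · omega
  obtain ⟨⟨c1, c2, c3, c4⟩, hF6⟩ := hσ6
  refine Runs.seq (Stmt.wp.runs_le (Q := fun σ' => σ' =
      (σ6.setv .m (2 * σ6.v .fresh + 2)).setv .lim 1) ?_ (by decide)) fun σ7 hσ7 => ?_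
  · rw [len5] at c2
    simp only [block, Stmt.wp, ok_add, ok_var, ok_const, eval_add, eval_var,
      eval_const, true_and, two_mul, and_true]
    omega
  -- Pass through the levels.
  refine Runs.seq (levels_runs (a := a) (n := n) (M := 2 * σ6.v .fresh + 2) (d := σ5.v .d)
    ?_ ?_ hn0 ?_ ?_ ?_ ?_ ?_ ?_ ?_ ?_).frame fun σ8 hσ8 => ?_
  · omega
  · simp [hσ7, c1]
  · simp [hσ7]
  · simp [hσ7, hF6.v .d (by decide)]
  · simp [hσ7]
  · simpa [hσ7] using c3
  · simpa [hσ7] using c4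
  · funext i
    simp [hσ7, hF6.a .cls (by decide), y5, y1 .cls (by decide)]
  · omega
  · rw [len5] at c2
    calc (2 * σ6.v .fresh + 2) * (n + 2) ≤ (2 * (L + 2)) * (L + 2) :=
          Nat.mul_le_mul (by omega) (by omega)
      _ ≤ V := by rw [hVdef, numBound]; nlinarith
  obtain ⟨⟨D, hC, hD1, hD2⟩, hF8⟩ := hσ8
  have n8 : σ8.v .n = n := by
    rw [hF8.v .n (by decide), hσ7]
    simpa using c1
  have res8 : σ8.v .res = 0 := by
    rw [hF8.v .res (by decide), hσ7]
    simp [hF6.v .res (by decide), z5 .res (by decide) (by decide) (by decide)]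
  have hnorm : (FreeGroup.mk w).norm ≤ n := hn ▸ FreeGroup.norm_mk_le
  have hres : σ8.a .cls n = 0 ↔ eval r d w = 1 := by
    rw [← hC.zero, hC.eq_iff n le_rfl 0 (Nat.zero_le n), pre_eq_mk_map_range, hwa, eval,
      QuotientGroup.eq_one_iff, ← mem_derivedSeries_iff hnorm ?_ hD1 hD2]
    · exact QuotientGroup.eq_one_iff _
    · omega
  refine Runs.seq (Stmt.wp.runs_le ?_ (by decide)) fun σ' h => Runs.block_nil h
  simp only [Stmt.wp, ok_get, ok_var, ok_const, eval_get, eval_var, eval_const, true_and, n8,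
    ← hres, St.setv_v, if_true, res8]
  refine ⟨fun h => ?_, fun h => ⟨by omega, ?_⟩⟩
  · simp [h.ne']
  · simp [h]

end FreeSolvable

/-! ### The running time -/

namespace FreeSolvable

open RAM

theorem lt_two_pow_log (n : ℕ) : n + 2 < 2 ^ (Nat.log 2 (n + 2) + 1) :=
  Nat.lt_pow_succ_log_self Nat.one_lt_two _

theorem one_le_log (n : ℕ) : 1 ≤ Nat.log 2 (n + 2) :=
  Nat.log_pos Nat.one_lt_two (by omega)

theorem unitCost_numBound_le (L : ℕ) : unitCost (numBound L) ≤ 22 * Nat.log 2 (L + 2) := by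
  have h1 := lt_two_pow_log L
  have h2 := one_le_log L
  set l := Nat.log 2 (L + 2)
  have h3 : 16 * numBound L + 16 < 2 ^ (2 * l + 9) := by
    have h4 : (L + 2) ^ 2 < (2 ^ (l + 1)) ^ 2 := Nat.pow_lt_pow_left h1 two_ne_zero
    have h5 : 1 ≤ (L + 2) ^ 2 := Nat.one_le_pow _ _ (by omega)
    have h6 : 2 ^ (2 * l + 9) = 128 * (2 ^ (l + 1)) ^ 2 := by ring
    rw [h6, numBound]
    omega
  have h4 : Nat.size (16 * numBound L + 16) ≤ 2 * l + 9 := Nat.size_le.2 h3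
  rw [unitCost, bitLen]
  omega

/-- The number of steps times the cost of a step is quasi-quadratic. The mixed term
`n² log n log L` is absorbed by `L log² L` if `n² ≤ L`, and by `n² log² n` otherwise. -/
theorem time_le {n L : ℕ} (hn : 0 < n) (hnL : n ≤ L) :
    (1000 * (L + 1) + 1000 * (n + 1) ^ 2 * (Nat.size n + 1) + 2) * unitCost (numBound L) ≤
      2000000 * (n ^ 2 * Nat.log 2 (n + 2) ^ 2 + L * Nat.log 2 (L + 2) ^ 2 + 1) := by
  have hu := unitCost_numBound_le L
  have hn1 := one_le_log n
  have hL1 := one_le_log L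
  have hlog : Nat.log 2 (n + 2) ≤ Nat.log 2 (L + 2) := Nat.log_mono_right (by omega)
  have hsize : Nat.size n ≤ Nat.log 2 (n + 2) + 1 :=
    Nat.size_le.2 ((by omega : n < n + 2).trans (lt_two_pow_log n))
  have hcases : n ^ 2 ≤ L ∨ Nat.log 2 (L + 2) ≤ 4 * Nat.log 2 (n + 2) := by
    refine (le_or_gt (n ^ 2) L).imp_right fun h => ?_
    have h1 : L + 2 < 2 ^ (2 * (Nat.log 2 (n + 2) + 1)) := by
      rw [mul_comm, pow_mul]
      have := Nat.pow_lt_pow_left (lt_two_pow_log n) two_ne_zero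
      nlinarith
    have := Nat.log_lt_of_lt_pow (by omega) h1
    omega
  set u := unitCost (numBound L)
  set l := Nat.log 2 (L + 2)
  set k := Nat.log 2 (n + 2)
  have hsteps : 1000 * (L + 1) + 1000 * (n + 1) ^ 2 * (Nat.size n + 1) + 2 ≤
      2002 * L + 12000 * (n ^ 2 * k) := by
    have h1 : (n + 1) ^ 2 ≤ 4 * n ^ 2 := by nlinarith
    have h2 : (n + 1) ^ 2 * (Nat.size n + 1) ≤ (4 * n ^ 2) * (3 * k) :=
      Nat.mul_le_mul h1 (by omega)
    have h3 : (4 * n ^ 2) * (3 * k) = 12 * (n ^ 2 * k) := by ring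
    rw [mul_assoc]
    omega
  have hmixed : n ^ 2 * k * l ≤ 4 * (n ^ 2 * k ^ 2) + L * l ^ 2 := by
    rcases hcases with h | h
    · calc n ^ 2 * k * l ≤ L * l * l := by gcongr
        _ = L * l ^ 2 := by ring
        _ ≤ _ := Nat.le_add_left _ _
    · calc n ^ 2 * k * l ≤ n ^ 2 * k * (4 * k) := by gcongr
        _ = 4 * (n ^ 2 * k ^ 2) := by ring
        _ ≤ _ := Nat.le_add_right _ _
  have hl : L * l ≤ L * l ^ 2 := Nat.mul_le_mul_left L (Nat.le_self_pow two_ne_zero l)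
  calc _ ≤ (2002 * L + 12000 * (n ^ 2 * k)) * (22 * l) := Nat.mul_le_mul hsteps hu
    _ = 44044 * (L * l) + 264000 * (n ^ 2 * k * l) := by ring
    _ ≤ _ := by omega

theorem wordProblem_halts (r d : ℕ) (w : Word r) : ∃ (t : ℕ) (b : Bool),
    Halts wordProblem.toProgram (inputTape r d w) t b ∧ (b = true ↔ eval r d w = 1) ∧
      t ≤ 2000000 * (w.length ^ 2 * Nat.log 2 (w.length + 2) ^ 2 +
        (code w).length * Nat.log 2 ((code w).length + 2) ^ 2 + 1) := by
  have hτ : ∀ L, ∀ x ∈ inputTape r d w, x ≤ numBound L := fun L x hx =>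
    (le_two_of_mem_inputTape hx).trans (by
      have := Nat.one_le_pow 2 (L + 2) (by omega)
      rw [numBound]
      omega)
  have key : ∀ L N, Runs (numBound L) wordProblem (start (inputTape r d w)) N
      (fun σ' => 0 < σ'.v .res ↔ eval r d w = 1) → ∃ (t : ℕ) (b : Bool),
      Halts wordProblem.toProgram (inputTape r d w) t b ∧ (b = true ↔ eval r d w = 1) ∧
        t ≤ (N + 2) * unitCost (numBound L) := by
    rintro L N ⟨σ', m, h1, h2, h3⟩
    obtain ⟨t, h4, h5⟩ := h1.halts (hτ L)
    exact ⟨t, _, h4, decide_eq_true_iff.trans h3,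
      h5.trans (Nat.mul_le_mul_right _ (by omega))⟩
  rcases eq_or_ne w [] with rfl | hw
  · obtain ⟨t, b, h1, h2, h3⟩ := key _ _ (wordProblem_runs_nil r d)
    refine ⟨t, b, h1, h2, h3.trans ?_⟩
    have h4 := unitCost_numBound_le 0
    have h5 : Nat.log 2 (0 + 2) = 1 := by norm_num
    rw [h5] at h4
    omega
  · obtain ⟨t, b, h1, h2, h3⟩ := key _ _ (wordProblem_runs (d := d) hw rfl rfl)
    refine ⟨t, b, h1, h2, h3.trans (time_le (List.length_pos_iff.2 hw) ?_)⟩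
    rw [length_code]
    exact Nat.le_mul_of_pos_right _ (Nat.succ_pos _)

end FreeSolvable

theorem mainTheorem1 :
    (∃ (P : RAM.Program) (C k : ℕ), ∀ (r d : ℕ) (w : FreeSolvable.Word r),
      ∃ (t : ℕ) (b : Bool), RAM.Halts P (FreeSolvable.inputTape r d w) t b ∧
        (b = true ↔ FreeSolvable.eval r d w = 1) ∧
        t ≤ C * (w.length ^ 2 * Nat.log 2 (w.length + 2) ^ k
              + (FreeSolvable.code w).length * Nat.log 2 ((FreeSolvable.code w).length + 2) ^ k
              + 1)) ∧
    (∀ (r d : ℕ) (g : FreeGroup (Fin r)), g ≠ 1 →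
      (QuotientGroup.mk g : FreeSolvable.S r d) = 1 → 3 ^ d ≤ g.norm) :=
  ⟨⟨_, _, _, FreeSolvable.wordProblem_halts⟩, fun _ d g hg h =>
    FreeSolvable.three_pow_le_norm d g hg ((QuotientGroup.eq_one_iff g).1 h)⟩
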